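/- Let $\Bbbk$ be a field of characteristic $0$. "Graded vector space" means $\mathbb Z$-graded $\Bbbk$-vector space, with Koszul signs; write $\underline n=\{1<\dots<n\}$. **The category $\mathtt{Per}$.** Its objects are the surjections $\alpha:\underline n\twoheadrightarrow\underline k$, $n\ge 1$ (not necessarily order preserving). A morphism from $\alpha':\underline n\twoheadrightarrow\underline k'$ to $\alpha'':\underline n\twoheadrightarrow\underline k''$ is an order-preserving map $\gamma:\underline k'\to\underline k''$ with $\gamma\alpha'=\alpha''$. Its fiber over $i\in\underline k''$ is the surjection $(\gamma\alpha')^{-1}(i)\twoheadrightarrow\gamma^{-1}(i)$ induced by $\alpha'$, renumbered in the order-preserving way. The grade of $\alpha$ is $k-1$; the (chosen) local terminal objects are $U_n:\underline n\twoheadrightarrow\underline 1$, so that the connected components are indexed by $n\ge1$. A morphism $\phi:T\to S$ is elementary, written $F\triangleright_i T\xrightarrow{\phi}S$, if its fiber over $i$ is $F$, $F$ has grade $\ge 1$, and all its other fibers are chosen local terminal objects. Only identities are isomorphisms of $\mathtt{Per}$. **Operads.** A unital Markl $\mathtt{Per}$-operad $M$ consists of graded vector spaces $M(T)$, $T\in\mathtt{Per}$,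 of degree $0$ maps $\circ_\phi:M(S)\otimes M(F)\to M(T)$ for all elementary $F\triangleright_i T\xrightarrow{\phi}S$, and of units $1_n\in M(U_n)_0$, such that: * if $\phi:T\to S$ and $\psi:S\to P$ are elementary with nontrivial fibers $F$ over $i$ and $G$ over $\psi(i)$, so that $\psi\phi$ is elementary with a nontrivial fiber $H$ over $\psi(i)$ and $\phi$ induces an elementary $\phi_H:H\to G$ with nontrivial fiber $F$, then $x\circ_{\psi\phi}(y\circ_{\phi_H}z)=(x\circ_\psi y)\circ_\phi z$; * if $i\ne j$ and $T\xrightarrow{\phi'}P'\xrightarrow{\psi'}S$, $T\xrightarrow{\phi''}P''\xrightarrow{\psi''}S$ are elementary morphisms such that $\psi'$ has the nontrivial fiber $G$ over $j$, $\psi''$ has the nontrivial fiber $F$ over $i$, $\phi'$ has the nontrivial fiber $F$ over a point that $\psi'$ sends to $i$, and $\phi''$ has the nontrivial fiber $G$ over a point that $\psi''$ sends to $j$, then $(x\circ_{\psi'}g)\circ_{\phi'}f=(-1)^{|f||g|}(x\circ_{\psi''}f)\circ_{\phi''}g$; * $1_n\circ_\phi x=x$ for the morphism $\phi:T\to U_n$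 (whose only fiber is $T$), if $T$ has grade $\ge1$. $M$ is $1$-connected if $c\mapsto c\,1_n$ is an isomorphism $\Bbbk\cong M(U_n)$ for all $n$. The terminal operad $\mathsf 1_{\mathtt{Per}}$ has $\mathsf 1_{\mathtt{Per}}(T)=\Bbbk$ for all $T$, with the canonical isomorphisms $\Bbbk\otimes\Bbbk\cong\Bbbk$ as structure operations and units $1\in\Bbbk$. **Quadratic operads and duals.** For a collection $E=\{E(T)\}_{T\in\mathtt{Per}}$ of graded vector spaces with $E(U_n)=0$ for all $n$, let $\mathbb F(E)$ be the free unital Markl operad on $E$, and let $\mathbb F^2(E)(X)=\bigoplus_\phi E(F)\otimes E(S)$, the sum over all elementary $F\triangleright_i X\xrightarrow{\phi}S$ with $S$ of grade $\ge1$, considered in $\mathbb F(E)(X)$ via $e_1\otimes e_2\mapsto(-1)^{|e_1||e_2|}e_2\circ_\phi e_1$. Quadratic data $(E,R)$ consist of such an $E$ and of graded subspaces $R(X)\subset\mathbb F^2(E)(X)$; they present the operad $\mathbb F(E)/(R)$ and are binary if $E(T)=0$ unless $T$ has grade $1$. A $1$-connected operad is binary quadratic if it is isomorphic to $\mathbb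 F(E)/(R)$ for some binary quadratic data. The Koszul dual of the operad presented by $(E,R)$ is $\mathbb F(\uparrow\!E^*)/(R^\perp)$, where $\uparrow\!E^*$ is the suspension of the component-wise graded linear dual of $E$ and $R^\perp$ is the annihilator of $R$ under the pairing of $\mathbb F^2(\uparrow\!E^*)(X)$ with $\mathbb F^2(E)(X)$ for which different summands are orthogonal and $\langle\uparrow\!f\otimes\uparrow\!g\mid a\otimes b\rangle=(-1)^{|\uparrow g||a|}f(a)g(b)$. **Algebras.** An algebra over $M$ is a collection $A=\{A(n)\}_{n\ge1}$ of graded vector spaces with degree $0$ maps $$M(T)\otimes A(n_1)\otimes\cdots\otimes A(n_k)\to A(n),\qquad x\otimes a_1\otimes\cdots\otimes a_k\mapsto x(a_1,\dots,a_k),$$ for all $T:\underline n\twoheadrightarrow\underline k$, $n_j:=|T^{-1}(j)|$, such that $1_n(a)=a$ and, for $F\triangleright_i S\xrightarrow{\phi}T$, $x\in M(T)$, $y\in M(F)$, $$(x\circ_\phi y)(a_1,a_2,\dots)=(-1)^{|y|(|a_1|+\cdots+|a_{i-1}|)}\,x(a_1,\dots,a_{i-1},y(a_i,\dots),\dots).$$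 **Permutads.** A (Loday–Ronco) permutad, in the biased form, is a collection $P=\{P(n)\}_{n\ge1}$ of graded vector spaces with degree $0$ operations $\circ_r:P(n_1)\otimes P(n_2)\to P(n_1+n_2)$ for all surjections $r:\underline n\twoheadrightarrow\underline 2$, $n_i=|r^{-1}(i)|$, such that for each surjection $\alpha:\underline n\twoheadrightarrow\underline 3$ $$\circ_t(\circ_s\otimes\mathrm{id})=\circ_u(\mathrm{id}\otimes\circ_v),$$ where $s=\alpha|_{\alpha^{-1}\{1,2\}}$ and $v=\alpha|_{\alpha^{-1}\{2,3\}}$ (renumbered in the order-preserving way), $t=\nu_{12}\alpha$, $u=\nu_{23}\alpha$, and $\nu_{12},\nu_{23}:\underline3\to\underline2$ are the order-preserving surjections identifying $1,2$, respectively $2,3$. Morphisms of algebras and of permutads are families of degree $0$ linear maps commuting with all operations. **Theorem.** 1. The category of $\mathsf 1_{\mathtt{Per}}$-algebras is isomorphic to the category of permutads. The isomorphism is the identity on the underlying collections and on the underlying maps, and the operation $\circ_r$ is the action of $1\in\Bbbk=\mathsf 1_{\mathtt{Per}}(r)$, for each $r:\underline n\twoheadrightarrow\underline2$. 2. The operad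 $\mathsf 1_{\mathtt{Per}}$ is binary quadratic. 3. $\mathsf 1_{\mathtt{Per}}$ is self-dual in the following sense. For every binary quadratic presentation $\mathsf 1_{\mathtt{Per}}\cong\mathbb F(E)/(R)$, the category of algebras over the Koszul dual $\mathsf 1_{\mathtt{Per}}^!=\mathbb F(\uparrow\!E^*)/(R^\perp)$ is isomorphic to the category of permutads by a functor that acts on the underlying collections and maps as the component-wise suspension $(\uparrow\!A)(n)_d=A(n)_{d-1}$. -/

import Mathlib

open CategoryTheory

namespace PerOperads

/-! ### The operadic category of surjections -/

/-- An object of `Per`: an epimorphism from the ordered set with `n ≥ 1` elements onto the ordered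
set with `k` elements. -/
structure Per where
  n : ℕ+
  k : ℕ
  map : Fin n → Fin k
  surj : Function.Surjective map

namespace Per

/-- A morphism of `Per`: an order-preserving map `base` of the targets, lying under the identity
of the (common) source. -/
structure Hom (T S : Per) where
  n_eq : T.n = S.n
  base : Fin T.k →o Fin S.k
  comm : ∀ x : Fin T.n, base (T.map x) = S.map (Fin.cast (congrArg PNat.val n_eq) x)

instance : Category Per where
  Hom := Hom
  id T := ⟨rfl, OrderHom.id, fun _ => rfl⟩
  comp f g := ⟨f.n_eq.trans g.n_eq, g.base.comp f.base, fun x => by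
    change g.base (f.base _) = _
    rw [f.comm, g.comm]; rfl⟩

/-- There is at most one morphism between two objects of `Per`. -/
instance (T S : Per) : Subsingleton (T ⟶ S) where
  allEq f g := by
    have h : f.base = g.base := by
      apply OrderHom.ext
      funext j
      obtain ⟨x, rfl⟩ := T.surj j
      rw [f.comm, g.comm]
    obtain ⟨_, _, _⟩ : Hom T S := f
    obtain ⟨_, _, _⟩ : Hom T S := g
    cases h; rfl

/-- The only isomorphisms of `Per` are the identities. -/
theorem eq_of_iso {T S : Per} (e : T ≅ S) : T = S := by
  have h1 : ∀ j, e.inv.base (e.hom.base j) = j := fun j =>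
    congrArg (fun f : T ⟶ T => f.base j) e.hom_inv_id
  have h2 : ∀ j, e.hom.base (e.inv.base j) = j := fun j =>
    congrArg (fun f : S ⟶ S => f.base j) e.inv_hom_id
  obtain ⟨n, k, m, hm⟩ := T
  obtain ⟨n', k', m', hm'⟩ := S
  obtain rfl : n = n' := e.hom.n_eq
  obtain rfl : k = k' := by
    have := Fintype.card_congr (⟨e.hom.base, e.inv.base, h1, h2⟩ : Fin k ≃ Fin k')
    simpa using this
  have h3 : ∀ j, e.hom.base j = j := by
    let o : Fin k ≃o Fin k :=
      { toFun := e.hom.base, invFun := e.inv.base, left_inv := h1, right_inv := h2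
        map_rel_iff' := by
          intro a b
          refine ⟨fun h => ?_, fun h => e.hom.base.monotone h⟩
          have := e.inv.base.monotone h
          change e.inv.base (e.hom.base a) ≤ e.inv.base (e.hom.base b) at this
          rwa [h1, h1] at this }
    intro j
    have : o = OrderIso.refl _ := Subsingleton.elim _ _
    exact congrArg (fun p : Fin k ≃o Fin k => p j) this
  obtain rfl : m = m' := by
    funext x
    have := e.hom.comm x
    rw [h3] at this
    exact this
  rfl

/-- The grade `e(n ↠ k) = k - 1`. -/
def grade (T : Per) : ℕ := T.k - 1

/-- The chosen (and only) local terminal object `n ↠ 1` of the `n`-th connected component. -/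
def term (n : ℕ+) : Per where
  n := n
  k := 1
  map _ := 0
  surj _ := ⟨⟨0, n.pos⟩, Subsingleton.elim _ _⟩

section Fiber

variable {T S : Per} (f : T ⟶ S) (i : Fin S.k)

/-- The preimage of `i` in the common source of a morphism. -/
def fiberDom : Finset (Fin T.n) := Finset.univ.filter fun x => f.base (T.map x) = i

/-- The preimage of `i` in the target `{1, …, k'}` of the domain of a morphism. -/
def fiberCod : Finset (Fin T.k) := Finset.univ.filter fun j => f.base j = i

theorem fiberDom_card_pos : 0 < (fiberDom f i).card := by
  obtain ⟨x, hx⟩ := S.surj i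
  refine Finset.card_pos.2 ⟨Fin.cast (congrArg PNat.val f.n_eq).symm x, ?_⟩
  simp only [fiberDom, Finset.mem_filter, Finset.mem_univ, true_and]
  rw [f.comm, ← hx]; rfl

/-- The `i`-th fiber of a morphism of `Per`: the epimorphism which it induces between the preimages
of `i`, where both preimages are renumbered in the order-preserving way. -/
def fiber : Per where
  n := ⟨(fiberDom f i).card, fiberDom_card_pos f i⟩
  k := (fiberCod f i).card
  map x := ((fiberCod f i).orderIsoOfFin rfl).symm
    ⟨T.map ((fiberDom f i).orderEmbOfFin rfl x), by
      have := (fiberDom f i).orderEmbOfFin_mem rfl x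
      simpa [fiberDom, fiberCod] using this⟩
  surj j := by
    obtain ⟨x, hx⟩ := T.surj ((fiberCod f i).orderEmbOfFin rfl j)
    have hj : f.base (T.map x) = i := by
      have := (fiberCod f i).orderEmbOfFin_mem rfl j
      rw [hx]; simpa [fiberCod] using this
    have hx' : x ∈ fiberDom f i := by simp [fiberDom, hj]
    refine ⟨((fiberDom f i).orderIsoOfFin rfl).symm ⟨x, hx'⟩, ?_⟩
    rw [OrderIso.symm_apply_eq]
    apply Subtype.ext
    have h := congrArg Subtype.val
      (((fiberDom f i).orderIsoOfFin rfl).apply_symm_apply ⟨x, hx'⟩)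
    rw [Finset.coe_orderIsoOfFin_apply] at h
    exact (congrArg T.map h).trans (hx.trans (Finset.coe_orderIsoOfFin_apply _ _ _).symm)

end Fiber

/-- The connected component of the `j`-th source of `T`, i.e. of the `j`-th fiber of the identity
of `T`; it is the cardinality of the preimage of `j`. -/
def src (T : Per) (j : Fin T.k) : ℕ+ := (fiber (𝟙 T) j).n

/-- An elementary morphism `F ▷ T → S`: all its fibers are chosen local terminal objects except
for the fiber over `idx`, which is `F` and has grade at least `1`. -/
structure Elem (F T S : Per) where
  hom : T ⟶ S
  idx : Fin S.k
  fiber_idx : fiber hom idx = F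
  grade_pos : 1 ≤ F.grade
  trivial_of_ne : ∀ i, i ≠ idx → ∃ n, fiber hom i = term n

/-- The inclusion of `|F|`, the preimage of `idx`, into `|T|`. -/
def Elem.incl {F T S : Per} (φ : Elem F T S) : Fin F.k ↪o Fin T.k :=
  (fiberCod φ.hom φ.idx).orderEmbOfFin (congrArg Per.k φ.fiber_idx)

end Per

open Per

/-! ### Markl operads over `Per` in graded vector spaces -/

universe u

section Operads

variable (k : Type u) [Field k]

/-- `ℤ`-graded vector spaces. -/
abbrev GrVect := GradedObject ℤ (ModuleCat.{u} k)

/-- The Koszul sign `(-1)^i`. -/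
def sgn (i : ℤ) : k := ((Int.negOnePow i : ℤ) : k)

/-- The data of a unital Markl `Per`-operad, without axioms. A degree `0` map from `A ⊗ B` to `C`
is given by its restrictions to `A_i ⊗ B_j`, with values in `C_d`, `d = i + j`. -/
structure PreOperad where
  obj : Per → GrVect k
  circ : ∀ {F T S : Per} (_ : Elem F T S) {i j d : ℤ} (_ : i + j = d),
    obj S i →ₗ[k] obj F j →ₗ[k] obj T d
  one : ∀ n : ℕ+, obj (term n) 0

/-- A unital Markl `Per`-operad in graded vector spaces. Since all isomorphisms of `Per` are
identities, presheaves on the category of isomorphisms are just families of objects and the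
equivariance axiom is empty; since all local terminal objects are the chosen ones, extended units
are the same as units, and the unit axiom says that the operad is strictly extended unital.
Since morphisms of `Per` are unique when they exist, `ξ` in `joint` is the composite of `φ` and
`ψ`, the object `H` is its nontrivial fiber, and `χ` is the map induced by `φ` on the fibers. -/
structure MarklOperad extends PreOperad k where
  joint : ∀ {F G H T S P : Per} (φ : Elem F T S) (ψ : Elem G S P) (ξ : Elem H T P)
    (χ : Elem F H G), ψ.hom.base φ.idx = ψ.idx →
    ∀ {p q r pq qr d : ℤ} (h₁ : q + r = qr) (h₂ : p + qr = d) (h₃ : p + q = pq) (h₄ : pq + r = d)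
      (x : obj P p) (y : obj G q) (z : obj F r),
      circ ξ h₂ x (circ χ h₁ y z) = circ φ h₄ (circ ψ h₃ x y) z
  disjoint : ∀ {F G T P' P'' S : Per} (φ' : Elem F T P') (ψ' : Elem G P' S)
    (φ'' : Elem G T P'') (ψ'' : Elem F P'' S),
    ψ'.hom.base φ'.idx = ψ''.idx → ψ''.hom.base φ''.idx = ψ'.idx → ψ'.idx ≠ ψ''.idx →
    ∀ {p q r pq pr d : ℤ} (h₁ : p + q = pq) (h₂ : pq + r = d) (h₃ : p + r = pr) (h₄ : pr + q = d)
      (x : obj S p) (g : obj G q) (f : obj F r),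
      circ φ' h₂ (circ ψ' h₁ x g) f = sgn k (q * r) • circ φ'' h₄ (circ ψ'' h₃ x f) g
  one_circ : ∀ {T : Per} {n : ℕ+} (φ : Elem T T (term n)) {d : ℤ} (h : 0 + d = d) (x : obj T d),
    circ φ h (one n) x = x

variable {k}

/-- A morphism of unital Markl operads. -/
@[ext]
structure MarklOperad.Hom (M N : MarklOperad k) where
  app : ∀ (X : Per) (d : ℤ), M.obj X d →ₗ[k] N.obj X d
  map_circ : ∀ {F T S : Per} (φ : Elem F T S) {i j d : ℤ} (h : i + j = d)
    (x : M.obj S i) (y : M.obj F j),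
    app T d (M.circ φ h x y) = N.circ φ h (app S i x) (app F j y)
  map_one : ∀ n : ℕ+, app (term n) 0 (M.one n) = N.one n

instance : Category (MarklOperad k) where
  Hom := MarklOperad.Hom
  id M := ⟨fun _ _ => LinearMap.id, fun _ _ _ _ _ _ _ => rfl, fun _ => rfl⟩
  comp f g := ⟨fun X d => g.app X d ∘ₗ f.app X d,
    fun φ h x y => by simp [f.map_circ, g.map_circ], fun n => by simp [f.map_one, g.map_one]⟩

/-- A Markl operad is `1`-connected if its units are isomorphisms from the ground field (placed in
degree `0`) to its values on the local terminal objects. -/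
def MarklOperad.OneConnected (M : MarklOperad k) : Prop :=
  ∀ n : ℕ+, Function.Bijective (fun c : k => c • M.one n) ∧
    ∀ d : ℤ, d ≠ 0 → Subsingleton (M.obj (term n) d)

variable (k) in
/-- The ground field, placed in degree `0`: its piece of degree `d` is `k` if `d = 0` and `0`
otherwise. -/
def groundField (d : ℤ) : Submodule k k where
  carrier := {x | d ≠ 0 → x = 0}
  zero_mem' _ := rfl
  add_mem' ha hb h := by rw [ha h, hb h, add_zero]
  smul_mem' c x hx h := by rw [hx h, smul_zero]

variable (k) in
/-- The terminal `Per`-operad: all its values are the ground field and all its structure operations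
are the canonical isomorphisms `k ⊗ k ≅ k`. -/
def terminalOperad : MarklOperad k where
  obj _ d := ModuleCat.of k (groundField k d)
  circ {_ _ _} _ {i j d} h := LinearMap.mk₂ k
    (fun (x : groundField k i) (y : groundField k j) =>
      (⟨x.1 * y.1, fun hd => by
        by_cases hi : i = 0
        · rw [y.2 (by omega), mul_zero]
        · rw [x.2 hi, zero_mul]⟩ : groundField k d))
    (fun _ _ _ => Subtype.ext (add_mul _ _ _)) (fun _ _ _ => Subtype.ext (mul_assoc _ _ _))
    (fun _ _ _ => Subtype.ext (mul_add _ _ _))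
    (fun _ _ _ => Subtype.ext (mul_left_comm _ _ _))
  one _ := (⟨1, fun h => absurd rfl h⟩ : groundField k 0)
  joint _ _ _ _ _ _ _ _ _ _ _ _ _ _ _ _ _ _ := Subtype.ext (mul_assoc _ _ _).symm
  disjoint _ _ _ _ _ _ _ _ q r _ _ _ _ _ _ _ x g f := by
    apply Subtype.ext
    change (x.1 * g.1) * f.1 = sgn k (q * r) * ((x.1 * f.1) * g.1)
    by_cases hq : q = 0
    · subst hq; simp [sgn]; ring
    · rw [g.2 hq]; simp
  one_circ _ _ _ _ := Subtype.ext (one_mul _)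

/-! ### Ideals, quotients and free operads -/

/-- An ideal: a family of graded subspaces closed under the circle products with arbitrary
elements, from both sides. -/
structure PreOperad.Ideal (M : PreOperad k) where
  carrier : ∀ (X : Per) (d : ℤ), Submodule k (M.obj X d)
  circ_left : ∀ {F T S : Per} (φ : Elem F T S) {i j d : ℤ} (h : i + j = d)
    (x : M.obj S i) (y : M.obj F j), x ∈ carrier S i → M.circ φ h x y ∈ carrier T d
  circ_right : ∀ {F T S : Per} (φ : Elem F T S) {i j d : ℤ} (h : i + j = d)
    (x : M.obj S i) (y : M.obj F j), y ∈ carrier F j → M.circ φ h x y ∈ carrier T d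

/-- The ideal generated by `R`: the component-wise intersection of all ideals containing `R`. -/
def PreOperad.Ideal.gen (M : PreOperad k) (R : ∀ (X : Per) (d : ℤ), Set (M.obj X d)) :
    M.Ideal where
  carrier X d := ⨅ I : {I : M.Ideal // ∀ Y e, R Y e ⊆ I.carrier Y e}, I.1.carrier X d
  circ_left φ _ _ _ h x y hx := by
    rw [Submodule.mem_iInf] at hx ⊢
    exact fun I => I.1.circ_left φ h x y (hx I)
  circ_right φ _ _ _ h x y hy := by
    rw [Submodule.mem_iInf] at hy ⊢
    exact fun I => I.1.circ_right φ h x y (hy I)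

theorem PreOperad.Ideal.subset_gen (M : PreOperad k) (R : ∀ (X : Per) (d : ℤ), Set (M.obj X d))
    {X : Per} {d : ℤ} {x : M.obj X d} (hx : x ∈ R X d) : x ∈ (gen M R).carrier X d :=
  (Submodule.mem_iInf _).2 fun I => I.2 X d hx

/-- The quotient by an ideal. -/
def PreOperad.quotient (M : PreOperad k) (I : M.Ideal) : PreOperad k where
  obj X d := ModuleCat.of k (M.obj X d ⧸ I.carrier X d)
  circ {F T S} φ {i j d} h := (I.carrier S i).liftQ
    { toFun := fun x => (I.carrier F j).mapQ (I.carrier T d) (M.circ φ h x)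
        (fun y hy => I.circ_right φ h x y hy)
      map_add' := fun x x' => by ext y; simp
      map_smul' := fun c x => by ext y; simp }
    (fun x hx => by
      rw [LinearMap.mem_ker]
      ext y
      exact (Submodule.Quotient.mk_eq_zero _).2 (I.circ_left φ h x y hx))
  one n := Submodule.Quotient.mk (M.one n)

/-- The quotient of a Markl operad by an ideal. -/
def MarklOperad.quotient (M : MarklOperad k) (I : M.toPreOperad.Ideal) : MarklOperad k where
  toPreOperad := M.toPreOperad.quotient I
  joint φ ψ ξ χ hi p q r pq qr d h₁ h₂ h₃ h₄ x y z := by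
    obtain ⟨x, rfl⟩ := Submodule.Quotient.mk_surjective _ x
    obtain ⟨y, rfl⟩ := Submodule.Quotient.mk_surjective _ y
    obtain ⟨z, rfl⟩ := Submodule.Quotient.mk_surjective _ z
    exact congrArg Submodule.Quotient.mk (M.joint φ ψ ξ χ hi h₁ h₂ h₃ h₄ x y z)
  disjoint φ' ψ' φ'' ψ'' hi hj hij p q r pq pr d h₁ h₂ h₃ h₄ x y z := by
    obtain ⟨x, rfl⟩ := Submodule.Quotient.mk_surjective _ x
    obtain ⟨y, rfl⟩ := Submodule.Quotient.mk_surjective _ y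
    obtain ⟨z, rfl⟩ := Submodule.Quotient.mk_surjective _ z
    exact congrArg Submodule.Quotient.mk
      (M.disjoint φ' ψ' φ'' ψ'' hi hj hij h₁ h₂ h₃ h₄ x y z)
  one_circ φ d h x := by
    obtain ⟨x, rfl⟩ := Submodule.Quotient.mk_surjective _ x
    exact congrArg Submodule.Quotient.mk (M.one_circ φ h x)

/-- Formal composites of elements of a collection `E` and of units. -/
inductive Tree (E : Per → GrVect k) : Per → ℤ → Type u
  | one (n : ℕ+) : Tree E (term n) 0
  | gen {X : Per} {d : ℤ} (e : E X d) : Tree E X d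
  | circ {F T S : Per} (φ : Elem F T S) {i j d : ℤ} (h : i + j = d)
      (a : Tree E S i) (b : Tree E F j) : Tree E T d

/-- Formal linear combinations of formal composites. -/
noncomputable def treeOperad (E : Per → GrVect k) : PreOperad k where
  obj X d := ModuleCat.of k (Tree E X d →₀ k)
  circ {F T S} φ {i j d} h := Finsupp.lsum k fun a : Tree E S i =>
    LinearMap.toSpanSingleton k ((Tree E F j →₀ k) →ₗ[k] (Tree E T d →₀ k))
      (Finsupp.lmapDomain k k fun b => Tree.circ φ h a b)
  one n := Finsupp.single (Tree.one n) 1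

/-- A generator as a formal composite. -/
noncomputable def treeGen (E : Per → GrVect k) {X : Per} {d : ℤ} (e : E X d) :
    (treeOperad E).obj X d :=
  (Finsupp.single (Tree.gen e) 1 : Tree E X d →₀ k)

/-- The relations imposed on formal composites: linearity in the generators and the axioms of
Markl operads. -/
inductive FreeRel (E : Per → GrVect k) : ∀ (X : Per) (d : ℤ), (treeOperad E).obj X d → Prop
  | add {X : Per} {d : ℤ} (e e' : E X d) :
      FreeRel E X d (treeGen E (e + e') - (treeGen E e + treeGen E e'))
  | smul {X : Per} {d : ℤ} (c : k) (e : E X d) :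
      FreeRel E X d (treeGen E (c • e) - c • treeGen E e)
  | joint {F G H T S P : Per} (φ : Elem F T S) (ψ : Elem G S P) (ξ : Elem H T P)
      (χ : Elem F H G) (_ : ψ.hom.base φ.idx = ψ.idx)
      {p q r pq qr d : ℤ} (h₁ : q + r = qr) (h₂ : p + qr = d) (h₃ : p + q = pq) (h₄ : pq + r = d)
      (x : (treeOperad E).obj P p) (y : (treeOperad E).obj G q) (z : (treeOperad E).obj F r) :
      FreeRel E T d ((treeOperad E).circ ξ h₂ x ((treeOperad E).circ χ h₁ y z) -
        (treeOperad E).circ φ h₄ ((treeOperad E).circ ψ h₃ x y) z)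
  | disjoint {F G T P' P'' S : Per} (φ' : Elem F T P') (ψ' : Elem G P' S)
      (φ'' : Elem G T P'') (ψ'' : Elem F P'' S) (_ : ψ'.hom.base φ'.idx = ψ''.idx)
      (_ : ψ''.hom.base φ''.idx = ψ'.idx) (_ : ψ'.idx ≠ ψ''.idx)
      {p q r pq pr d : ℤ} (h₁ : p + q = pq) (h₂ : pq + r = d) (h₃ : p + r = pr) (h₄ : pr + q = d)
      (x : (treeOperad E).obj S p) (g : (treeOperad E).obj G q) (f : (treeOperad E).obj F r) :
      FreeRel E T d ((treeOperad E).circ φ' h₂ ((treeOperad E).circ ψ' h₁ x g) f -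
        sgn k (q * r) • (treeOperad E).circ φ'' h₄ ((treeOperad E).circ ψ'' h₃ x f) g)
  | one_circ {T : Per} {n : ℕ+} (φ : Elem T T (term n)) {d : ℤ} (h : 0 + d = d)
      (x : (treeOperad E).obj T d) :
      FreeRel E T d ((treeOperad E).circ φ h ((treeOperad E).one n) x - x)

/-- The ideal of relations in the formal composites. -/
noncomputable def freeIdeal (E : Per → GrVect k) : (treeOperad E).Ideal :=
  PreOperad.Ideal.gen (treeOperad E) fun X d => {x | FreeRel E X d x}

/-- The free unital Markl operad `𝔽(E)` generated by the collection `E`. -/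
noncomputable def freeOperad (E : Per → GrVect k) : MarklOperad k where
  toPreOperad := (treeOperad E).quotient (freeIdeal E)
  joint φ ψ ξ χ hi p q r pq qr d h₁ h₂ h₃ h₄ x y z := by
    obtain ⟨x, rfl⟩ := Submodule.Quotient.mk_surjective _ x
    obtain ⟨y, rfl⟩ := Submodule.Quotient.mk_surjective _ y
    obtain ⟨z, rfl⟩ := Submodule.Quotient.mk_surjective _ z
    exact (Submodule.Quotient.eq _).2 (PreOperad.Ideal.subset_gen _ _
      (FreeRel.joint φ ψ ξ χ hi h₁ h₂ h₃ h₄ x y z))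
  disjoint φ' ψ' φ'' ψ'' hi hj hij p q r pq pr d h₁ h₂ h₃ h₄ x y z := by
    obtain ⟨x, rfl⟩ := Submodule.Quotient.mk_surjective _ x
    obtain ⟨y, rfl⟩ := Submodule.Quotient.mk_surjective _ y
    obtain ⟨z, rfl⟩ := Submodule.Quotient.mk_surjective _ z
    exact (Submodule.Quotient.eq _).2 (PreOperad.Ideal.subset_gen _ _
      (FreeRel.disjoint φ' ψ' φ'' ψ'' hi hj hij h₁ h₂ h₃ h₄ x y z))
  one_circ φ d h x := by
    obtain ⟨x, rfl⟩ := Submodule.Quotient.mk_surjective _ x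
    exact (Submodule.Quotient.eq _).2 (PreOperad.Ideal.subset_gen _ _ (FreeRel.one_circ φ h x))

/-- The inclusion of the generators into the free operad. -/
noncomputable def freeGen (E : Per → GrVect k) (X : Per) (d : ℤ) :
    E X d →ₗ[k] (freeOperad E).obj X d where
  toFun e := ((freeIdeal E).carrier X d).mkQ (treeGen E e)
  map_add' e e' := (Submodule.Quotient.eq _).2
    (PreOperad.Ideal.subset_gen _ _ (FreeRel.add e e'))
  map_smul' c e := (Submodule.Quotient.eq _).2
    (PreOperad.Ideal.subset_gen _ _ (FreeRel.smul c e))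

/-! ### Quadratic operads and Koszul duals -/

/-- A tower of height two with the initial term `X`: an elementary morphism `X → S` whose
nontrivial fiber is `F`, with degrees `i + j = d` assigned to `F` and `S`. Its fiber sequence is
`F, S`. -/
structure Tower₂ (X : Per) (d : ℤ) where
  F : Per
  S : Per
  φ : Elem F X S
  grade_pos : 1 ≤ S.grade
  i : ℤ
  j : ℤ
  deg : i + j = d

/-- The degree `d` piece of `𝔽²(E)(X)`, the direct sum of `E[F] ⊗ E[S]` over all towers of height
two with the initial term `X`. -/
abbrev FreeQuad (E : Per → GrVect k) (X : Per) (d : ℤ) : Type u :=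
  DirectSum (Tower₂ X d) fun t => TensorProduct k (E t.F t.i) (E t.S t.j)

open Classical in
/-- The inclusion of `𝔽²(E)` into the free operad: it sends `e₁ ⊗ e₂ ∈ E[F] ⊗ E[S]` to
`(-1)^{|e₁||e₂|} e₂ ∘_φ e₁`. -/
noncomputable def FreeQuad.toFree (E : Per → GrVect k) (X : Per) (d : ℤ) :
    FreeQuad E X d →ₗ[k] (freeOperad E).obj X d :=
  DirectSum.toModule k (Tower₂ X d) _ fun t => TensorProduct.lift
    (sgn k (t.i * t.j) • (((freeOperad E).circ t.φ ((add_comm _ _).trans t.deg)).compl₁₂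
      (freeGen E t.S t.j) (freeGen E t.F t.i)).flip)

variable (k) in
/-- Quadratic data: a `1`-connected collection `E` together with a family `R` of graded subspaces
of `𝔽²(E)`. -/
structure QuadraticData where
  E : Per → GrVect k
  oneConnected : ∀ (T : Per) (d : ℤ), T.grade = 0 → Subsingleton (E T d)
  R : ∀ (X : Per) (d : ℤ), Submodule k (FreeQuad E X d)

namespace QuadraticData

variable (D : QuadraticData k)

/-- The quadratic operad `𝔽(E)/(R)`. -/
noncomputable def operad : MarklOperad k :=
  (freeOperad D.E).quotient (PreOperad.Ideal.gen _ fun X d => FreeQuad.toFree D.E X d '' D.R X d)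

/-- Quadratic data are binary if the generators are concentrated in grade `1`. -/
def IsBinary : Prop := ∀ (T : Per) (d : ℤ), Nontrivial (D.E T d) → T.grade = 1

end QuadraticData

/-- The suspension `↑E^*` of the component-wise graded linear dual of a collection `E`: the piece
of degree `d` is the linear dual of the piece of `E` of degree `1 - d`. -/
def suspDual (E : Per → GrVect k) : Per → GrVect k := fun X d =>
  ModuleCat.of k (Module.Dual k (E X (1 - d)))

open Classical in
/-- The pairing of `𝔽²(↑E^*)(X)` with `𝔽²(E)(X)`, on homogeneous pieces of complementary
degrees. Pieces indexed by different towers are orthogonal; for the same tower it is the evaluation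
`⟨↑f ⊗ ↑g | a ⊗ b⟩ = (-1)^{|↑g||a|} f(a) g(b)`. -/
noncomputable def quadPairing (E : Per → GrVect k) (X : Per) (d : ℤ) :
    FreeQuad (suspDual E) X d →ₗ[k] Module.Dual k (FreeQuad E X (2 - d)) :=
  DirectSum.toModule k (Tower₂ X d) _ fun t =>
    let t' : Tower₂ X (2 - d) :=
      ⟨t.F, t.S, t.φ, t.grade_pos, 1 - t.i, 1 - t.j, by have := t.deg; omega⟩
    sgn k (t.j * (1 - t.i)) •
      (LinearMap.lcomp k k (DirectSum.component k (Tower₂ X (2 - d))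
        (fun s => TensorProduct k (E s.F s.i) (E s.S s.j)) t')) ∘ₗ
      TensorProduct.dualDistrib k (E t.F (1 - t.i)) (E t.S (1 - t.j))

/-- The quadratic data `(↑E^*, R^⊥)`, where `R^⊥` is the annihilator of `R`. -/
noncomputable def QuadraticData.dual (D : QuadraticData k) : QuadraticData k where
  E := suspDual D.E
  oneConnected T d h := by
    have := D.oneConnected T (1 - d) h
    change Subsingleton (Module.Dual k (D.E T (1 - d)))
    infer_instance
  R X d :=
    { carrier := {θ | ∀ x ∈ D.R X (2 - d), quadPairing D.E X d θ x = 0}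
      zero_mem' := fun x _ => by simp
      add_mem' := fun h h' x hx => by simp [h x hx, h' x hx]
      smul_mem' := fun c θ h x hx => by simp [h x hx] }

/-- The Koszul dual `𝔽(↑E^*)/(R^⊥)` of the quadratic operad presented by the given data. -/
noncomputable def QuadraticData.koszulDual (D : QuadraticData k) : MarklOperad k := D.dual.operad

/-- A `1`-connected Markl operad is binary quadratic if it is isomorphic to `𝔽(E)/(R)` for some
binary quadratic data. -/
def MarklOperad.IsBinaryQuadratic (M : MarklOperad k) : Prop :=
  M.OneConnected ∧ ∃ D : QuadraticData k, D.IsBinary ∧ Nonempty (D.operad ≅ M)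

/-! ### Algebras over Markl operads -/

variable (k) in
/-- Collections of graded vector spaces indexed by the connected components `n ≥ 1` of `Per`. -/
abbrev Coll := ℕ+ → GrVect k

/-- Homogeneous elements of a collection. -/
abbrev Coll.Elt (A : Coll k) := Σ (n : ℕ+) (d : ℤ), A n d

/-- A homogeneous element of a collection, with its component and its degree recorded. -/
abbrev Coll.elt (A : Coll k) {n : ℕ+} {d : ℤ} (a : A n d) : A.Elt := ⟨n, d, a⟩

/-- The structure of an algebra over a Markl operad `M` on a collection `A`. The element
`x(a₁, …, a_s)` is `act T hn hc hD x a`; here `c` and `d` list the components and the degrees of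
`a₁, …, a_s`, while `n` and `D` are the component and the degree of the result. In `assoc`, for an
elementary `F ▷ S → T` and a family `a` of elements labelled by `|S|`, the family `b` labelled by
`|T|` is obtained from `a` by replacing the part of `a` lying over `φ.idx` by the single element
`y(a_i, …)`. Equivariance is empty since all isomorphisms of `Per` are identities. -/
structure AlgebraStr (M : MarklOperad k) (A : Coll k) where
  act : ∀ (T : Per) {n : ℕ+} (_ : T.n = n) {c : Fin T.k → ℕ+} (_ : ∀ j, T.src j = c j)
    {p : ℤ} {d : Fin T.k → ℤ} {D : ℤ} (_ : p + ∑ j, d j = D),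
    M.obj T p →ₗ[k] MultilinearMap k (fun j => A (c j) (d j)) (A n D)
  unit : ∀ {n : ℕ+} (hc : ∀ j, (term n).src j = n) {d : ℤ} (hD : 0 + ∑ _j : Fin (term n).k, d = d)
    (a : A n d), act (term n) rfl hc hD (M.one n) (fun _ => a) = a
  assoc : ∀ {F S T : Per} (φ : Elem F S T) {p q r : ℤ} (hr : p + q = r)
    (x : M.obj T p) (y : M.obj F q) {n : ℕ+} (hS : S.n = n) (hT : T.n = n)
    {c : Fin S.k → ℕ+} (hc : ∀ j, S.src j = c j) {d : Fin S.k → ℤ} {D : ℤ}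
    (hD : r + ∑ j, d j = D) (a : ∀ j, A (c j) (d j))
    (hcF : ∀ l, F.src l = c (φ.incl l)) {D' : ℤ} (hD' : q + ∑ l, d (φ.incl l) = D')
    (b : Fin T.k → A.Elt)
    (_ : b φ.idx = A.elt (act F rfl hcF hD' y fun l => a (φ.incl l)))
    (_ : ∀ j, φ.hom.base j ≠ φ.idx → b (φ.hom.base j) = A.elt (a j))
    (hcT : ∀ t, T.src t = (b t).1) (hDT : p + ∑ t, (b t).2.1 = D),
    act S hS hc hD (M.circ φ hr x y) a =
      sgn k (q * ∑ j with φ.hom.base j < φ.idx, d j) • act T hT hcT hDT x fun t => (b t).2.2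

/-- An algebra over a Markl operad. -/
structure Algebra (M : MarklOperad k) where
  coll : Coll k
  str : AlgebraStr M coll

/-- A morphism of algebras: a morphism of the underlying collections commuting with the structure
operations. -/
@[ext]
structure Algebra.Hom {M : MarklOperad k} (A B : Algebra M) where
  map : A.coll ⟶ B.coll
  map_act : ∀ (T : Per) {n : ℕ+} (hn : T.n = n) {c : Fin T.k → ℕ+} (hc : ∀ j, T.src j = c j)
    {p : ℤ} {d : Fin T.k → ℤ} {D : ℤ} (hD : p + ∑ j, d j = D) (x : M.obj T p)
    (a : ∀ j, A.coll (c j) (d j)),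
    map n D (A.str.act T hn hc hD x a) =
      B.str.act T hn hc hD x fun j => map (c j) (d j) (a j)

instance (M : MarklOperad k) : Category (Algebra M) where
  Hom := Algebra.Hom
  id A := ⟨𝟙 A.coll, fun _ _ _ _ _ _ _ _ _ _ _ => rfl⟩
  comp f g := ⟨f.map ≫ g.map, fun T n hn c hc p d D hD x a =>
    (congrArg (g.map n D) (f.map_act T hn hc hD x a)).trans (g.map_act T hn hc hD x _)⟩

/-- The underlying collection of an algebra. -/
def Algebra.forget (M : MarklOperad k) : Algebra M ⥤ Coll k where
  obj A := A.coll
  map f := f.map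

/-! ### Permutads -/

/-- The number of elements which a map sends to `i`. -/
def fibCard {n m : ℕ} (r : Fin n → Fin m) (i : Fin m) : ℕ :=
  (Finset.univ.filter fun x => r x = i).card

/-- The restriction of a map to an `m`-element subset of `{1, …, n}`, renumbered in the
order-preserving way. -/
def restr {n m : ℕ} {β : Type} (r : Fin n → β) (s : Finset (Fin n)) (h : s.card = m) :
    Fin m → β := fun x => r (s.orderEmbOfFin h x)

/-- The structure of a permutad on a collection `P`: for each epimorphism `r` from `{1, …, n}` onto
a two-element set, with preimages of cardinalities `n₁` and `n₂`, an operation `∘_r` from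
`P(n₁) ⊗ P(n₂)` to `P(n)`. Each epimorphism `α` onto the three-element set `{0, 1, 2}` gives rise
to the associativity `(a ∘_s b) ∘_t c = a ∘_u (b ∘_v c)`, where `s` and `v` are the restrictions of
`α` to the preimages of `{0, 1}` and `{1, 2}`, and where `t` and `u` identify `0` with `1`,
respectively `1` with `2`. -/
structure PermutadStr (P : Coll k) where
  op : ∀ {n n₁ n₂ : ℕ+} (r : Fin n → Fin 2) (_ : fibCard r 0 = n₁) (_ : fibCard r 1 = n₂)
    {i j d : ℤ} (_ : i + j = d), P n₁ i →ₗ[k] P n₂ j →ₗ[k] P n d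
  assoc : ∀ {n n₁ n₂ n₃ n₁₂ n₂₃ : ℕ+} (α : Fin n → Fin 3)
    (h₁₂ : (Finset.univ.filter fun x => α x ≠ 2).card = n₁₂)
    (h₂₃ : (Finset.univ.filter fun x => α x ≠ 0).card = n₂₃)
    (s : Fin n₁₂ → Fin 2) (_ : s = restr (fun x => if α x = 0 then 0 else 1) _ h₁₂)
    (t : Fin n → Fin 2) (_ : t = fun x => if α x = 2 then 1 else 0)
    (u : Fin n → Fin 2) (_ : u = fun x => if α x = 0 then 0 else 1)
    (v : Fin n₂₃ → Fin 2) (_ : v = restr (fun x => if α x = 2 then 1 else 0) _ h₂₃)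
    (s₀ : fibCard s 0 = n₁) (s₁ : fibCard s 1 = n₂) (t₀ : fibCard t 0 = n₁₂)
    (t₁ : fibCard t 1 = n₃) (u₀ : fibCard u 0 = n₁) (u₁ : fibCard u 1 = n₂₃)
    (v₀ : fibCard v 0 = n₂) (v₁ : fibCard v 1 = n₃)
    {i j l ij jl d : ℤ} (hij : i + j = ij) (hijl : ij + l = d) (hjl : j + l = jl)
    (hijl' : i + jl = d) (a : P n₁ i) (b : P n₂ j) (c : P n₃ l),
    op t t₀ t₁ hijl (op s s₀ s₁ hij a b) c = op u u₀ u₁ hijl' a (op v v₀ v₁ hjl b c)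

variable (k) in
/-- A permutad in graded vector spaces. -/
structure Permutad where
  coll : Coll k
  str : PermutadStr coll

/-- A morphism of permutads. -/
@[ext]
structure Permutad.Hom (P Q : Permutad k) where
  map : P.coll ⟶ Q.coll
  map_op : ∀ {n n₁ n₂ : ℕ+} (r : Fin n → Fin 2) (h₁ : fibCard r 0 = n₁) (h₂ : fibCard r 1 = n₂)
    {i j d : ℤ} (h : i + j = d) (a : P.coll n₁ i) (b : P.coll n₂ j),
    map n d (P.str.op r h₁ h₂ h a b) = Q.str.op r h₁ h₂ h (map n₁ i a) (map n₂ j b)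

instance : Category (Permutad k) where
  Hom := Permutad.Hom
  id P := ⟨𝟙 P.coll, fun _ _ _ _ _ _ _ _ _ => rfl⟩
  comp f g := ⟨f.map ≫ g.map, fun {n _ _} r h₁ h₂ {_ _ d} h a b =>
    (congrArg (g.map n d) (f.map_op r h₁ h₂ h a b)).trans (g.map_op r h₁ h₂ h _ _)⟩

variable (k) in
/-- The underlying collection of a permutad. -/
def Permutad.forget : Permutad k ⥤ Coll k where
  obj P := P.coll
  map f := f.map

variable (k) in
/-- The component-wise suspension of collections, `(↑A)(n)_d = A(n)_{d-1}`. -/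
def suspension : Coll k ⥤ Coll k where
  obj A n d := A n (d - 1)
  map f n d := f n (d - 1)

end Operads

/-- A functor is an isomorphism of categories if it has a strict inverse. -/
def IsIsoOfCategories {C D : Type*} [Category C] [Category D] (Φ : C ⥤ D) : Prop :=
  ∃ Ψ : D ⥤ C, Φ ⋙ Ψ = 𝟭 C ∧ Ψ ⋙ Φ = 𝟭 D

end PerOperads

/-! Call an operad `M` free on elements `m T` of degree `ε`, one for each surjection `T` onto two
points, if it is generated by them subject only to the relation `(ab)c = (-1)^ε a(bc)` over each
surjection onto three points (`IsFreeOn`). An algebra structure over `M` on a collection `A` is a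
morphism from `M` to the endomorphism operad of `A`; for such `M` this is a family of binary
operations of degree `ε` satisfying the relation. Raising the degrees of `A` by `ε` makes the
operations homogeneous of degree `0`, and the twist by `(-1)^{ε|a|}` turns the relation into strict
associativity (`sgn_assoc`, `binOp_assoc_iff`). Algebras are thus permutads, literally for `ε = 0`
and after one suspension for `ε = 1`. It remains to see that the terminal operad is free with `ε =
0`, and the Koszul dual of each of its binary quadratic presentations with `ε = 1`.

Terminal operad: an elementary morphism contracts an interval of at least two points to a point, so
composites of generators are bracketings of an ordered word. Any two bracketings agree, by a diamond
argument on the contractions peeled off first: these coincide, or they overlap in one point and the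
relation applies, or they are disjoint and the axiom for disjoint fibers applies (`IsMono.unique`).
There is exactly one monomial over each surjection, as in the terminal operad.

Koszul dual: the data `(E, R)` have to be recovered from the operad that they present. Truncation to
weight at most two is an operad in which `E` and `𝔽²(E)/R` are visible, so generators embed and `R`
is the full kernel of the evaluation (`gen_injective`, `mem_R_of_quadEval_gen`). If the operad is
terminal, `E` is therefore a line in degree `0` over each surjection onto two points, and over three
points `R` is the line spanned by `(1, -1)` in the plane with basis `(ab)c`, `a(bc)`
(`exists_relSpec`). Its annihilator is spanned by `(1, 1)`, and the dual generators have degree `1`;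
this is the relation for `ε = 1` (`RelSpec.dual`). -/

namespace PerOperads

/-! ### Elementary morphisms as contractions of intervals -/

namespace Per

/-- The underlying map of the order-preserving surjection which contracts the interval
`{i, …, i + m - 1}` to a point. -/
def contr (i m j : ℕ) : ℕ := min j i + (j + 1 - (i + m))

theorem one_le_k (T : Per) : 1 ≤ T.k :=
  Nat.succ_le_of_lt (lt_of_le_of_lt (Nat.zero_le _) (T.map ⟨0, T.n.pos⟩).2)

theorem eq_term {T : Per} (h : T.k = 1) : T = term T.n := by
  obtain ⟨n, k, f, hf⟩ := T
  obtain rfl : k = 1 := h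
  obtain rfl : f = fun _ => 0 := funext fun x => Subsingleton.elim _ _
  rfl

theorem fiber_k {T S : Per} (f : T ⟶ S) (i : Fin S.k) :
    (fiber f i).k = (fiberCod f i).card := rfl

theorem Elem.two_le {F T S : Per} (φ : Elem F T S) : 2 ≤ F.k := by
  have := φ.grade_pos
  unfold grade at this
  omega

theorem Elem.card_idx {F T S : Per} (φ : Elem F T S) : (fiberCod φ.hom φ.idx).card = F.k :=
  congrArg Per.k φ.fiber_idx

theorem Elem.card_of_ne {F T S : Per} (φ : Elem F T S) {i : Fin S.k} (h : i ≠ φ.idx) :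
    (fiberCod φ.hom i).card = 1 := by
  obtain ⟨n, hn⟩ := φ.trivial_of_ne i h
  exact congrArg Per.k hn

/-- Induction on `t`: each step adds the fiber over `t`, which has `m` points for `t = i` and one
point otherwise. These counts determine a monotone map, because preimages of initial segments are
initial segments. -/
theorem card_filter_lt {a b : ℕ} (f : Fin a →o Fin b) (i : Fin b) {m : ℕ} (hm : 1 ≤ m)
    (h1 : (Finset.univ.filter fun j => f j = i).card = m)
    (h2 : ∀ t, t ≠ i → (Finset.univ.filter fun j => f j = t).card = 1) (t : ℕ) (ht : t ≤ b) :
    (Finset.univ.filter fun j => (f j).val < t).card = if i.val < t then t + m - 1 else t := by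
  induction t with
  | zero => simp
  | succ t ih =>
    have h : (Finset.univ.filter fun j => (f j).val < t + 1) =
        (Finset.univ.filter fun j => (f j).val < t) ∪
          (Finset.univ.filter fun j => f j = ⟨t, ht⟩) := by
      ext j
      simp only [Finset.mem_filter, Finset.mem_univ, true_and, Finset.mem_union, Fin.ext_iff]
      omega
    rw [h, Finset.card_union_of_disjoint, ih (by omega)]
    · by_cases hi : (⟨t, ht⟩ : Fin b) = i
      · subst hi
        rw [h1]
        simp only [lt_irrefl, if_false]
        rw [if_pos (by omega)]
        omega
      · rw [h2 _ hi]
        have : t ≠ i.val := fun h => hi (Fin.ext h)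
        split_ifs <;> omega
    · rw [Finset.disjoint_left]
      intro j
      simp only [Finset.mem_filter, Finset.mem_univ, true_and, Fin.ext_iff]
      omega

/-- A monotone map whose fibers are points, except for one of cardinality `m`, is a contraction of
an interval. -/
theorem orderHom_eq_contr {a b : ℕ} (f : Fin a →o Fin b) (i : Fin b) {m : ℕ} (hm : 1 ≤ m)
    (h1 : (Finset.univ.filter fun j => f j = i).card = m)
    (h2 : ∀ t, t ≠ i → (Finset.univ.filter fun j => f j = t).card = 1) :
    a + 1 = b + m ∧ ∀ j, (f j).val = contr i m j := by
  have hc := card_filter_lt f i hm h1 h2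
  constructor
  · have := hc b le_rfl
    rw [Finset.filter_true_of_mem fun j _ => (f j).2] at this
    simp only [Finset.card_univ, Fintype.card_fin, i.2, if_true] at this
    omega
  · intro j
    -- By monotonicity the points sent strictly below `f j` precede `j`, while all points up to `j`
    -- are sent to at most `f j`. The two counts squeeze the value of `f j`.
    have h3 : (Finset.univ.filter fun j' => (f j').val < (f j).val).card ≤ j := by
      calc _ ≤ (Finset.Iio j).card := Finset.card_le_card fun j' hj' => by
            simp only [Finset.mem_filter, Finset.mem_univ, true_and] at hj'
            rw [Finset.mem_Iio]
            by_contra h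
            exact absurd (f.monotone (not_lt.1 h)) (not_le.2 hj')
        _ = j := Fin.card_Iio j
    have h4 : j + 1 ≤ (Finset.univ.filter fun j' => (f j').val < (f j).val + 1).card := by
      calc j.val + 1 = (Finset.Iic j).card := (Fin.card_Iic j).symm
        _ ≤ _ := Finset.card_le_card fun j' hj' => by
            simp only [Finset.mem_filter, Finset.mem_univ, true_and]
            exact Nat.lt_succ_of_le (f.monotone (Finset.mem_Iic.1 hj'))
    have hj := (f j).2
    rw [hc _ (by omega)] at h3 h4
    unfold contr
    have hi := i.2
    split_ifs at h3 h4 <;> omega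

section Elem

variable {F T S : Per} (φ : Elem F T S)

theorem Elem.k_eq {F T S : Per} (φ : Elem F T S) : T.k + 1 = S.k + F.k :=
  (orderHom_eq_contr φ.hom.base φ.idx (le_trans one_le_two φ.two_le) φ.card_idx
    fun _ h => φ.card_of_ne h).1

theorem Elem.base_val (j : Fin T.k) : (φ.hom.base j).val = contr φ.idx F.k j :=
  (orderHom_eq_contr φ.hom.base φ.idx (le_trans one_le_two φ.two_le) φ.card_idx
    fun _ h => φ.card_of_ne h).2 j

theorem Elem.idx_add_le : φ.idx.val + F.k ≤ T.k := by
  have := φ.k_eq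
  have := φ.idx.2
  omega

theorem Elem.incl_val (l : Fin F.k) : (φ.incl l).val = φ.idx.val + l.val := by
  have h := φ.idx_add_le
  have h2 := φ.two_le
  have := Finset.orderEmbOfFin_unique (s := fiberCod φ.hom φ.idx) (congrArg Per.k φ.fiber_idx)
    (f := fun l : Fin F.k => (⟨φ.idx.val + l.val, by omega⟩ : Fin T.k))
    (fun l => by
      simp only [fiberCod, Finset.mem_filter, Finset.mem_univ, true_and]
      apply Fin.ext
      rw [φ.base_val]
      simp only [contr]
      omega)
    (fun a b hab => by
      rw [Fin.lt_def] at hab ⊢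
      simpa using hab)
  exact (congrArg Fin.val (congrFun this l)).symm

theorem Elem.base_eq_idx_iff (j : Fin T.k) :
    φ.hom.base j = φ.idx ↔ φ.idx.val ≤ j.val ∧ j.val < φ.idx.val + F.k := by
  have h2 := φ.two_le
  rw [Fin.ext_iff, φ.base_val, contr]
  omega

theorem Elem.base_incl (l : Fin F.k) : φ.hom.base (φ.incl l) = φ.idx := by
  rw [φ.base_eq_idx_iff, φ.incl_val]
  omega

theorem Elem.exists_incl {j : Fin T.k} (h : φ.hom.base j = φ.idx) : ∃ l, φ.incl l = j := by
  rw [φ.base_eq_idx_iff] at h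
  refine ⟨⟨j.val - φ.idx.val, by omega⟩, Fin.ext ?_⟩
  rw [φ.incl_val]
  simp only
  omega

/-- The inclusion of the source of the nontrivial fiber. -/
def Elem.emb : Fin F.n ↪o Fin T.n :=
  (fiberDom φ.hom φ.idx).orderEmbOfFin (congrArg (fun X : Per => X.n.val) φ.fiber_idx)

theorem Elem.range_emb : Set.range φ.emb = {x | φ.hom.base (T.map x) = φ.idx} := by
  refine (Finset.range_orderEmbOfFin (fiberDom φ.hom φ.idx)
    (congrArg (fun X : Per => X.n.val) φ.fiber_idx)).trans ?_
  ext x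
  simp [fiberDom]

theorem Elem.map_emb (x : Fin F.n) : T.map (φ.emb x) = φ.incl (F.map x) := by
  obtain ⟨f, i, rfl, h1, h2⟩ := φ
  have h := ((fiberCod f i).orderIsoOfFin rfl).apply_symm_apply
    ⟨T.map ((fiberDom f i).orderEmbOfFin rfl x), by
      have := (fiberDom f i).orderEmbOfFin_mem rfl x
      simpa [fiberDom, fiberCod] using this⟩
  exact (congrArg Subtype.val h).symm

end Elem

theorem src_val (T : Per) (j : Fin T.k) :
    (T.src j : ℕ) = (Finset.univ.filter fun x => T.map x = j).card := rfl

theorem src_term (n : ℕ+) (j : Fin (term n).k) : (term n).src j = n := by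
  apply PNat.eq
  rw [src_val]
  have : ∀ x, (term n).map x = j := fun x => Subsingleton.elim (α := Fin 1) _ _
  simp only [this, Finset.filter_true, Finset.card_univ, Fintype.card_fin]
  rfl

theorem fiberDom_card {T S : Per} (f : T ⟶ S) (i : Fin S.k) :
    (fiberDom f i).card = S.src i := by
  rw [src_val]
  obtain ⟨n, k, g, hg⟩ := T
  obtain ⟨n', k', g', hg'⟩ := S
  obtain rfl : n = n' := f.n_eq
  simp only [fiberDom]
  congr 1
  ext x
  simp only [Finset.mem_filter, Finset.mem_univ, true_and]
  rw [f.comm]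
  rfl

section Elem

variable {F T S : Per} (φ : Elem F T S)

theorem Elem.src_idx : S.src φ.idx = F.n :=
  PNat.eq ((fiberDom_card φ.hom φ.idx).symm.trans
    (congrArg (fun X : Per => X.n.val) φ.fiber_idx))

theorem Elem.src_incl (l : Fin F.k) : F.src l = T.src (φ.incl l) := by
  apply PNat.eq
  rw [src_val, src_val, ← Finset.card_map φ.emb.toEmbedding]
  congr 1
  ext x
  simp only [Finset.mem_map, Finset.mem_filter, Finset.mem_univ, true_and,
    RelEmbedding.coe_toEmbedding]
  constructor
  · rintro ⟨y, rfl, rfl⟩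
    exact φ.map_emb y
  · intro h
    have : x ∈ Set.range φ.emb := by
      rw [φ.range_emb]
      simp only [Set.mem_ofPred_eq]
      rw [h, φ.base_incl]
    obtain ⟨y, rfl⟩ := this
    rw [φ.map_emb] at h
    exact ⟨y, φ.incl.injective h, rfl⟩

theorem Elem.src_base {j : Fin T.k} (h : φ.hom.base j ≠ φ.idx) :
    S.src (φ.hom.base j) = T.src j := by
  apply PNat.eq
  rw [← fiberDom_card φ.hom, src_val, fiberDom]
  congr 1
  ext x
  simp only [Finset.mem_filter, Finset.mem_univ, true_and]
  constructor
  · intro hx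
    obtain ⟨a, ha⟩ := Finset.card_eq_one.1 (φ.card_of_ne h)
    have h1 : j ∈ ({a} : Finset _) := by rw [← ha]; simp [fiberCod]
    have h2 : T.map x ∈ ({a} : Finset _) := by rw [← ha]; simp [fiberCod, hx]
    rw [Finset.mem_singleton] at h1 h2
    rw [h1, h2]
  · rintro rfl
    rfl

/-- A section of an elementary morphism outside of the nontrivial fiber. -/
def Elem.sec (t : Fin S.k) : Fin T.k :=
  ⟨if t ≤ φ.idx then t else t + F.k - 1, by
    have := φ.k_eq
    have := φ.two_le
    have := t.2
    split_ifs <;> omega⟩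

theorem Elem.base_sec (t : Fin S.k) : φ.hom.base (φ.sec t) = t := by
  have := φ.two_le
  apply Fin.ext
  rw [φ.base_val]
  simp only [sec, contr, Fin.le_def]
  split_ifs <;> omega

theorem Elem.sec_base {j : Fin T.k} (h : φ.hom.base j ≠ φ.idx) : φ.sec (φ.hom.base j) = j := by
  have := φ.two_le
  rw [Ne, φ.base_eq_idx_iff] at h
  apply Fin.ext
  simp only [sec, Fin.le_def, φ.base_val, contr]
  split_ifs <;> omega

end Elem

/-- `T` is the restriction to `s` of the preorder on `{1, …, N}` defined by the map `g`. -/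
def IsRestr (T : Per) {N : ℕ} (s : Set (Fin N)) (g : Fin N → ℕ) : Prop :=
  ∃ e : Fin T.n ↪o Fin N, Set.range e = s ∧ ∀ x, (T.map x).val = g (e x)

theorem isRestr_self (T : Per) : IsRestr T Set.univ fun x => (T.map x).val :=
  ⟨RelEmbedding.refl _, by simp, fun _ => rfl⟩

/-- An increasing embedding is determined by its range, so the set fixes the numbering of the source
and the level function on it fixes the map. Objects obtained by iterated fibers and targets are
compared in this way inside one ambient `Fin N`, without explicit renumberings. -/
theorem IsRestr.eq {T S : Per} {N : ℕ} {s s' : Set (Fin N)} {g g' : Fin N → ℕ}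
    (hT : IsRestr T s g) (hS : IsRestr S s' g') (hk : T.k = S.k) (hs : s = s')
    (h : ∀ x ∈ s, g x = g' x) : T = S := by
  subst hs
  obtain ⟨n, k, f, hf⟩ := T
  obtain ⟨n', k', f', hf'⟩ := S
  obtain rfl : k = k' := hk
  obtain ⟨e, he, hg⟩ := hT
  obtain ⟨e', he', hg'⟩ := hS
  obtain rfl : n = n' := by
    have h1 := Set.card_range_of_injective e.injective
    have h2 := Set.card_range_of_injective e'.injective
    apply PNat.eq
    have h3 : Nat.card (Set.range e) = Nat.card (Set.range e') := by rw [he, he']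
    rw [Nat.card_range_of_injective e.injective, Nat.card_range_of_injective e'.injective] at h3
    simpa using h3
  obtain rfl : e = e' := by
    have := (e.strictMono.range_inj e'.strictMono).1 (he.trans he'.symm)
    exact DFunLike.coe_injective this
  obtain rfl : f = f' := by
    funext x
    apply Fin.ext
    have h1 := hg x
    have h2 := hg' x
    simp only at h1 h2
    rw [h1, h2]
    exact h _ (he ▸ ⟨x, rfl⟩)
  rfl

section Elem

variable {F T S : Per} (φ : Elem F T S)

theorem Elem.map_val (x : Fin T.n) :
    (S.map (Fin.cast (congrArg PNat.val φ.hom.n_eq) x)).val = contr φ.idx F.k (T.map x) := by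
  rw [← φ.base_val, φ.hom.comm]

/-- Together with `Elem.isRestr_fiber` this describes iterated targets and fibers inside one ambient
set, so that identities between objects of `Per` become arithmetic of intervals. -/
theorem Elem.isRestr_target {N : ℕ} {s : Set (Fin N)} {g : Fin N → ℕ} (h : IsRestr T s g) :
    IsRestr S s fun x => contr φ.idx F.k (g x) := by
  obtain ⟨e, he, hg⟩ := h
  have hn := congrArg PNat.val φ.hom.n_eq
  refine ⟨(Fin.castOrderIso hn.symm).toOrderEmbedding.trans e, ?_, fun x => ?_⟩
  · rw [← he]
    ext y
    constructor
    · rintro ⟨x, rfl⟩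
      exact ⟨_, rfl⟩
    · rintro ⟨x, rfl⟩
      exact ⟨Fin.cast hn x, rfl⟩
  · have := φ.map_val (Fin.cast hn.symm x)
    rw [hg] at this
    exact this

theorem Elem.isRestr_fiber {N : ℕ} {s : Set (Fin N)} {g : Fin N → ℕ} (h : IsRestr T s g) :
    IsRestr F {x | x ∈ s ∧ φ.idx.val ≤ g x ∧ g x < φ.idx.val + F.k} fun x => g x - φ.idx := by
  obtain ⟨e, he, hg⟩ := h
  refine ⟨φ.emb.trans e, ?_, fun x => ?_⟩
  · ext y
    simp only [Set.mem_range, RelEmbedding.coe_trans, Function.comp, Set.mem_ofPred_eq]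
    constructor
    · rintro ⟨x, rfl⟩
      have h1 : φ.emb x ∈ Set.range φ.emb := ⟨x, rfl⟩
      rw [φ.range_emb, Set.mem_ofPred_eq, φ.base_eq_idx_iff, hg] at h1
      exact ⟨he ▸ ⟨_, rfl⟩, h1⟩
    · rintro ⟨h1, h2⟩
      rw [← he] at h1
      obtain ⟨z, rfl⟩ := h1
      have : z ∈ Set.range φ.emb := by
        rw [φ.range_emb, Set.mem_ofPred_eq, φ.base_eq_idx_iff, hg]
        exact h2
      obtain ⟨w, rfl⟩ := this
      exact ⟨w, rfl⟩
  · change _ = g (e (φ.emb x)) - _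
    rw [← hg, φ.map_emb, φ.incl_val]
    omega

end Elem

theorem exists_elem (T : Per) {i m : ℕ} (hm : 2 ≤ m) (hi : i + m ≤ T.k) :
    ∃ (F S : Per) (φ : Elem F T S), φ.idx.val = i ∧ F.k = m := by
  let f : Fin T.k →o Fin (T.k + 1 - m) :=
    ⟨fun j => ⟨contr i m j, by have := j.2; unfold contr; omega⟩, fun a b hab => by
      rw [Fin.le_def] at hab ⊢
      simp only [contr]
      omega⟩
  have hf : Function.Surjective f := by
    intro t
    refine ⟨⟨if t ≤ i then t else t + m - 1, by have := t.2; split_ifs <;> omega⟩, Fin.ext ?_⟩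
    change contr i m (if t ≤ i then t else t + m - 1) = _
    unfold contr
    split_ifs <;> omega
  let S : Per := ⟨T.n, T.k + 1 - m, fun x => f (T.map x), hf.comp T.surj⟩
  let h : T ⟶ S := (⟨rfl, f, fun _ => rfl⟩ : Hom T S)
  let i' : Fin S.k := ⟨i, by change i < T.k + 1 - m; omega⟩
  have h1 : (fiberCod h i').card = m := by
    have hinj : Function.Injective fun l : Fin m => (⟨i + l, by omega⟩ : Fin T.k) :=
      fun a b hab => Fin.ext (Nat.add_left_cancel (congrArg Fin.val hab))
    have : fiberCod h i' = Finset.univ.map ⟨_, hinj⟩ := by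
      ext j
      simp only [fiberCod, Finset.mem_filter, Finset.mem_univ, true_and, Finset.mem_map,
        Function.Embedding.coeFn_mk, Fin.ext_iff]
      change contr i m j = i ↔ _
      unfold contr
      constructor
      · intro hj
        exact ⟨⟨j - i, by omega⟩, by simp only; omega⟩
      · rintro ⟨l, hl⟩
        have hl' : i + l.val = j.val := hl
        have := l.2
        omega
    rw [this, Finset.card_map]
    simp
  refine ⟨fiber h i', S, ⟨h, i', rfl, ?_, fun t ht => ⟨_, eq_term ?_⟩⟩, rfl, h1⟩
  · unfold grade
    rw [fiber_k, h1]
    omega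
  · have ht' : t.val ≠ i := fun h => ht (Fin.ext h)
    have ht2 : t.val < T.k + 1 - m := t.2
    rw [fiber_k, Finset.card_eq_one]
    refine ⟨⟨if t.val ≤ i then t else t + m - 1, by split_ifs <;> omega⟩, ?_⟩
    ext j
    simp only [fiberCod, Finset.mem_filter, Finset.mem_univ, true_and, Finset.mem_singleton,
      Fin.ext_iff]
    change contr i m j = t.val ↔ _
    unfold contr
    split_ifs <;> omega

/-- An elementary morphism is determined by its domain and the contracted interval. -/
theorem Elem.unique {F F' T S S' : Per} (φ : Elem F T S) (φ' : Elem F' T S')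
    (hi : φ.idx.val = φ'.idx.val) (hk : F.k = F'.k) : F = F' ∧ S = S' ∧ HEq φ φ' := by
  have hS : S.k = S'.k := by
    have := φ.k_eq
    have := φ'.k_eq
    omega
  obtain rfl : F = F' := (φ.isRestr_fiber T.isRestr_self).eq (φ'.isRestr_fiber T.isRestr_self) hk
    (by rw [hi, hk]) (by rw [hi]; exact fun _ _ => rfl)
  obtain rfl : S = S' := (φ.isRestr_target T.isRestr_self).eq
    (φ'.isRestr_target T.isRestr_self) hS rfl (by rw [hi]; exact fun _ _ => rfl)
  refine ⟨rfl, rfl, ?_⟩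
  obtain ⟨h, i, _, _, _⟩ := φ
  obtain ⟨h', i', _, _, _⟩ := φ'
  obtain rfl : h = h' := Subsingleton.elim _ _
  obtain rfl : i = i' := Fin.ext hi
  rfl

/-- The contraction of the interval exists by `exists_elem`; its fiber and target are then
recognized as `F` and `S`, because they are restrictions of the same level functions to the same
sets. -/
theorem exists_elem_of_isRestr {F T S : Per} {i : ℕ} (hF : 2 ≤ F.k) (hi : i + F.k ≤ T.k)
    (hS : S.k + F.k = T.k + 1)
    {N : ℕ} {s s' s'' : Set (Fin N)} {g g' g'' : Fin N → ℕ} (rT : IsRestr T s g)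
    (rF : IsRestr F s' g') (rS : IsRestr S s'' g'')
    (hs' : s' = {x | x ∈ s ∧ i ≤ g x ∧ g x < i + F.k}) (hs'' : s'' = s)
    (hg' : ∀ x ∈ s', g' x = g x - i) (hg'' : ∀ x ∈ s'', g'' x = contr i F.k (g x)) :
    ∃ φ : Elem F T S, φ.idx.val = i := by
  obtain ⟨F', S', φ, rfl, hk⟩ := T.exists_elem hF hi
  have := φ.k_eq
  obtain rfl : F = F' := rF.eq (φ.isRestr_fiber rT) hk.symm (by rw [hs', hk])
    hg'
  obtain rfl : S = S' := rS.eq (φ.isRestr_target rT) (by omega) hs'' hg''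
  exact ⟨φ, rfl⟩

end Per

end PerOperads

/-! ### Partial sums of degrees and Koszul signs -/

namespace PerOperads

open Per

universe u

/-- A map which feeds the variables of `U`, via multilinear expressions, into the slots of a
multilinear map on `V`, is multilinear. -/
def multilinearComp {k : Type*} [Field k] {J I : Type*} [DecidableEq J] [DecidableEq I]
    {U : J → Type*} {V : I → Type*} {W : Type*} [∀ j, AddCommGroup (U j)] [∀ j, Module k (U j)]
    [∀ i, AddCommGroup (V i)] [∀ i, Module k (V i)] [AddCommGroup W] [Module k W]
    (x : MultilinearMap k V W) (g : (∀ j, U j) → ∀ i, V i) (π : J → I)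
    (h : ∀ a j, ∃ L : U j →ₗ[k] V (π j),
      ∀ v, g (Function.update a j v) = Function.update (g a) (π j) (L v)) :
    MultilinearMap k U W :=
  MultilinearMap.mk' (fun a => x (g a))
    (fun a j v w => by
      obtain ⟨L, hL⟩ := h a j
      rw [hL, hL, hL, map_add, x.map_update_add])
    (fun a j c v => by
      obtain ⟨L, hL⟩ := h a j
      rw [hL, hL, map_smul, x.map_update_smul])

section Sums

/-- The sum of the first `i` values of `f`. -/
def psum {a : ℕ} (f : Fin a → ℤ) (i : ℕ) : ℤ := ∑ j with j.val < i, f j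

theorem psum_eq {a : ℕ} (f : Fin a → ℤ) (i : ℕ) :
    psum f i = ∑ n ∈ Finset.range i, if h : n < a then f ⟨n, h⟩ else 0 := by
  induction i with
  | zero => simp [psum]
  | succ i ih =>
    rw [Finset.sum_range_succ, ← ih]
    unfold psum
    by_cases h : i < a
    · have : (Finset.univ.filter fun j : Fin a => j.val < i + 1) =
          insert ⟨i, h⟩ (Finset.univ.filter fun j : Fin a => j.val < i) := by
        ext j
        simp only [Finset.mem_filter, Finset.mem_univ, true_and, Finset.mem_insert, Fin.ext_iff]
        omega
      rw [this, Finset.sum_insert (by simp), dif_pos h, add_comm]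
    · rw [dif_neg h, add_zero]
      congr 1
      ext j
      have := j.2
      simp only [Finset.mem_filter, Finset.mem_univ, true_and]
      omega

theorem psum_self {a : ℕ} (f : Fin a → ℤ) : psum f a = ∑ j, f j := by
  unfold psum
  rw [Finset.filter_true_of_mem fun j _ => j.2]

theorem psum_zero {a : ℕ} (f : Fin a → ℤ) : psum f 0 = 0 := by
  simp [psum]

theorem psum_succ {a : ℕ} (f : Fin a → ℤ) {i : ℕ} (h : i < a) :
    psum f (i + 1) = psum f i + f ⟨i, h⟩ := by
  rw [psum_eq, psum_eq, Finset.sum_range_succ, dif_pos h]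

theorem psum_add {a b : ℕ} (f : Fin a → ℤ) (f' : Fin b → ℤ) (i : ℕ) {l : ℕ} (hl : l ≤ b)
    (h : ∀ (t : Fin b) (j : Fin a), j.val = i + t.val → t.val < l → f j = f' t)
    (h' : i + l ≤ a) : psum f (i + l) = psum f i + psum f' l := by
  induction l with
  | zero => simp [psum_zero]
  | succ l ih =>
    rw [← add_assoc, psum_succ f (i := i + l) (by omega), psum_succ f' (i := l) (by omega),
      ih (by omega) (fun t j hj ht => h t j hj (by omega)) (by omega), add_assoc,
      h ⟨l, by omega⟩ ⟨i + l, by omega⟩ rfl (by simp)]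

theorem Per.Elem.base_lt_idx_iff {F T S : Per} (φ : Elem F T S) (j : Fin T.k) :
    φ.hom.base j < φ.idx ↔ j.val < φ.idx.val := by
  have := φ.two_le
  rw [Fin.lt_def, φ.base_val, contr]
  omega

theorem Per.Elem.sum_lt {F T S : Per} (φ : Elem F T S) (f : Fin T.k → ℤ) :
    ∑ j with φ.hom.base j < φ.idx, f j = psum f φ.idx := by
  unfold psum
  congr 1
  ext j
  simp [φ.base_lt_idx_iff]

/-- Partial sums after replacing the values over the nontrivial fiber by `q` plus their sum. -/
theorem Per.Elem.psum_contr {F T S : Per} (φ : Elem F T S) (f : Fin T.k → ℤ) (f' : Fin S.k → ℤ)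
    {q : ℤ} (h1 : f' φ.idx = q + ∑ l, f (φ.incl l)) (h2 : ∀ t, t ≠ φ.idx → f' t = f (φ.sec t))
    (t : ℕ) (ht : t ≤ S.k) :
    psum f' t = if t ≤ φ.idx then psum f t else q + psum f (t + F.k - 1) := by
  have hk := φ.k_eq
  have hm := φ.two_le
  have hi := φ.idx.2
  induction t with
  | zero => simp [psum_zero]
  | succ t ih =>
    rw [psum_succ f' (i := t) (by omega), ih (by omega)]
    rcases lt_trichotomy t φ.idx.val with h | h | h
    · rw [if_pos (by omega), if_pos (by omega), psum_succ f (i := t) (by omega), h2]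
      · congr 2
        apply Fin.ext
        simp only [Elem.sec, Fin.le_def]
        rw [if_pos (by omega)]
      · exact fun h' => by rw [← h'] at h; simp at h
    -- At the contracted point the whole block of `F.k` arguments enters at once, together with the
    -- degree `q` of the operation applied to it.
    · subst h
      rw [if_pos le_rfl, if_neg (by omega), h1, ← psum_self,
        show φ.idx.val + 1 + F.k - 1 = φ.idx.val + F.k by omega,
        psum_add f (fun l => f (φ.incl l)) φ.idx le_rfl _ (by omega)]
      · ring
      · intro l j hj _
        congr 1
        apply Fin.ext
        rw [hj, φ.incl_val]
    · rw [if_neg (by omega), if_neg (by omega), h2,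
        show t + 1 + F.k - 1 = (t + F.k - 1) + 1 by omega, psum_succ f (by omega), add_assoc]
      · congr 3
        apply Fin.ext
        simp only [Elem.sec, Fin.le_def]
        rw [if_neg (by omega)]
      · exact fun h' => by rw [← h'] at h; simp at h

theorem Per.Elem.sum_contr {F T S : Per} (φ : Elem F T S) (f : Fin T.k → ℤ) (f' : Fin S.k → ℤ)
    {q : ℤ} (h1 : f' φ.idx = q + ∑ l, f (φ.incl l)) (h2 : ∀ t, t ≠ φ.idx → f' t = f (φ.sec t)) :
    ∑ t, f' t = q + ∑ j, f j := by
  have hk := φ.k_eq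
  have := φ.idx.2
  rw [← psum_self, φ.psum_contr f f' h1 h2 _ le_rfl, if_neg (by omega), ← psum_self,
    show S.k + F.k - 1 = T.k by omega]

end Sums

section Sgn

variable (k : Type u) [Field k]

theorem sgn_add (i j : ℤ) : sgn k (i + j) = sgn k i * sgn k j := by
  simp [sgn, Int.negOnePow_add]

theorem sgn_zero : sgn k 0 = 1 := by simp [sgn]

theorem sgn_one : sgn k 1 = -1 := by simp [sgn]

theorem sgn_mul_self (i : ℤ) : sgn k i * sgn k i = 1 := by
  rw [← sgn_add]
  simp [sgn, Int.negOnePow_even _ (Even.add_self i)]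

theorem sgn_eq {i j : ℤ} (l : ℤ) (h : i = j + 2 * l) : sgn k i = sgn k j := by
  rw [h, sgn_add, two_mul, sgn_add, sgn_mul_self, mul_one]

end Sgn

/-! ### The endomorphism operad of a collection -/

variable {k : Type u} [Field k]

/-- Transport along equalities of the indices of a collection. -/
def Coll.tr (A : Coll k) {n n' : ℕ+} {d d' : ℤ} (hn : n = n') (hd : d = d') :
    A n d ≃ₗ[k] A n' d' := by
  subst hn hd
  exact LinearEquiv.refl k _

theorem Coll.elt_tr (A : Coll k) {n n' : ℕ+} {d d' : ℤ} (hn : n = n') (hd : d = d') (a : A n d) :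
    A.elt (A.tr hn hd a) = A.elt a := by
  subst hn hd
  rfl

theorem Coll.elt_injective (A : Coll k) {n : ℕ+} {d : ℤ} {a b : A n d} (h : A.elt a = A.elt b) :
    a = b := by
  simpa [Coll.elt] using h

/-- Rescaling of a homogeneous element. -/
def Coll.Elt.smul {A : Coll k} (s : k) (e : A.Elt) : A.Elt := A.elt (s • e.2.2)

theorem Coll.elt_smul (A : Coll k) {n : ℕ+} {d : ℤ} (s : k) (a : A n d) :
    A.elt (s • a) = (A.elt a).smul s := rfl

theorem Coll.Elt.smul_smul {A : Coll k} (s t : k) (e : A.Elt) :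
    (e.smul t).smul s = e.smul (s * t) := by
  exact congrArg A.elt (_root_.smul_smul s t e.2.2)

theorem Coll.Elt.one_smul {A : Coll k} (e : A.Elt) : e.smul (1 : k) = e := by
  simp only [smul, Coll.elt, _root_.one_smul]

/-- The components and degrees of the arguments and of the result of an operation of degree `p`
indexed by `T`. -/
structure EndIdx (T : Per) (p : ℤ) where
  n : ℕ+
  hn : T.n = n
  c : Fin T.k → ℕ+
  hc : ∀ j, T.src j = c j
  d : Fin T.k → ℤ
  D : ℤ
  hD : p + ∑ j, d j = D

/-- Maps of degree `p` from the tensor product of the pieces of a collection indexed by the sources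
of `T` to the piece indexed by the target of `T`. -/
abbrev EndObj (A : Coll k) (T : Per) (p : ℤ) : Type u :=
  ∀ i : EndIdx T p, MultilinearMap k (fun j => A (i.c j) (i.d j)) (A i.n i.D)

namespace EndObj

variable {A : Coll k}

/-- The value on a family of homogeneous elements. -/
def ev {T : Per} {p : ℤ} (x : EndObj A T p) (b : Fin T.k → A.Elt) (h : ∀ j, T.src j = (b j).1) :
    A.Elt :=
  A.elt (x ⟨T.n, rfl, _, h, _, _, rfl⟩ fun j => (b j).2.2)

theorem ev_congr {T : Per} {p : ℤ} (x : EndObj A T p) {b b' : Fin T.k → A.Elt} (e : b = b')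
    (h : ∀ j, T.src j = (b j).1) : x.ev b h = x.ev b' (e ▸ h) := by
  subst e
  rfl

/-- Once the result is bundled with its component and degree, the proofs relating the indices no
longer matter. This replaces dependently typed identities by identities between values on families
of homogeneous elements. -/
theorem elt_apply {T : Per} {p : ℤ} (x : EndObj A T p) {n : ℕ+} (hn : T.n = n)
    {c : Fin T.k → ℕ+} (hc : ∀ j, T.src j = c j) {d : Fin T.k → ℤ} {D : ℤ}
    (hD : p + ∑ j, d j = D) (a : ∀ j, A (c j) (d j)) :
    A.elt (x ⟨n, hn, c, hc, d, D, hD⟩ a) = x.ev (fun j => A.elt (a j)) hc := by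
  subst hn hD
  rfl

theorem ext_ev {T : Per} {p : ℤ} {x y : EndObj A T p} (h : ∀ b hb, x.ev b hb = y.ev b hb) :
    x = y := by
  funext ⟨n, hn, c, hc, d, D, hD⟩
  apply MultilinearMap.ext
  intro a
  apply A.elt_injective
  rw [elt_apply, elt_apply, h]

theorem ev_smul {T : Per} {p : ℤ} (x : EndObj A T p) (s : k) (b : Fin T.k → A.Elt)
    (h : ∀ j, T.src j = (b j).1) : ev (s • x) b h = (x.ev b h).smul s := rfl

/-- Used to pull the sign produced by an inner operation out of the slot which that operation
occupies. -/
theorem ev_smul_slot {T : Per} {p : ℤ} (x : EndObj A T p) (s : k) (b b' : Fin T.k → A.Elt)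
    (h : ∀ j, T.src j = (b j).1) (h' : ∀ j, T.src j = (b' j).1) (i : Fin T.k)
    (hi : b' i = (b i).smul s) (hne : ∀ j, j ≠ i → b' j = b j) :
    x.ev b' h' = (x.ev b h).smul s := by
  have e : b' = fun j => A.elt (Function.update (fun j => (b j).2.2) i (s • (b i).2.2) j) := by
    funext j
    by_cases hj : j = i
    · subst hj
      rw [hi, Function.update_self]
      rfl
    · rw [hne j hj, Function.update_of_ne hj]
  rw [x.ev_congr e]
  rw [← elt_apply x rfl h rfl, MultilinearMap.map_update_smul, Function.update_eq_self]
  rfl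

theorem src_graft {F T S : Per} (φ : Elem F T S) {c : Fin T.k → ℕ+} (hc : ∀ j, T.src j = c j)
    (t : Fin S.k) : S.src t = if t = φ.idx then F.n else c (φ.sec t) := by
  split_ifs with h
  · rw [h, φ.src_idx]
  · rw [← hc]
    have : φ.hom.base (φ.sec t) ≠ φ.idx := by rwa [φ.base_sec]
    rw [← φ.src_base this, φ.base_sec]

section Graft

variable {F T S : Per} (φ : Elem F T S)

/-- The family obtained from `b` by replacing its part over the nontrivial fiber by the value of
`y`. -/
def graft {q : ℤ} (y : EndObj A F q) (b : Fin T.k → A.Elt) (h : ∀ j, T.src j = (b j).1) :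
    Fin S.k → A.Elt := fun t =>
  if t = φ.idx then y.ev (fun l => b (φ.incl l)) fun l => (φ.src_incl l).trans (h _)
  else b (φ.sec t)

theorem graft_src {q : ℤ} (y : EndObj A F q) (b : Fin T.k → A.Elt)
    (h : ∀ j, T.src j = (b j).1) (t : Fin S.k) : S.src t = (graft φ y b h t).1 := by
  rw [src_graft φ h, graft]
  split_ifs <;> rfl

/-- The components of a family after grafting. -/
def graftC (c : Fin T.k → ℕ+) (t : Fin S.k) : ℕ+ := if t = φ.idx then F.n else c (φ.sec t)

/-- The degrees of a family after grafting. -/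
def graftD (q : ℤ) (d : Fin T.k → ℤ) (t : Fin S.k) : ℤ :=
  if t = φ.idx then q + ∑ l, d (φ.incl l) else d (φ.sec t)

/-- Grafting with fixed components and degrees. -/
def graftV (q : ℤ) {c : Fin T.k → ℕ+} {d : Fin T.k → ℤ} (v : A F.n (q + ∑ l, d (φ.incl l)))
    (a : ∀ j, A (c j) (d j)) (t : Fin S.k) : A (graftC φ c t) (graftD φ q d t) :=
  if h : t = φ.idx then A.tr (by rw [graftC, if_pos h]) (by rw [graftD, if_pos h]) v
  else A.tr (by rw [graftC, if_neg h]) (by rw [graftD, if_neg h]) (a (φ.sec t))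

/-- Isolates the only slot in which `v` occurs; additivity and homogeneity in `v` are then those of
a multilinear map in that slot. -/
theorem graftV_eq (q : ℤ) {c : Fin T.k → ℕ+} {d : Fin T.k → ℤ}
    (v : A F.n (q + ∑ l, d (φ.incl l))) (a : ∀ j, A (c j) (d j)) :
    graftV φ q v a = Function.update (graftV φ q 0 a) φ.idx
      (A.tr (by rw [graftC, if_pos rfl]) (by rw [graftD, if_pos rfl]) v) := by
  funext t
  by_cases h : t = φ.idx
  · subst h
    rw [Function.update_self, graftV, dif_pos rfl]
  · rw [Function.update_of_ne h, graftV, graftV, dif_neg h, dif_neg h]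

theorem map_graftV_add {W : Type*} [AddCommGroup W] [Module k W] (q : ℤ) {c : Fin T.k → ℕ+}
    {d : Fin T.k → ℤ}
    (x : MultilinearMap k (fun t => A (graftC φ c t) (graftD φ q d t)) W)
    (v v' : A F.n (q + ∑ l, d (φ.incl l))) (a : ∀ j, A (c j) (d j)) :
    x (graftV φ q (v + v') a) = x (graftV φ q v a) + x (graftV φ q v' a) := by
  rw [graftV_eq φ q (v + v'), graftV_eq φ q v, graftV_eq φ q v', map_add, x.map_update_add]

theorem map_graftV_smul {W : Type*} [AddCommGroup W] [Module k W] (q : ℤ) {c : Fin T.k → ℕ+}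
    {d : Fin T.k → ℤ}
    (x : MultilinearMap k (fun t => A (graftC φ c t) (graftD φ q d t)) W)
    (s : k) (v : A F.n (q + ∑ l, d (φ.incl l))) (a : ∀ j, A (c j) (d j)) :
    x (graftV φ q (s • v) a) = s • x (graftV φ q v a) := by
  rw [graftV_eq φ q (s • v), graftV_eq φ q v, map_smul, x.map_update_smul]

theorem elt_graftV (q : ℤ) {c : Fin T.k → ℕ+} {d : Fin T.k → ℤ}
    (v : A F.n (q + ∑ l, d (φ.incl l))) (a : ∀ j, A (c j) (d j)) (t : Fin S.k) :
    A.elt (graftV φ q v a t) = if t = φ.idx then A.elt v else A.elt (a (φ.sec t)) := by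
  unfold graftV
  split_ifs with h
  · rw [A.elt_tr]
  · rw [A.elt_tr]

/-- A change of the argument `a j` is felt only in the slot over `φ.hom.base j`: through `y` if `j`
lies in the nontrivial fiber, and directly otherwise. This is the input which `multilinearComp`
requires. -/
theorem graft_linear {q : ℤ} (y : EndObj A F q) {c : Fin T.k → ℕ+} {d : Fin T.k → ℤ}
    (hc : ∀ l, F.src l = c (φ.incl l)) (a : ∀ j, A (c j) (d j)) (j : Fin T.k) :
    ∃ L : A (c j) (d j) →ₗ[k] A (graftC φ c (φ.hom.base j)) (graftD φ q d (φ.hom.base j)),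
      ∀ v, graftV φ q (y ⟨F.n, rfl, _, hc, _, _, rfl⟩ fun l => Function.update a j v (φ.incl l))
          (Function.update a j v) =
        Function.update (graftV φ q (y ⟨F.n, rfl, _, hc, _, _, rfl⟩ fun l => a (φ.incl l)) a)
          (φ.hom.base j) (L v) := by
  by_cases h : φ.hom.base j = φ.idx
  · obtain ⟨l, rfl⟩ := φ.exists_incl h
    have e : ∀ v, (fun l' => Function.update a (φ.incl l) v (φ.incl l')) =
        Function.update (fun l' => a (φ.incl l')) l v := fun v => by
      funext l'
      by_cases hl : l' = l
      · subst hl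
        rw [Function.update_self, Function.update_self]
      · rw [Function.update_of_ne hl,
          Function.update_of_ne fun h' => hl (φ.incl.injective h')]
    refine ⟨(A.tr (by rw [graftC, if_pos h]) (by rw [graftD, if_pos h])).toLinearMap ∘ₗ
      (y ⟨F.n, rfl, _, hc, _, _, rfl⟩).toLinearMap (fun l => a (φ.incl l)) l, fun v => ?_⟩
    funext t
    by_cases ht : t = φ.hom.base (φ.incl l)
    · subst ht
      rw [Function.update_self, graftV, dif_pos h, e]
      rfl
    · have h2 : t ≠ φ.idx := fun h' => ht (h'.trans h.symm)
      rw [Function.update_of_ne ht, graftV, graftV, dif_neg h2, dif_neg h2,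
        Function.update_of_ne]
      intro h3
      exact ht (by rw [← h3, φ.base_sec])
  · have e : ∀ v, (fun l => Function.update a j v (φ.incl l)) = fun l => a (φ.incl l) :=
      fun v => by
        funext l
        rw [Function.update_of_ne]
        rintro rfl
        exact h (φ.base_incl l)
    have hs := φ.sec_base h
    refine ⟨(A.tr (by rw [graftC, if_neg h, hs]) (by rw [graftD, if_neg h, hs])).toLinearMap,
      fun v => ?_⟩
    rw [e]
    funext t
    by_cases ht : t = φ.hom.base j
    · subst ht
      rw [Function.update_self, graftV, dif_neg h]
      apply A.elt_injective
      refine (A.elt_tr _ _ _).trans (Eq.trans ?_ (A.elt_tr _ _ _).symm)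
      rw [hs, Function.update_self]
    · rw [Function.update_of_ne ht, graftV, graftV]
      split_ifs
      · rfl
      · rw [Function.update_of_ne]
        intro h3
        exact ht (by rw [← h3, φ.base_sec])

theorem graftD_sum {p q r : ℤ} (hr : p + q = r) (d : Fin T.k → ℤ) :
    p + ∑ t, graftD φ q d t = r + ∑ j, d j := by
  rw [φ.sum_contr d (graftD φ q d) (q := q) (by rw [graftD, if_pos rfl])
    fun t ht => by rw [graftD, if_neg ht]]
  rw [← hr, add_assoc]

/-- Composition of multilinear maps, without the Koszul sign. -/
def comp {p q r : ℤ} (hr : p + q = r) (x : EndObj A S p) (y : EndObj A F q) : EndObj A T r :=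
  fun i => multilinearComp
    (x ⟨i.n, φ.hom.n_eq.symm.trans i.hn, graftC φ i.c, src_graft φ i.hc, graftD φ q i.d, i.D,
      (graftD_sum φ hr i.d).trans i.hD⟩)
    (fun a => graftV φ q
      (y ⟨F.n, rfl, _, fun l => (φ.src_incl l).trans (i.hc _), _, _, rfl⟩
        fun l => a (φ.incl l)) a)
    φ.hom.base (graft_linear φ y fun l => (φ.src_incl l).trans (i.hc _))

/-- The circle product of the endomorphism operad. -/
def circ {p q r : ℤ} (hr : p + q = r) : EndObj A S p →ₗ[k] EndObj A F q →ₗ[k] EndObj A T r :=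
  LinearMap.mk₂ k
    (fun x y i =>
      sgn k (q * ∑ j with φ.hom.base j < φ.idx, i.d j) • comp φ hr x y i)
    (fun x x' y => by
      funext i
      exact smul_add _ (comp φ hr x y i) (comp φ hr x' y i))
    (fun s x y => by
      funext i
      exact smul_comm _ s (comp φ hr x y i))
    (fun x y y' => by
      funext i
      refine Eq.trans ?_ (smul_add _ (comp φ hr x y i)
        (comp φ hr x y' i))
      congr 1
      apply MultilinearMap.ext
      intro a
      exact map_graftV_add φ q _ _ _ a)
    (fun s x y => by
      funext i
      refine Eq.trans ?_ (smul_comm s _ (comp φ hr x y i)).symm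
      congr 1
      apply MultilinearMap.ext
      intro a
      exact map_graftV_smul φ q _ s _ a)

/-- The form in which circle products are computed below. The degree of the arguments preceding the
fiber is a partial sum, so each operad axiom splits into an equality of grafted families and a
parity statement about partial sums. -/
theorem ev_circ {p q r : ℤ} (hr : p + q = r) (x : EndObj A S p) (y : EndObj A F q)
    (b : Fin T.k → A.Elt) (h : ∀ j, T.src j = (b j).1) :
    ev (circ φ hr x y) b h =
      (x.ev (graft φ y b h) (graft_src φ y b h)).smul
        (sgn k (q * psum (fun j => (b j).2.1) φ.idx)) := by
  have e : graft φ y b h = fun t => A.elt (graftV φ q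
      (y ⟨F.n, rfl, _, fun l => (φ.src_incl l).trans (h _), _, _, rfl⟩ fun l => (b (φ.incl l)).2.2)
      (fun j => (b j).2.2) t) := by
    funext t
    rw [elt_graftV, graft]
    rfl
  rw [x.ev_congr e, ← φ.sum_lt]
  exact congrArg (Coll.Elt.smul _) (elt_apply x (φ.hom.n_eq.symm.trans rfl) (src_graft φ h)
    (graftD_sum φ hr _) (graftV φ q _ fun j => (b j).2.2))

theorem psum_graft {q : ℤ} (y : EndObj A F q) (b : Fin T.k → A.Elt)
    (h : ∀ j, T.src j = (b j).1) (t : ℕ) (ht : t ≤ S.k) :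
    psum (fun t => (graft φ y b h t).2.1) t =
      if t ≤ φ.idx then psum (fun j => (b j).2.1) t
      else q + psum (fun j => (b j).2.1) (t + F.k - 1) :=
  φ.psum_contr (fun j => (b j).2.1) _ (by rw [graft, if_pos rfl]; rfl)
    (fun t ht => by rw [graft, if_neg ht]) t ht

end Graft

/-- The unit of the endomorphism operad. -/
def one (A : Coll k) (n : ℕ+) : EndObj A (term n) 0 := fun i =>
  MultilinearMap.mk' (fun a => A.tr ((i.hc ⟨0, Nat.one_pos⟩).symm.trans
      ((src_term n _).trans i.hn))
      (by rw [← i.hD, zero_add]; exact (Fin.sum_univ_one i.d).symm) (a ⟨0, Nat.one_pos⟩))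
    (fun a j v w => by
      obtain rfl : j = ⟨0, Nat.one_pos⟩ := Subsingleton.elim (α := Fin 1) _ _
      simp)
    (fun a j s v => by
      obtain rfl : j = ⟨0, Nat.one_pos⟩ := Subsingleton.elim (α := Fin 1) _ _
      simp)

theorem ev_one (n : ℕ+) (b : Fin (term n).k → A.Elt) (h : ∀ j, (term n).src j = (b j).1) :
    ev (one A n) b h = b ⟨0, Nat.one_pos⟩ :=
  A.elt_tr _ _ _

end EndObj

end PerOperads

/-! ### Operad axioms for the endomorphism operad -/

namespace PerOperads

open Per

universe u

namespace Per

theorem IsRestr.agree {T : Per} {N : ℕ} {s s' : Set (Fin N)} {g g' : Fin N → ℕ}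
    (h : IsRestr T s g) (h' : IsRestr T s' g') (hs : s = s') : ∀ x ∈ s, g x = g' x := by
  subst hs
  obtain ⟨e, he, hg⟩ := h
  obtain ⟨e', he', hg'⟩ := h'
  obtain rfl : e = e' :=
    DFunLike.coe_injective ((e.strictMono.range_inj e'.strictMono).1 (he.trans he'.symm))
  intro x hx
  rw [← he] at hx
  obtain ⟨y, rfl⟩ := hx
  rw [← hg, hg']

theorem base_comp {T S P : Per} (φ : T ⟶ S) (ψ : S ⟶ P) (ξ : T ⟶ P) (j : Fin T.k) :
    ξ.base j = ψ.base (φ.base j) := by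
  obtain rfl : ξ = φ ≫ ψ := Subsingleton.elim _ _
  rfl

section Joint

variable {F G H T S P : Per} (φ : Elem F T S) (ψ : Elem G S P) (ξ : Elem H T P) (χ : Elem F H G)

/-- The fiber of `ξ` over `ψ.idx` contains the whole nontrivial fiber of `φ`, hence at least two
points, and all fibers of `ξ` but one are points. -/
theorem Elem.joint_idx (h : ψ.hom.base φ.idx = ψ.idx) : ξ.idx = ψ.idx := by
  by_contra hne
  obtain ⟨a, ha⟩ := Finset.card_eq_one.1 (ξ.card_of_ne (Ne.symm hne))
  have h2 := φ.two_le
  have key : ∀ l, φ.incl l = a := fun l => by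
    rw [← Finset.mem_singleton, ← ha]
    simp only [fiberCod, Finset.mem_filter, Finset.mem_univ, true_and]
    rw [base_comp φ.hom ψ.hom, φ.base_incl, h]
  have := φ.incl.injective ((key ⟨0, by omega⟩).trans (key ⟨1, by omega⟩).symm)
  simp at this

/-- The object `G` occurs in two ways, as the fiber of `ψ` and as the target of `χ`. Comparing the
two level functions shows that on this block `φ`, shifted by `ψ.idx`, is the same contraction as
`χ`, and a contraction of at least two points determines its position. -/
theorem Elem.joint_idx_val {F G H T S P : Per} (φ : Elem F T S) (ψ : Elem G S P)
    (ξ : Elem H T P) (χ : Elem F H G) (h : ψ.hom.base φ.idx = ψ.idx) :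
    φ.idx.val = ψ.idx.val + χ.idx.val := by
  have h1 := φ.joint_idx ψ ξ h
  rw [ψ.base_eq_idx_iff] at h
  have hk := χ.k_eq
  have hF := φ.two_le
  have hG := ψ.two_le
  have hi := χ.idx.2
  have hs : {x | x ∈ Set.univ ∧ ψ.idx.val ≤ contr φ.idx F.k (T.map x) ∧
      contr φ.idx F.k (T.map x) < ψ.idx.val + G.k} =
      {x | x ∈ Set.univ ∧ ξ.idx.val ≤ (T.map x).val ∧ (T.map x).val < ξ.idx.val + H.k} := by
    ext x
    have := congrArg Fin.val h1
    simp only [Set.mem_ofPred_eq, contr, Set.mem_univ, true_and]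
    omega
  have key := IsRestr.agree (ψ.isRestr_fiber (φ.isRestr_target T.isRestr_self))
    (χ.isRestr_target (ξ.isRestr_fiber T.isRestr_self)) hs
  have key' : ∀ l < H.k, contr φ.idx F.k (ψ.idx.val + l) - ψ.idx = contr χ.idx F.k l := by
    intro l hl
    have hT := ξ.idx_add_le
    obtain ⟨x, hx⟩ := T.surj ⟨ψ.idx.val + l, by rw [h1] at hT; omega⟩
    have := key x (by
      rw [hs]
      simp only [Set.mem_ofPred_eq, h1, hx, Set.mem_univ, true_and]
      omega)
    rw [hx] at this
    simp only [h1] at this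
    rw [this]
    congr 1
    omega
  -- The first two points identified by `χ`; the values there locate the interval contracted by `φ`.
  have k1 := key' χ.idx (by omega)
  have k2 := key' (χ.idx + 1) (by omega)
  simp only [contr] at k1 k2
  omega

end Joint

end Per

variable {k : Type u} [Field k] {A : Coll k}

namespace EndObj

theorem graft_lt {F T S : Per} (φ : Elem F T S) {q : ℤ} (y : EndObj A F q) (b : Fin T.k → A.Elt)
    (h : ∀ j, T.src j = (b j).1) {t : Fin S.k} {j : Fin T.k} (ht : t.val < φ.idx.val)
    (hj : j.val = t.val) : graft φ y b h t = b j := by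
  rw [graft, if_neg fun h' => by rw [h'] at ht; exact lt_irrefl _ ht]
  congr 1
  apply Fin.ext
  simp only [Elem.sec, Fin.le_def]
  rw [if_pos (by omega), hj]

theorem graft_gt {F T S : Per} (φ : Elem F T S) {q : ℤ} (y : EndObj A F q) (b : Fin T.k → A.Elt)
    (h : ∀ j, T.src j = (b j).1) {t : Fin S.k} {j : Fin T.k} (ht : φ.idx.val < t.val)
    (hj : j.val + 1 = t.val + F.k) : graft φ y b h t = b j := by
  rw [graft, if_neg fun h' => by rw [h'] at ht; exact lt_irrefl _ ht]
  congr 1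
  apply Fin.ext
  simp only [Elem.sec, Fin.le_def]
  rw [if_neg (by omega)]
  omega

theorem graft_idx {F T S : Per} (φ : Elem F T S) {q : ℤ} (y : EndObj A F q) (b : Fin T.k → A.Elt)
    (h : ∀ j, T.src j = (b j).1) {t : Fin S.k} (ht : t.val = φ.idx.val) {b' : Fin F.k → A.Elt}
    (hb : ∀ (l : Fin F.k) (j : Fin T.k), j.val = φ.idx.val + l.val → b' l = b j)
    (h' : ∀ j, F.src j = (b' j).1) :
    graft φ y b h t = y.ev b' h' := by
  rw [graft, if_pos (Fin.ext ht)]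
  apply ev_congr
  funext l
  exact (hb l _ (φ.incl_val l)).symm

/-- Both sides graft the same family. As for signs, `z` passes the arguments before the block of `ξ`
and then those of the block which precede its own; since `φ.idx` is the sum of `ψ.idx` and `χ.idx`,
these are together the arguments preceding the interval contracted by `φ`. -/
theorem circ_joint {F G H T S P : Per} (φ : Elem F T S) (ψ : Elem G S P) (ξ : Elem H T P)
    (χ : Elem F H G) (hi : ψ.hom.base φ.idx = ψ.idx) {p q r pq qr d : ℤ} (h₁ : q + r = qr)
    (h₂ : p + qr = d) (h₃ : p + q = pq) (h₄ : pq + r = d)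
    (x : EndObj A P p) (y : EndObj A G q) (z : EndObj A F r) :
    circ ξ h₂ x (circ χ h₁ y z) = circ φ h₄ (circ ψ h₃ x y) z := by
  apply ext_ev
  intro b hb
  have e1 := φ.joint_idx ψ ξ hi
  have e2 := φ.joint_idx_val ψ ξ χ hi
  have k1 := φ.k_eq
  have k2 := ψ.k_eq
  have k3 := ξ.k_eq
  have k4 := χ.k_eq
  have m1 := φ.two_le
  have m2 := ψ.two_le
  have i1 := φ.idx.2
  have i2 := ψ.idx.2
  have i3 := χ.idx.2
  have hbx : ∀ l, H.src l = (b (ξ.incl l)).1 := fun l => (ξ.src_incl l).trans (hb _)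
  rw [ev_circ, ev_circ φ, ev_circ ψ, Coll.Elt.smul_smul]
  have key : ∀ l, graft χ z (fun l => b (ξ.incl l)) hbx l = graft φ z b hb (ψ.incl l) := by
    intro l
    have hl := ψ.incl_val l
    rcases lt_trichotomy l.val χ.idx.val with h | h | h
    · rw [graft_lt χ z _ _ (j := ⟨l.val, by omega⟩) h rfl]
      symm
      apply graft_lt _ _ _ _ (by omega)
      rw [ξ.incl_val, e1, hl]
    · rw [graft_idx φ z _ _ (by omega) (b' := fun l => b (ξ.incl (χ.incl l)))]
      · rw [graft, if_pos (Fin.ext h)]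
      · intro l j hj
        congr 1
        apply Fin.ext
        rw [ξ.incl_val, χ.incl_val, e1]
        omega
    · rw [graft_gt χ z _ _ (j := ⟨l.val + F.k - 1, by omega⟩) h (by simp only; omega)]
      symm
      apply graft_gt _ _ _ _ (by omega)
      rw [ξ.incl_val, e1, hl]
      simp only
      omega
  -- The sign of the composite along `χ` sits inside the slot `ψ.idx` of `x` and has to be moved
  -- outside.
  have hs := x.ev_smul_slot (sgn k (r * psum (fun j => (b (ξ.incl j)).2.1) χ.idx))
    (graft ψ y (graft φ z b hb) (graft_src φ z b hb)) (graft ξ (circ χ h₁ y z) b hb)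
    (graft_src ψ y _ _) (graft_src ξ _ _ _) ψ.idx
    (by
      rw [graft_idx ξ (circ χ h₁ y z) b hb (by rw [e1]) (b' := fun l => b (ξ.incl l))
        (fun l j hj => by
          congr 1
          apply Fin.ext
          rw [hj, ξ.incl_val]) hbx, ev_circ, graft, if_pos rfl]
      congr 1
      apply ev_congr
      funext l
      exact key l)
    (fun t ht => by
      rcases lt_or_gt_of_ne (fun h => ht (Fin.ext h) : t.val ≠ ψ.idx.val) with h | h
      · rw [graft_lt ψ y _ _ (j := ⟨t.val, by omega⟩) h rfl,
          graft_lt ξ _ _ _ (j := ⟨t.val, by omega⟩) (by omega) rfl]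
        symm
        exact graft_lt _ _ _ _ (by simp only; omega) rfl
      · have ht := t.2
        rw [graft_gt ψ y _ _ (j := ⟨t.val + G.k - 1, by omega⟩) h (by simp only; omega),
          graft_gt ξ _ _ _ (j := ⟨t.val + H.k - 1, by omega⟩) (by omega) (by simp only; omega)]
        symm
        exact graft_gt _ _ _ _ (by simp only; omega) (by simp only; omega))
  rw [hs, Coll.Elt.smul_smul]
  congr 1
  rw [← sgn_add, ← sgn_add, psum_graft φ z b hb _ (by omega), if_pos (by omega), e2, e1, ← h₁,
    psum_add (fun j => (b j).2.1) (fun j => (b (ξ.incl j)).2.1) ψ.idx.val (l := χ.idx.val)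
      (by omega) _ (by omega)]
  · congr 1
    ring
  · intro l j hj _
    refine congrArg (fun t => (b t).2.1) (Fin.ext ?_)
    rw [ξ.incl_val, e1, hj]

/-- The case in which the interval of `G` lies to the left. If `G` is contracted first, the element
`g` counts among what `f` has to pass, which contributes a further `q * r`; if `F` is contracted
first, `g` does not notice `f`. -/
theorem circ_disjoint_aux {F G T P' P'' S : Per} (φ' : Elem F T P') (ψ' : Elem G P' S)
    (φ'' : Elem G T P'') (ψ'' : Elem F P'' S)
    (h1 : φ'.idx.val + 1 = ψ''.idx.val + G.k) (h2 : φ''.idx.val = ψ'.idx.val)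
    (hlt : ψ'.idx.val < ψ''.idx.val)
    {p q r pq pr d : ℤ} (h₁ : p + q = pq) (h₂ : pq + r = d) (h₃ : p + r = pr) (h₄ : pr + q = d)
    (x : EndObj A S p) (g : EndObj A G q) (f : EndObj A F r) :
    circ φ' h₂ (circ ψ' h₁ x g) f = sgn k (q * r) • circ φ'' h₄ (circ ψ'' h₃ x f) g := by
  apply ext_ev
  intro b hb
  have k1 := φ'.k_eq
  have k2 := ψ'.k_eq
  have k3 := φ''.k_eq
  have k4 := ψ''.k_eq
  have m1 := φ'.two_le
  have m2 := ψ'.two_le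
  have i1 := ψ''.idx.2
  have i2 := ψ'.idx.2
  rw [ev_smul, ev_circ, ev_circ ψ', ev_circ, ev_circ ψ'', Coll.Elt.smul_smul, Coll.Elt.smul_smul,
    Coll.Elt.smul_smul]
  have key : graft ψ' g (graft φ' f b hb) (graft_src φ' f b hb) =
      graft ψ'' f (graft φ'' g b hb) (graft_src φ'' g b hb) := by
    funext t
    have ht := t.2
    rcases lt_trichotomy t.val ψ'.idx.val with h | h | h
    · rw [graft_lt ψ' g _ _ (j := ⟨t.val, by omega⟩) h rfl,
        graft_lt φ' f _ _ (j := ⟨t.val, by omega⟩) (by simp only; omega) rfl,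
        graft_lt ψ'' f _ _ (j := ⟨t.val, by omega⟩) (by omega) rfl,
        graft_lt φ'' g _ _ (j := ⟨t.val, by omega⟩) (by simp only; omega) rfl]
    · rw [graft_lt ψ'' f _ _ (j := ⟨t.val, by omega⟩) (by omega) rfl]
      have e : ∀ l (j : Fin P'.k), j.val = ψ'.idx.val + l.val →
          b (φ''.incl l) = graft φ' f b hb j := by
        intro l j hj
        symm
        have := l.2
        apply graft_lt _ _ _ _ (by omega)
        rw [φ''.incl_val]
        omega
      rw [graft_idx ψ' g _ _ h e fun l => (φ''.src_incl l).trans (hb _), graft,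
        if_pos (Fin.ext (by simp only; omega))]
    · rw [graft_gt ψ' g _ _ (j := ⟨t.val + G.k - 1, by omega⟩) h (by simp only; omega)]
      rcases lt_trichotomy t.val ψ''.idx.val with h' | h' | h'
      · rw [graft_lt ψ'' f _ _ (j := ⟨t.val, by omega⟩) h' rfl,
          graft_lt φ' f _ _ (j := ⟨t.val + G.k - 1, by omega⟩) (by simp only; omega) rfl,
          graft_gt φ'' g _ _ (j := ⟨t.val + G.k - 1, by omega⟩) (by simp only; omega)
            (by simp only; omega)]
      · have e : ∀ l (j : Fin P''.k), j.val = ψ''.idx.val + l.val →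
            b (φ'.incl l) = graft φ'' g b hb j := by
          intro l j hj
          symm
          apply graft_gt _ _ _ _ (by omega)
          rw [φ'.incl_val]
          omega
        rw [graft_idx ψ'' f _ _ h' e fun l => (φ'.src_incl l).trans (hb _), graft,
          if_pos (Fin.ext (by simp only; omega))]
      · rw [graft_gt ψ'' f _ _ (j := ⟨t.val + F.k - 1, by omega⟩) h' (by simp only; omega),
          graft_gt φ' f _ _ (j := ⟨t.val + G.k - 1 + F.k - 1, by omega⟩) (by simp only; omega)
            (by simp only; omega),
          graft_gt φ'' g _ _ (j := ⟨t.val + G.k - 1 + F.k - 1, by omega⟩) (by simp only; omega)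
            (by simp only; omega)]
  rw [x.ev_congr key]
  congr 1
  rw [← sgn_add, ← sgn_add, ← sgn_add, psum_graft φ' f b hb _ (by omega), if_pos (by omega),
    psum_graft φ'' g b hb _ (by omega), if_neg (by omega), h2,
    show ψ''.idx.val + G.k - 1 = φ'.idx.val by omega]
  symm
  -- The product `q * r` occurs twice on one side, from the axiom and from `f` passing `g`, and is
  -- invisible modulo two.
  apply sgn_eq k (q * r)
  ring

theorem circ_disjoint {F G T P' P'' S : Per} (φ' : Elem F T P') (ψ' : Elem G P' S)
    (φ'' : Elem G T P'') (ψ'' : Elem F P'' S) (hi : ψ'.hom.base φ'.idx = ψ''.idx)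
    (hj : ψ''.hom.base φ''.idx = ψ'.idx) (hij : ψ'.idx ≠ ψ''.idx)
    {p q r pq pr d : ℤ} (h₁ : p + q = pq) (h₂ : pq + r = d) (h₃ : p + r = pr) (h₄ : pr + q = d)
    (x : EndObj A S p) (g : EndObj A G q) (f : EndObj A F r) :
    circ φ' h₂ (circ ψ' h₁ x g) f = sgn k (q * r) • circ φ'' h₄ (circ ψ'' h₃ x f) g := by
  have hij' : ψ'.idx.val ≠ ψ''.idx.val := fun h => hij (Fin.ext h)
  have hi' := congrArg Fin.val hi
  have hj' := congrArg Fin.val hj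
  rw [ψ'.base_val] at hi'
  rw [ψ''.base_val] at hj'
  simp only [contr] at hi' hj'
  have m1 := ψ'.two_le
  have m2 := ψ''.two_le
  rcases lt_or_gt_of_ne hij' with h | h
  · exact circ_disjoint_aux φ' ψ' φ'' ψ'' (by omega) (by omega) h h₁ h₂ h₃ h₄ x g f
  · rw [circ_disjoint_aux φ'' ψ'' φ' ψ' (by omega) (by omega) h h₃ h₄ h₁ h₂ x f g, smul_smul,
      mul_comm r q, sgn_mul_self, one_smul]

theorem one_circ {T : Per} {n : ℕ+} (φ : Elem T T (term n)) {d : ℤ} (h : 0 + d = d)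
    (x : EndObj A T d) : circ φ h (one A n) x = x := by
  apply ext_ev
  intro b hb
  have h0 : φ.idx.val = 0 := Nat.lt_one_iff.1 φ.idx.2
  rw [ev_circ, ev_one, h0, psum_zero, mul_zero, sgn_zero, Coll.Elt.one_smul]
  refine graft_idx φ x b hb h0.symm (fun l j hj => ?_) hb
  congr 1
  apply Fin.ext
  omega

end EndObj

/-- The endomorphism operad of a collection. -/
def endOperad (A : Coll k) : MarklOperad k where
  obj T p := ModuleCat.of k (EndObj A T p)
  circ {_ _ _} φ {_ _ _} h := EndObj.circ φ h
  one n := EndObj.one A n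
  joint φ ψ ξ χ hi _ _ _ _ _ _ h₁ h₂ h₃ h₄ x y z :=
    EndObj.circ_joint φ ψ ξ χ hi h₁ h₂ h₃ h₄ x y z
  disjoint φ' ψ' φ'' ψ'' hi hj hij _ _ _ _ _ _ h₁ h₂ h₃ h₄ x g f :=
    EndObj.circ_disjoint φ' ψ' φ'' ψ'' hi hj hij h₁ h₂ h₃ h₄ x g f
  one_circ φ _ h x := EndObj.one_circ φ h x

/-! ### Algebras as morphisms to the endomorphism operad -/

section Algebra

variable {M : MarklOperad k}

theorem sgn_smul_sgn_smul {V : Type*} [AddCommGroup V] [Module k V] (i : ℤ) (v : V) :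
    sgn k i • sgn k i • v = v := by
  rw [smul_smul, sgn_mul_self, one_smul]

/-- The structure operations of an algebra as a morphism to the endomorphism operad. -/
def AlgebraStr.toHom (σ : AlgebraStr M A) : M ⟶ endOperad A :=
  MarklOperad.Hom.mk
    (fun X p =>
      { toFun := fun x => (fun i => σ.act X i.hn i.hc i.hD x : EndObj A X p)
        map_add' := fun x y => by
          funext i
          exact map_add (σ.act X i.hn i.hc i.hD) x y
        map_smul' := fun s x => by
          funext i
          exact map_smul (σ.act X i.hn i.hc i.hD) s x })
    (fun {F T S} φ {i j d} h x y => by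
      apply EndObj.ext_ev
      intro b hb
      refine Eq.trans ?_ (EndObj.ev_circ φ h _ _ b hb).symm
      have hD : i + ∑ t, (EndObj.graft φ (fun i => σ.act F i.hn i.hc i.hD y) b hb t).2.1 =
          d + ∑ j, (b j).2.1 := by
        rw [φ.sum_contr (fun j => (b j).2.1) _ (q := j)
          (by rw [EndObj.graft, if_pos rfl]; rfl)
          (fun t ht => by rw [EndObj.graft, if_neg ht]), ← add_assoc, h]
      have := σ.assoc φ h x y (n := T.n) rfl φ.hom.n_eq.symm hb (d := fun j => (b j).2.1) rfl
        (fun j => (b j).2.2) (fun l => (φ.src_incl l).trans (hb _)) rfl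
        (EndObj.graft φ (fun i => σ.act F i.hn i.hc i.hD y) b hb)
        (by rw [EndObj.graft, if_pos rfl]; rfl)
        (fun j hj => by
          rw [EndObj.graft, if_neg hj, φ.sec_base hj])
        (EndObj.graft_src φ _ b hb)
        hD
      refine (congrArg A.elt this).trans ?_
      rw [φ.sum_lt, Coll.elt_smul]
      congr 1
      exact EndObj.elt_apply (fun i => σ.act S i.hn i.hc i.hD x) φ.hom.n_eq.symm
        (EndObj.graft_src φ _ b hb) hD fun t => (EndObj.graft φ _ b hb t).2.2)
    (fun n => by
      apply EndObj.ext_ev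
      intro b hb
      refine Eq.trans ?_ (EndObj.ev_one n b hb).symm
      have hb0 : ∀ t, b t = b ⟨0, Nat.one_pos⟩ := fun t =>
        congrArg b (Subsingleton.elim (α := Fin 1) _ _)
      rcases hb0' : b ⟨0, Nat.one_pos⟩ with ⟨n', d, a⟩
      obtain rfl : b = fun _ => ⟨n', d, a⟩ := funext fun t => (hb0 t).trans hb0'
      obtain rfl : n = n' := (src_term n ⟨0, Nat.one_pos⟩).symm.trans (hb _)
      have hD : 0 + ∑ _j : Fin (term n).k, d = d := by
        rw [zero_add]
        exact Fin.sum_univ_one fun _ => d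
      refine Eq.trans ?_ (congrArg A.elt (σ.unit hb hD a))
      exact (EndObj.elt_apply (fun i => σ.act (term n) i.hn i.hc i.hD (M.one n)) rfl hb hD
        fun _ => a).symm)

/-- The algebra structure corresponding to a morphism to the endomorphism operad. -/
def AlgebraStr.ofHom (f : M ⟶ endOperad A) : AlgebraStr M A where
  act T n hn c hc p d D hD :=
    { toFun := fun x => (f.app T p x : EndObj A T p) ⟨n, hn, c, hc, d, D, hD⟩
      map_add' := fun x y => by rw [map_add]; rfl
      map_smul' := fun s x => by rw [map_smul]; rfl }
  unit {n} hc {d} hD a := by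
    have e : f.app (term n) 0 (M.one n) = EndObj.one A n := f.map_one n
    apply A.elt_injective
    refine (EndObj.elt_apply _ rfl hc hD _).trans ?_
    exact (congrArg (fun z : EndObj A (term n) 0 => z.ev _ hc) e).trans (EndObj.ev_one n _ hc)
  assoc {F S T} φ {p q r} hr x y {n} hS hT {c} hc {d D} hD a hcF {D'} hD' b hb hb' hcT hDT := by
    apply A.elt_injective
    refine (EndObj.elt_apply _ hS hc hD _).trans ?_
    rw [φ.sum_lt, Coll.elt_smul]
    have e : f.app S r (M.circ φ hr x y) = EndObj.circ φ hr (f.app T p x) (f.app F q y) :=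
      f.map_circ φ hr x y
    refine ((congrArg (fun z : EndObj A S r => z.ev _ hc) e).trans
      (EndObj.ev_circ φ hr _ _ _ hc)).trans ?_
    refine congrArg (Coll.Elt.smul _) (Eq.trans ?_
      (EndObj.elt_apply (f.app T p x : EndObj A T p) hT hcT hDT _).symm)
    apply EndObj.ev_congr
    funext t
    by_cases ht : t = φ.idx
    · subst ht
      refine (if_pos rfl).trans (Eq.trans ?_ hb.symm)
      exact (EndObj.elt_apply (f.app F q y : EndObj A F q) rfl hcF hD' _).symm
    · refine (if_neg ht).trans ?_
      have h1 := φ.base_sec t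
      have := hb' (φ.sec t) (by rwa [h1])
      rw [h1] at this
      exact this.symm

theorem AlgebraStr.ofHom_toHom (σ : AlgebraStr M A) : ofHom σ.toHom = σ := by
  cases σ
  rfl

end Algebra

end PerOperads

/-! ### Universal properties of free and presented operads -/

namespace PerOperads

open Per

universe u

variable {k : Type u} [Field k]

theorem PreOperad.Ideal.gen_le {M : PreOperad k} {R : ∀ (X : Per) (d : ℤ), Set (M.obj X d)}
    (I : M.Ideal) (h : ∀ Y e, R Y e ⊆ I.carrier Y e) (X : Per) (d : ℤ) :
    (gen M R).carrier X d ≤ I.carrier X d :=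
  iInf_le (fun I : {I : M.Ideal // ∀ Y e, R Y e ⊆ I.carrier Y e} => I.1.carrier X d) ⟨I, h⟩

/-- The kernel of a family of maps compatible with the circle products. -/
def PreOperad.kerIdeal {M N : PreOperad k} (f : ∀ (X : Per) (d : ℤ), M.obj X d →ₗ[k] N.obj X d)
    (hf : ∀ {F T S : Per} (φ : Elem F T S) {i j d : ℤ} (h : i + j = d)
      (x : M.obj S i) (y : M.obj F j),
      f T d (M.circ φ h x y) = N.circ φ h (f S i x) (f F j y)) : M.Ideal where
  carrier X d := LinearMap.ker (f X d)
  circ_left φ _ _ _ h x y hx := by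
    rw [LinearMap.mem_ker] at hx ⊢
    rw [hf, hx, map_zero, LinearMap.zero_apply]
  circ_right φ _ _ _ h x y hy := by
    rw [LinearMap.mem_ker] at hy ⊢
    rw [hf, hy, map_zero]

section Free

variable {E : Per → GrVect k} {N : MarklOperad k}

/-- The value of a formal composite. -/
noncomputable def Tree.eval (g : ∀ X d, E X d →ₗ[k] N.obj X d) :
    ∀ {X : Per} {d : ℤ}, Tree E X d → N.obj X d
  | _, _, .one n => N.one n
  | _, _, .gen e => g _ _ e
  | _, _, .circ φ h a b => N.circ φ h (a.eval g) (b.eval g)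

/-- The value of a linear combination of formal composites. -/
noncomputable def treeLift (g : ∀ X d, E X d →ₗ[k] N.obj X d) (X : Per) (d : ℤ) :
    (treeOperad E).obj X d →ₗ[k] N.obj X d :=
  Finsupp.lift (N.obj X d) k (Tree E X d) (Tree.eval g)

theorem treeLift_single (g : ∀ X d, E X d →ₗ[k] N.obj X d) {X : Per} {d : ℤ} (t : Tree E X d)
    (c : k) : treeLift g X d (Finsupp.single t c : Tree E X d →₀ k) = c • t.eval g := by
  exact Finsupp.sum_single_index (zero_smul k _)

theorem treeOperad_circ_single {F T S : Per} (φ : Elem F T S) {i j d : ℤ} (h : i + j = d)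
    (a : Tree E S i) (b : Tree E F j) (s t : k) :
    (treeOperad E).circ φ h (Finsupp.single a s : Tree E S i →₀ k)
      (Finsupp.single b t : Tree E F j →₀ k) =
      (Finsupp.single (Tree.circ φ h a b) (s * t) : Tree E T d →₀ k) := by
  refine (congrArg (fun f : (Tree E F j →₀ k) →ₗ[k] (Tree E T d →₀ k) => f (Finsupp.single b t))
    (Finsupp.lsum_single k _ a s)).trans ?_
  rw [LinearMap.toSpanSingleton_apply, LinearMap.smul_apply, Finsupp.lmapDomain_apply,
    Finsupp.mapDomain_single, Finsupp.smul_single, smul_eq_mul]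

theorem treeLift_circ (g : ∀ X d, E X d →ₗ[k] N.obj X d) {F T S : Per} (φ : Elem F T S)
    {i j d : ℤ} (h : i + j = d) (x : (treeOperad E).obj S i) (y : (treeOperad E).obj F j) :
    treeLift g T d ((treeOperad E).circ φ h x y) =
      N.circ φ h (treeLift g S i x) (treeLift g F j y) := by
  have key : ((treeOperad E).circ φ h).compr₂ (treeLift g T d) =
      (N.circ φ h).compl₁₂ (treeLift g S i) (treeLift g F j) := by
    refine Finsupp.lhom_ext fun a s => ?_
    refine Finsupp.lhom_ext fun b t => ?_
    change treeLift g T d ((treeOperad E).circ φ h _ _) = N.circ φ h (treeLift g S i _)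
      (treeLift g F j _)
    refine (congrArg (treeLift g T d) (treeOperad_circ_single φ h a b s t)).trans ?_
    rw [treeLift_single, treeLift_single, treeLift_single, map_smul, map_smul,
      LinearMap.smul_apply, smul_smul, mul_comm]
    rfl
  exact congrArg (fun f => f x y) key

theorem treeLift_gen (g : ∀ X d, E X d →ₗ[k] N.obj X d) {X : Per} {d : ℤ} (e : E X d) :
    treeLift g X d (treeGen E e) = g X d e :=
  (treeLift_single g _ _).trans (one_smul _ _)

theorem treeLift_one (g : ∀ X d, E X d →ₗ[k] N.obj X d) (n : ℕ+) :
    treeLift g (term n) 0 ((treeOperad E).one n) = N.one n :=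
  (treeLift_single g _ _).trans (one_smul _ _)

/-- The kernel of the evaluation is an ideal, and the relations which generate the ideal of the free
operad are linearity of `g` and axioms which hold in `N`. -/
theorem freeIdeal_le_ker (g : ∀ X d, E X d →ₗ[k] N.obj X d) (X : Per) (d : ℤ) :
    (freeIdeal E).carrier X d ≤ LinearMap.ker (treeLift g X d) := by
  refine PreOperad.Ideal.gen_le
    (PreOperad.kerIdeal (N := N.toPreOperad) (treeLift g) (treeLift_circ g)) ?_ X d
  rintro Y e x hx
  change treeLift g Y e x = 0
  induction hx with
  | add e e' => rw [map_sub, map_add, treeLift_gen, treeLift_gen, treeLift_gen, map_add, sub_self]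
  | smul c e => rw [map_sub, map_smul, treeLift_gen, treeLift_gen, map_smul, sub_self]
  | joint φ ψ ξ χ hi h₁ h₂ h₃ h₄ x y z =>
    rw [map_sub, treeLift_circ, treeLift_circ, treeLift_circ, treeLift_circ,
      N.joint φ ψ ξ χ hi h₁ h₂ h₃ h₄, sub_self]
  | disjoint φ' ψ' φ'' ψ'' hi hj hij h₁ h₂ h₃ h₄ x g f =>
    rw [map_sub, map_smul, treeLift_circ, treeLift_circ, treeLift_circ, treeLift_circ,
      N.disjoint φ' ψ' φ'' ψ'' hi hj hij h₁ h₂ h₃ h₄, sub_self]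
  | one_circ φ h x =>
    rw [map_sub, treeLift_circ, treeLift_one, N.one_circ, sub_self]

/-- The morphism from the free operad extending a map of collections. -/
noncomputable def freeLift (g : ∀ X d, E X d →ₗ[k] N.obj X d) : MarklOperad.Hom (freeOperad E) N where
  app X d := ((freeIdeal E).carrier X d).liftQ (treeLift g X d) (freeIdeal_le_ker g X d)
  map_circ {_ _ _} φ {_ _ _} h x y := by
    obtain ⟨x, rfl⟩ := Submodule.Quotient.mk_surjective _ x
    obtain ⟨y, rfl⟩ := Submodule.Quotient.mk_surjective _ y
    exact treeLift_circ g φ h x y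
  map_one n := treeLift_one g n

theorem freeLift_gen (g : ∀ X d, E X d →ₗ[k] N.obj X d) (X : Per) (d : ℤ) (e : E X d) :
    (freeLift g).app X d (freeGen E X d e) = g X d e :=
  treeLift_gen g e

open Classical in
/-- The values of the quadratic expressions in the generators. -/
noncomputable def quadEval (g : ∀ X d, E X d →ₗ[k] N.obj X d) (X : Per) (d : ℤ) :
    FreeQuad E X d →ₗ[k] N.obj X d :=
  DirectSum.toModule k (Tower₂ X d) _ fun t => TensorProduct.lift
    (sgn k (t.i * t.j) • ((N.circ t.φ ((add_comm _ _).trans t.deg)).compl₁₂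
      (g t.S t.j) (g t.F t.i)).flip)

open Classical in
theorem quadEval_of (g : ∀ X d, E X d →ₗ[k] N.obj X d) {X : Per} {d : ℤ} (t : Tower₂ X d)
    (a : E t.F t.i) (b : E t.S t.j) :
    quadEval g X d (DirectSum.lof k (Tower₂ X d)
      (fun t => TensorProduct k (E t.F t.i) (E t.S t.j)) t (a ⊗ₜ b)) =
      sgn k (t.i * t.j) • N.circ t.φ ((add_comm _ _).trans t.deg) (g t.S t.j b) (g t.F t.i a) := by
  rw [quadEval, DirectSum.toModule_lof]
  rfl

open Classical in
theorem map_toFree (f : MarklOperad.Hom (freeOperad E) N) (X : Per) (d : ℤ)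
    (x : FreeQuad E X d) :
    f.app X d (FreeQuad.toFree E X d x) = quadEval (fun X d => f.app X d ∘ₗ freeGen E X d) X d x := by
  have : f.app X d ∘ₗ FreeQuad.toFree E X d =
      quadEval (fun X d => f.app X d ∘ₗ freeGen E X d) X d := by
    apply DirectSum.linearMap_ext
    intro t
    apply TensorProduct.ext'
    intro a b
    rw [LinearMap.comp_apply, LinearMap.comp_apply, LinearMap.comp_apply, quadEval_of,
      FreeQuad.toFree, DirectSum.toModule_lof]
    change f.app X d (sgn k (t.i * t.j) • (freeOperad E).circ t.φ _ (freeGen E t.S t.j b)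
      (freeGen E t.F t.i a)) = _
    rw [map_smul, f.map_circ]
    rfl
  exact congrArg (fun f => f x) this

end Free

namespace QuadraticData

variable {D : QuadraticData k} {N : MarklOperad k}

variable (D) in
/-- The ideal of relations of the operad presented by quadratic data. -/
noncomputable def relIdeal : (freeOperad D.E).toPreOperad.Ideal :=
  PreOperad.Ideal.gen _ fun X d => FreeQuad.toFree D.E X d '' D.R X d

variable (D) in
/-- The generators of the operad presented by quadratic data. -/
noncomputable def gen (X : Per) (d : ℤ) : D.E X d →ₗ[k] D.operad.obj X d :=
  (D.relIdeal.carrier X d).mkQ ∘ₗ freeGen D.E X d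

/-- The morphism from a presented operad extending a map which annihilates the relations. -/
noncomputable def lift (g : ∀ X d, D.E X d →ₗ[k] N.obj X d)
    (hg : ∀ X d, ∀ x ∈ D.R X d, quadEval g X d x = 0) : D.operad ⟶ N :=
  MarklOperad.Hom.mk
    (fun X d => (D.relIdeal.carrier X d).liftQ ((freeLift g).app X d)
      (PreOperad.Ideal.gen_le (PreOperad.kerIdeal (N := N.toPreOperad) (freeLift g).app
        (freeLift g).map_circ) (by
          rintro Y e _ ⟨x, hx, rfl⟩
          change (freeLift g).app Y e _ = 0
          rw [map_toFree, ← hg Y e x hx]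
          congr 2
          funext X d
          apply LinearMap.ext
          intro e
          exact freeLift_gen g X d e) X d))
    (fun {_ _ _} φ {_ _ _} h x y => by
      obtain ⟨x, rfl⟩ := Submodule.Quotient.mk_surjective _ x
      obtain ⟨y, rfl⟩ := Submodule.Quotient.mk_surjective _ y
      exact (freeLift g).map_circ φ h x y)
    (fun n => (freeLift g).map_one n)

theorem lift_gen (g : ∀ X d, D.E X d →ₗ[k] N.obj X d)
    (hg : ∀ X d, ∀ x ∈ D.R X d, quadEval g X d x = 0) (X : Per) (d : ℤ) (e : D.E X d) :
    (lift g hg).app X d (D.gen X d e) = g X d e :=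
  freeLift_gen g X d e

/-- A family of subspaces of a presented operad which contains the units and the generators and is
closed under the circle products is everything. -/
theorem generation (W : ∀ X d, Submodule k (D.operad.obj X d))
    (h1 : ∀ n, D.operad.one n ∈ W (term n) 0) (hg : ∀ X d e, D.gen X d e ∈ W X d)
    (hc : ∀ {F T S : Per} (φ : Elem F T S) {i j d : ℤ} (h : i + j = d)
      (x : D.operad.obj S i) (y : D.operad.obj F j), x ∈ W S i → y ∈ W F j →
      D.operad.circ φ h x y ∈ W T d) (X : Per) (d : ℤ) (x : D.operad.obj X d) : x ∈ W X d := by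
  let π : ∀ X d, (treeOperad D.E).obj X d →ₗ[k] D.operad.obj X d := fun X d =>
    (D.relIdeal.carrier X d).mkQ ∘ₗ ((freeIdeal D.E).carrier X d).mkQ
  have key : ∀ {X : Per} {d : ℤ} (t : Tree D.E X d),
      π X d (Finsupp.single t 1 : Tree D.E X d →₀ k) ∈ W X d := by
    intro X d t
    induction t with
    | one n => exact h1 n
    | gen e => exact hg _ _ e
    | @circ F T S φ i j d h a b iha ihb =>
      have := hc φ h _ _ iha ihb
      have e := treeOperad_circ_single φ h a b (1 : k) 1
      rw [one_mul] at e
      rw [← e]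
      exact this
  obtain ⟨x, rfl⟩ := Submodule.Quotient.mk_surjective _ x
  obtain ⟨x, rfl⟩ := Submodule.Quotient.mk_surjective _ x
  change π X d x ∈ W X d
  induction x using Finsupp.induction_linear with
  | zero => exact (map_zero (π X d)).symm ▸ zero_mem _
  | add a b ha hb => exact (map_add (π X d) a b).symm ▸ add_mem ha hb
  | single t c =>
    have := Submodule.smul_mem _ c (key t)
    have e : π X d (Finsupp.single t c : Tree D.E X d →₀ k) =
        c • π X d (Finsupp.single t 1 : Tree D.E X d →₀ k) :=
      (congrArg (π X d) (Finsupp.smul_single_one t c).symm).trans (map_smul (π X d) c _)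
    exact e ▸ this

/-- The locus where two morphisms agree contains the units and is closed under circle products, so
`generation` applies to it. -/
theorem hom_ext {f g : D.operad ⟶ N}
    (h : ∀ X d e, f.app X d (D.gen X d e) = g.app X d (D.gen X d e)) : f = g := by
  apply MarklOperad.Hom.ext
  funext X d
  apply LinearMap.ext
  intro x
  refine generation (fun X d => LinearMap.eqLocus (f.app X d) (g.app X d))
    (fun n => (f.map_one n).trans (g.map_one n).symm) h (fun φ _ _ _ h x y hx hy => ?_) X d x
  rw [LinearMap.mem_eqLocus] at hx hy ⊢
  rw [f.map_circ, g.map_circ, hx, hy]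

theorem gen_rel (X : Per) (d : ℤ) {x : FreeQuad D.E X d} (hx : x ∈ D.R X d) :
    quadEval (N := D.operad) D.gen X d x = 0 := by
  have := map_toFree (N := D.operad) (E := D.E) ⟨fun X d => (D.relIdeal.carrier X d).mkQ,
    fun {_ _ _} _ {_ _ _} _ _ _ => rfl, fun _ => rfl⟩ X d x
  refine this.symm.trans ?_
  exact (Submodule.Quotient.mk_eq_zero _).2 (PreOperad.Ideal.subset_gen _ _ ⟨x, hx, rfl⟩)

theorem map_quadEval {E : Per → GrVect k} {M : MarklOperad k} (f : M ⟶ N)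
    (g : ∀ X d, E X d →ₗ[k] M.obj X d)
    (X : Per) (d : ℤ) (x : FreeQuad E X d) :
    f.app X d (quadEval g X d x) = quadEval (fun X d => f.app X d ∘ₗ g X d) X d x := by
  classical
  have : f.app X d ∘ₗ quadEval g X d = quadEval (fun X d => f.app X d ∘ₗ g X d) X d := by
    apply DirectSum.linearMap_ext
    intro t
    apply TensorProduct.ext'
    intro a b
    rw [LinearMap.comp_apply, LinearMap.comp_apply, LinearMap.comp_apply, quadEval_of,
      quadEval_of, map_smul, f.map_circ]
    rfl
  exact congrArg (fun f => f x) this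

end QuadraticData

end PerOperads

/-! ### Factorizations of contractions -/

namespace PerOperads

open Per

universe u

namespace Per

theorem Elem.eq_of_term {F T : Per} {n : ℕ+} (φ : Elem F T (term n)) : F = T := by
  have hk := φ.k_eq
  have h1 : (term n).k = 1 := rfl
  have h0 : φ.idx.val = 0 := Nat.lt_one_iff.1 φ.idx.2
  refine (φ.isRestr_fiber T.isRestr_self).eq T.isRestr_self (by omega) ?_ ?_
  · ext x
    have := (T.map x).2
    simp only [Set.mem_ofPred_eq, Set.mem_univ, true_and, iff_true]
    omega
  · intro x _
    omega

theorem exists_elem_of_isRestr_fiber {F T : Per} {i : ℕ} (hF : 2 ≤ F.k) (hi : i + F.k ≤ T.k)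
    {N : ℕ} {s s' : Set (Fin N)} {g g' : Fin N → ℕ} (rT : IsRestr T s g) (rF : IsRestr F s' g')
    (hs' : s' = {x | x ∈ s ∧ i ≤ g x ∧ g x < i + F.k}) (hg' : ∀ x ∈ s', g' x = g x - i) :
    ∃ (S : Per) (φ : Elem F T S), φ.idx.val = i := by
  obtain ⟨F', S, φ, rfl, hk⟩ := T.exists_elem hF hi
  obtain rfl : F = F' := rF.eq (φ.isRestr_fiber rT) hk.symm (by rw [hs', hk]) hg'
  exact ⟨S, φ, rfl⟩

/-- An elementary morphism out of the nontrivial fiber extends to the whole domain. -/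
theorem Elem.exists_joint {F G H T P : Per} (ξ : Elem H T P) (χ : Elem F H G) (hG : 2 ≤ G.k) :
    ∃ (S : Per) (φ : Elem F T S) (ψ : Elem G S P), φ.idx.val = ξ.idx.val + χ.idx.val ∧
      ψ.hom.base φ.idx = ψ.idx := by
  have k1 := ξ.k_eq
  have k2 := χ.k_eq
  have m1 := χ.two_le
  have i1 := ξ.idx.2
  have i2 := χ.idx.2
  obtain ⟨S, φ, hφ⟩ := exists_elem_of_isRestr_fiber (i := ξ.idx.val + χ.idx.val) χ.two_le
    (by omega) T.isRestr_self (χ.isRestr_fiber (ξ.isRestr_fiber T.isRestr_self))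
    (by
      ext x
      simp only [Set.mem_ofPred_eq, Set.mem_univ, true_and]
      omega)
    (fun x _ => by omega)
  have k3 := φ.k_eq
  obtain ⟨ψ, hψ⟩ := exists_elem_of_isRestr (i := ξ.idx.val) hG (by omega) (by omega)
    (φ.isRestr_target T.isRestr_self) (χ.isRestr_target (ξ.isRestr_fiber T.isRestr_self))
    (ξ.isRestr_target T.isRestr_self)
    (by
      ext x
      simp only [Set.mem_ofPred_eq, Set.mem_univ, true_and, hφ, contr]
      omega)
    rfl
    (fun x hx => by
      simp only [Set.mem_ofPred_eq, Set.mem_univ, true_and] at hx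
      simp only [hφ, contr]
      omega)
    (fun x _ => by simp only [hφ, contr]; omega)
  refine ⟨S, φ, ψ, hφ, ?_⟩
  rw [ψ.base_eq_idx_iff, hψ, hφ]
  omega

/-- Contractions of disjoint intervals commute. -/
theorem Elem.exists_disjoint {F G T P' P'' : Per} (φ' : Elem F T P') (φ'' : Elem G T P'')
    (h : φ''.idx.val + G.k ≤ φ'.idx.val) :
    ∃ (S : Per) (ψ' : Elem G P' S) (ψ'' : Elem F P'' S), ψ'.hom.base φ'.idx = ψ''.idx ∧
      ψ''.hom.base φ''.idx = ψ'.idx ∧ ψ'.idx ≠ ψ''.idx := by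
  have k1 := φ'.k_eq
  have k2 := φ''.k_eq
  have m1 := φ'.two_le
  have m2 := φ''.two_le
  have i1 := φ'.idx.2
  obtain ⟨S, ψ', h'⟩ := exists_elem_of_isRestr_fiber (i := φ''.idx.val) φ''.two_le
    (by omega) (φ'.isRestr_target T.isRestr_self) (φ''.isRestr_fiber T.isRestr_self)
    (by
      ext x
      simp only [Set.mem_ofPred_eq, Set.mem_univ, true_and, contr]
      omega)
    (fun x hx => by
      simp only [Set.mem_ofPred_eq, Set.mem_univ, true_and] at hx
      simp only [contr]
      omega)
  have k3 := ψ'.k_eq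
  obtain ⟨ψ'', h''⟩ := exists_elem_of_isRestr (i := φ'.idx.val + 1 - G.k) φ'.two_le (by omega)
    (by omega) (φ''.isRestr_target T.isRestr_self) (φ'.isRestr_fiber T.isRestr_self)
    (ψ'.isRestr_target (φ'.isRestr_target T.isRestr_self))
    (by
      ext x
      simp only [Set.mem_ofPred_eq, Set.mem_univ, true_and, contr]
      omega)
    rfl
    (fun x hx => by
      simp only [Set.mem_ofPred_eq, Set.mem_univ, true_and] at hx
      simp only [contr]
      omega)
    (fun x _ => by simp only [h', contr]; omega)
  refine ⟨S, ψ', ψ'', Fin.ext ?_, Fin.ext ?_, fun e => ?_⟩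
  · rw [ψ'.base_val, h', h'', contr]
    omega
  · rw [ψ''.base_val, h', h'', contr]
    omega
  · have := congrArg Fin.val e
    omega

/-- The contractions of `{i, i + 1}` and of `{i + 1, i + 2}` both factor the contraction of
`{i, i + 1, i + 2}`. -/
theorem Elem.exists_overlap {F F' T S S' : Per} (φ : Elem F T S) (φ' : Elem F' T S')
    (hF : F.k = 2) (hF' : F'.k = 2) (h : φ'.idx.val = φ.idx.val + 1) :
    ∃ (H P G G' : Per) (_ : Elem H T P) (χ : Elem F H G) (χ' : Elem F' H G') (ψ : Elem G S P)
      (ψ' : Elem G' S' P), G.k = 2 ∧ G'.k = 2 ∧ χ.idx.val = 0 ∧ χ'.idx.val = 1 ∧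
      ψ.hom.base φ.idx = ψ.idx ∧ ψ'.hom.base φ'.idx = ψ'.idx := by
  have k1 := φ.k_eq
  have k2 := φ'.k_eq
  have i2 := φ'.idx.2
  obtain ⟨H, P, ξ, hξ, hH⟩ := T.exists_elem (i := φ.idx.val) (m := 3) (by omega) (by omega)
  obtain ⟨G, χ, hχ⟩ := exists_elem_of_isRestr_fiber (i := 0) φ.two_le
    (by omega) (ξ.isRestr_fiber T.isRestr_self) (φ.isRestr_fiber T.isRestr_self)
    (by
      ext x
      simp only [Set.mem_ofPred_eq, Set.mem_univ, true_and]
      omega)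
    (fun x _ => by omega)
  obtain ⟨G', χ', hχ'⟩ := exists_elem_of_isRestr_fiber (i := 1) φ'.two_le
    (by omega) (ξ.isRestr_fiber T.isRestr_self) (φ'.isRestr_fiber T.isRestr_self)
    (by
      ext x
      simp only [Set.mem_ofPred_eq, Set.mem_univ, true_and]
      omega)
    (fun x _ => by omega)
  have k3 := χ.k_eq
  have k4 := χ'.k_eq
  obtain ⟨S₁, φ₁, ψ, e, hψ⟩ := ξ.exists_joint χ (by omega)
  obtain ⟨S₂, φ₂, ψ', e', hψ'⟩ := ξ.exists_joint χ' (by omega)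
  obtain ⟨-, rfl, hh⟩ := φ.unique φ₁ (by omega) rfl
  obtain rfl := eq_of_heq hh
  obtain ⟨-, rfl, hh⟩ := φ'.unique φ₂ (by omega) rfl
  obtain rfl := eq_of_heq hh
  exact ⟨H, P, G, G', ξ, χ, χ', ψ, ψ', by omega, by omega, hχ, hχ', hψ, hψ'⟩

theorem exists_eq_term {T : Per} (h : T.k = 1) : ∃ n, T = term n := ⟨_, eq_term h⟩

end Per

/-! ### Uniqueness of iterated composites of binary generators -/

variable {k : Type u} [Field k]

/-- The quadratic relation `(a b) c = ± a (b c)` between elements of degree `ε` indexed by the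
surjections onto two-element sets. -/
def QuadRel (N : MarklOperad k) (ε : ℤ) (m : ∀ T : Per, T.k = 2 → N.obj T ε) : Prop :=
  ∀ {F F' X S S' : Per} (φ : Elem F X S) (φ' : Elem F' X S') (hF : F.k = 2) (hS : S.k = 2)
    (hF' : F'.k = 2) (hS' : S'.k = 2), φ.idx.val = 0 → φ'.idx.val = 1 →
    ∀ {d : ℤ} (h : ε + ε = d),
      N.circ φ h (m S hS) (m F hF) = sgn k ε • N.circ φ' h (m S' hS') (m F' hF')

section Mono

variable {N : MarklOperad k} {m : ∀ T : Per, T.k = 2 → N.obj T 0}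

variable (N m) in
/-- Iterated composites of elements indexed by the surjections onto two-element sets. -/
inductive IsMono : ∀ X : Per, N.obj X 0 → Prop
  | one (n : ℕ+) : IsMono (term n) (N.one n)
  | gen (T : Per) (hT : T.k = 2) : IsMono T (m T hT)
  | circ {F T S : Per} (φ : Elem F T S) (h : (0 : ℤ) + 0 = 0) {x : N.obj S 0} {y : N.obj F 0} :
      IsMono S x → IsMono F y → IsMono T (N.circ φ h x y)

/-- A circle product contracts at least two points, so it cannot live over an object with only one;
units are the only monomials there. -/
theorem IsMono.eq_one {n : ℕ+} {x : N.obj (term n) 0} (hx : IsMono N m (term n) x) :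
    x = N.one n := by
  -- The object is replaced by a variable with an equation, so that case analysis on the indexed
  -- predicate is possible.
  have key : ∀ X x, IsMono N m X x → ∀ h : X = term n, h ▸ x = N.one n := by
    intro X x hx
    cases hx with
    | one n' =>
      intro h
      obtain rfl : n' = n := congrArg Per.n h
      rfl
    | gen _ hT =>
      intro h
      subst h
      cases hT
    | circ φ =>
      intro h
      subst h
      have := φ.k_eq
      have := φ.two_le
      have := one_le_k
      have h1 : (term n).k = 1 := rfl
      have := φ.idx.2
      omega
  exact key _ x hx rfl

theorem IsMono.circ_term {F T : Per} {n : ℕ+} (φ : Elem F T (term n)) (h : (0 : ℤ) + 0 = 0)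
    {x : N.obj (term n) 0} {y : N.obj F 0} (hx : IsMono N m (term n) x) :
    HEq (N.circ φ h x y) y := by
  obtain rfl := φ.eq_of_term
  rw [hx.eq_one, N.one_circ]

theorem IsMono.eq_gen {T : Per} (hT : T.k = 2) {x : N.obj T 0} (hx : IsMono N m T x) :
    x = m T hT := by
  induction hx with
  | one n => cases hT
  | gen T hT => rfl
  | @circ F T S φ h x y hx hy ihx ihy =>
    have h1 := φ.k_eq
    have h2 := φ.two_le
    have h3 := φ.idx.2
    obtain ⟨n, rfl⟩ := exists_eq_term (T := S) (by omega)
    obtain rfl := φ.eq_of_term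
    rw [eq_of_heq (hx.circ_term φ h), ihy hT]

/-- Some generator can always be peeled off as the first contraction. A composite along a map onto
one point reduces to its inner factor. Otherwise either the inner factor is a generator, or it has
such a decomposition itself, and the axiom for nested fibers moves its innermost generator to the
outside. -/
theorem IsMono.decompose {T : Per} {x : N.obj T 0} (hx : IsMono N m T x) (hT : 3 ≤ T.k) :
    ∃ (F S : Per) (φ : Elem F T S) (hF : F.k = 2) (y : N.obj S 0), IsMono N m S y ∧
      x = N.circ φ (zero_add 0) y (m F hF) := by
  induction hx with
  | one n => exact absurd hT (by change ¬ 3 ≤ 1; omega)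
  | gen T hT' => omega
  | @circ F T S φ h x y hx hy ihx ihy =>
    have h1 := φ.k_eq
    have h2 := φ.two_le
    have h3 := φ.idx.2
    by_cases hS : S.k = 1
    · obtain ⟨n, rfl⟩ := exists_eq_term hS
      obtain rfl := φ.eq_of_term
      rw [eq_of_heq (hx.circ_term φ h)]
      exact ihy hT
    · by_cases hF : F.k = 2
      · exact ⟨F, S, φ, hF, x, hx, by rw [hy.eq_gen hF]⟩
      -- The inner factor is `z ∘_χ m F'`; the contraction `χ` of the fiber extends to all of `T`.
      · obtain ⟨F', G, χ, hF', z, hz, rfl⟩ := ihy (by omega)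
        have h4 := χ.k_eq
        obtain ⟨S', φ', ψ, -, hψ⟩ := φ.exists_joint χ (by omega)
        exact ⟨F', S', φ', hF', N.circ ψ (zero_add 0) x z, .circ _ _ hx hz,
          N.joint φ' ψ φ χ hψ _ _ _ _ _ _ _⟩

theorem exists_isMono (T : Per) : ∃ x, IsMono N m T x := by
  induction hn : T.k using Nat.strong_induction_on generalizing T with
  | _ n ih =>
    have h1 := T.one_le_k
    by_cases hT : T.k = 1
    · obtain ⟨n, rfl⟩ := exists_eq_term hT
      exact ⟨_, .one n⟩
    · obtain ⟨F, S, φ, -, hF⟩ := T.exists_elem (i := 0) le_rfl (by omega)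
      have h2 := φ.k_eq
      obtain ⟨x, hx⟩ := ih S.k (by omega) S rfl
      exact ⟨_, .circ φ (zero_add 0) hx (.gen F hF)⟩

/-- Diamond argument, by induction on the number of points in the target. Two monomials are compared
through the generators peeled off first. Whenever these differ, both contractions extend to a common
further target `P`; by induction the remaining factors may be rewritten through any chosen monomial
over `P`. -/
theorem IsMono.unique (hm : QuadRel N 0 m) {T : Per} {x y : N.obj T 0} (hx : IsMono N m T x)
    (hy : IsMono N m T y) : x = y := by
  induction hn : T.k using Nat.strong_induction_on generalizing T with
  | _ n ih =>
    have h1 := T.one_le_k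
    by_cases hT : T.k = 1
    · obtain ⟨n, rfl⟩ := exists_eq_term hT
      rw [hx.eq_one, hy.eq_one]
    by_cases hT : T.k = 2
    · rw [hx.eq_gen hT, hy.eq_gen hT]
    obtain ⟨F, S, φ, hF, x', hx', e⟩ := hx.decompose (by omega)
    obtain ⟨F', S', φ', hF', y', hy', e'⟩ := hy.decompose (by omega)
    rw [e, e']
    clear e e' hx hy x y
    rename' x' => x, hx' => hx, y' => y, hy' => hy
    wlog h : φ.idx.val ≤ φ'.idx.val generalizing F S φ F' S' φ' x y
    · exact (this F' S' φ' hF' y hy F S φ hF x hx (by omega)).symm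
    have k1 := φ.k_eq
    have k2 := φ'.k_eq
    rcases lt_trichotomy φ'.idx.val (φ.idx.val + 1) with h' | h' | h'
    · obtain ⟨rfl, rfl, e⟩ := φ.unique φ' (by omega) (by omega)
      obtain rfl := eq_of_heq e
      rw [ih S.k (by omega) hx hy rfl]
    -- The intervals share one point: both composites factor through the contraction of their
    -- three-point union, where they differ by one application of the relation.
    · obtain ⟨H, P, G, G', ξ, χ, χ', ψ, ψ', hG, hG', hχ, hχ', hψ, hψ'⟩ :=
        φ.exists_overlap φ' hF hF' h'
      obtain ⟨z, hz⟩ := exists_isMono (N := N) (m := m) P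
      rw [ih S.k (by omega) hx (.circ ψ (zero_add 0) hz (.gen G hG)) rfl,
        ih S'.k (by omega) hy (.circ ψ' (zero_add 0) hz (.gen G' hG')) rfl,
        ← N.joint φ ψ ξ χ hψ (zero_add 0) (zero_add 0),
        ← N.joint φ' ψ' ξ χ' hψ' (zero_add 0) (zero_add 0),
        hm χ χ' hF hG hF' hG' hχ hχ', sgn_zero, one_smul]
    -- The intervals are disjoint; in degree `0` the axiom for disjoint fibers carries no sign.
    · obtain ⟨P, ψ', ψ, e1, e2, e3⟩ := φ'.exists_disjoint φ (by omega)
      obtain ⟨z, hz⟩ := exists_isMono (N := N) (m := m) P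
      rw [ih S.k (by omega) hx (.circ ψ (zero_add 0) hz (.gen F' hF')) rfl,
        ih S'.k (by omega) hy (.circ ψ' (zero_add 0) hz (.gen F hF)) rfl,
        N.disjoint φ' ψ' φ ψ e1 e2 e3 (zero_add 0) (zero_add 0) (zero_add 0) (zero_add 0),
        mul_zero, sgn_zero, one_smul]

end Mono

/-! ### Operads free on binary generators; the terminal operad -/

/-- An operad is free on elements of degree `ε` indexed by the surjections onto two-element sets,
subject to the quadratic relation. -/
structure IsFreeOn (M : MarklOperad k) (ε : ℤ) (m₀ : ∀ T : Per, T.k = 2 → M.obj T ε) : Prop where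
  rel : QuadRel M ε m₀
  exists_hom : ∀ (N : MarklOperad k) (m : ∀ T : Per, T.k = 2 → N.obj T ε), QuadRel N ε m →
    ∃ f : M ⟶ N, ∀ T hT, f.app T ε (m₀ T hT) = m T hT
  hom_ext : ∀ {N : MarklOperad k} (f g : M ⟶ N),
    (∀ T hT, f.app T ε (m₀ T hT) = g.app T ε (m₀ T hT)) → f = g

theorem QuadRel.map {M N : MarklOperad k} {ε : ℤ} {m : ∀ T : Per, T.k = 2 → M.obj T ε}
    (hm : QuadRel M ε m) (f : M ⟶ N) : QuadRel N ε fun T hT => f.app T ε (m T hT) := by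
  intro F F' X S S' φ φ' hF hS hF' hS' h0 h1 d h
  rw [← f.map_circ, ← f.map_circ, hm φ φ' hF hS hF' hS' h0 h1, map_smul]

section Terminal

variable (k) in
/-- The unit of the ground field as an element of the terminal operad. -/
def termOne (T : Per) : (terminalOperad k).obj T 0 :=
  (⟨1, fun h => absurd rfl h⟩ : groundField k 0)

theorem termOne_circ {F T S : Per} (φ : Elem F T S) (h : (0 : ℤ) + 0 = 0) :
    (terminalOperad k).circ φ h (termOne k S) (termOne k F) = termOne k T :=
  Subtype.ext (one_mul 1)

theorem eq_smul_termOne {T : Per} (x : (terminalOperad k).obj T 0) :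
    ∃ c : k, x = c • termOne k T :=
  ⟨Subtype.val (p := fun c => c ∈ groundField k 0) x, Subtype.ext (mul_one _).symm⟩

theorem terminal_eq_zero {T : Per} {d : ℤ} (hd : d ≠ 0) (x : (terminalOperad k).obj T d) :
    x = 0 :=
  Subtype.ext (Subtype.prop (p := fun c => c ∈ groundField k d) x hd)

theorem quadRel_termOne : QuadRel (terminalOperad k) 0 fun T _ => termOne k T := by
  intro F F' X S S' φ φ' hF hS hF' hS' h0 h1 d h
  obtain rfl : d = 0 := by omega
  rw [termOne_circ, termOne_circ, sgn_zero, one_smul]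

open Classical in
/-- The morphism from the terminal operad with prescribed values on the units of the ground
field. -/
noncomputable def terminalLift {N : MarklOperad k} (u : ∀ T : Per, N.obj T 0)
    (h1 : ∀ n, u (term n) = N.one n)
    (h2 : ∀ {F T S : Per} (φ : Elem F T S) (h : (0 : ℤ) + 0 = 0),
      N.circ φ h (u S) (u F) = u T) : terminalOperad k ⟶ N :=
  MarklOperad.Hom.mk
    (fun X d => if h : d = 0 then
        h ▸ (LinearMap.toSpanSingleton k (N.obj X 0) (u X)) ∘ₗ (groundField k 0).subtype
      else 0)
    (fun {F T S} φ {i j d} h x y => by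
      by_cases hi : i = 0
      · by_cases hj : j = 0
        · subst hi hj
          obtain rfl : d = 0 := by omega
          obtain ⟨c, rfl⟩ := eq_smul_termOne x
          obtain ⟨c', rfl⟩ := eq_smul_termOne y
          have e : ∀ X, LinearMap.toSpanSingleton k (N.obj X 0) (u X)
              (Subtype.val (p := fun c => c ∈ groundField k 0) (termOne k X)) = u X :=
            fun X => one_smul _ _
          simp only [map_smul, LinearMap.smul_apply, termOne_circ]
          congr 2
          simp only [dif_pos]
          exact (e T).trans ((h2 φ h).symm.trans (by
            congr 1
            · exact congrArg _ (e S).symm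
            · exact (e F).symm))
        · rw [terminal_eq_zero hj y]
          simp
      · rw [terminal_eq_zero hi x]
        simp)
    (fun n => by
      simp only [dif_pos]
      exact (one_smul k (u (term n))).trans (h1 n))

theorem terminalLift_one {N : MarklOperad k} (u : ∀ T : Per, N.obj T 0)
    (h1 : ∀ n, u (term n) = N.one n)
    (h2 : ∀ {F T S : Per} (φ : Elem F T S) (h : (0 : ℤ) + 0 = 0),
      N.circ φ h (u S) (u F) = u T) (T : Per) :
    (terminalLift u h1 h2).app T 0 (termOne k T) = u T := by
  simp only [terminalLift, dif_pos]
  exact one_smul k (u T)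

/-- In the terminal operad the unit over `T` is the composite of units along any elementary
morphism, so repeated contraction of the first two points writes its image as a monomial in the
images over two points. -/
theorem isMono_termOne {N : MarklOperad k} (f : terminalOperad k ⟶ N) (T : Per) :
    IsMono N (fun T _ => f.app T 0 (termOne k T)) T (f.app T 0 (termOne k T)) := by
  induction hn : T.k using Nat.strong_induction_on generalizing T with
  | _ n ih =>
    have h1 := T.one_le_k
    by_cases hT : T.k = 1
    · obtain ⟨n, rfl⟩ := exists_eq_term hT
      have : f.app (term n) 0 (termOne k (term n)) = N.one n := f.map_one n
      rw [this]
      exact .one n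
    · obtain ⟨F, S, φ, -, hF⟩ := T.exists_elem (i := 0) le_rfl (by omega)
      have h2 := φ.k_eq
      rw [← termOne_circ φ (zero_add 0), f.map_circ]
      exact .circ φ _ (ih S.k (by omega) S rfl) (.gen F hF)

/-- Over each `T` the operad `N` has exactly one monomial in the given elements. Uniqueness makes
these monomials compatible with circle products, so they define the morphism, and every morphism
with the prescribed values must take them. -/
theorem isFreeOn_terminal : IsFreeOn (terminalOperad k) 0 fun T _ => termOne k T where
  rel := quadRel_termOne
  exists_hom N m hm := by
    choose u hu using fun T => exists_isMono (N := N) (m := m) T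
    refine ⟨terminalLift u (fun n => (hu _).eq_one)
      (fun φ h => (IsMono.circ φ h (hu _) (hu _)).unique hm (hu _)), fun T hT => ?_⟩
    rw [terminalLift_one]
    exact (hu T).eq_gen hT
  hom_ext {N} f g h := by
    apply MarklOperad.Hom.ext
    funext T d
    apply LinearMap.ext
    intro x
    by_cases hd : d = 0
    · subst hd
      obtain ⟨c, rfl⟩ := eq_smul_termOne x
      rw [map_smul, map_smul]
      congr 1
      have hf := isMono_termOne f T
      -- Both morphisms have the same generating values, so their values are monomials in the same
      -- elements.
      have e : (fun (T : Per) (_ : T.k = 2) => f.app T 0 (termOne k T)) =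
          fun (T : Per) (_ : T.k = 2) => g.app T 0 (termOne k T) := by
        funext T hT
        exact h T hT
      rw [e] at hf
      exact hf.unique (quadRel_termOne.map g) (isMono_termOne g T)
    · rw [terminal_eq_zero hd x, map_zero, map_zero]

end Terminal

end PerOperads

/-! ### Binary quadratic data with one generator in each two-point piece -/

namespace PerOperads

open Per

universe u

variable {k : Type u} [Field k]

/-- A basis of a collection which is one-dimensional and of degree `ε` on the surjections onto
two-element sets, and zero elsewhere. -/
structure BinaryBasis (E : Per → GrVect k) (ε : ℤ) where
  e : ∀ T : Per, T.k = 2 → E T ε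
  coord : ∀ T : Per, T.k = 2 → (E T ε →ₗ[k] k)
  coord_e : ∀ T hT, coord T hT (e T hT) = 1
  eq_smul : ∀ T hT (x : E T ε), x = coord T hT x • e T hT
  eq_zero : ∀ (T : Per) (d : ℤ) (x : E T d), ¬ (T.k = 2 ∧ d = ε) → x = 0

/-- The tower given by an elementary morphism, both of whose terms have degree `ε`. -/
def Tower₂.mk' {F X S : Per} (φ : Elem F X S) (hS : S.k = 2) {ε d : ℤ} (h : ε + ε = d) :
    Tower₂ X d :=
  ⟨F, S, φ, by rw [Per.grade, hS], ε, ε, h⟩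

namespace BinaryBasis

variable {E : Per → GrVect k} {ε : ℤ} (B : BinaryBasis E ε)

open Classical in
/-- The map of collections with prescribed values on the basis. -/
noncomputable def extend {N : MarklOperad k} (m : ∀ T : Per, T.k = 2 → N.obj T ε) (X : Per)
    (d : ℤ) : E X d →ₗ[k] N.obj X d :=
  if h : X.k = 2 ∧ d = ε then
    h.2 ▸ (LinearMap.toSpanSingleton k (N.obj X ε) (m X h.1)) ∘ₗ B.coord X h.1
  else 0

theorem extend_e {N : MarklOperad k} (m : ∀ T : Per, T.k = 2 → N.obj T ε) (T : Per)
    (hT : T.k = 2) : B.extend m T ε (B.e T hT) = m T hT := by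
  simp only [extend, hT, and_self, dif_pos]
  rw [LinearMap.comp_apply, B.coord_e, LinearMap.toSpanSingleton_apply, one_smul]

open Classical in
/-- The basis of the quadratic expressions. -/
noncomputable def quad {F X S : Per} (φ : Elem F X S) (hF : F.k = 2) (hS : S.k = 2) {d : ℤ}
    (h : ε + ε = d) : FreeQuad E X d :=
  DirectSum.lof k (Tower₂ X d) (fun t => TensorProduct k (E t.F t.i) (E t.S t.j))
    (Tower₂.mk' φ hS h) (B.e F hF ⊗ₜ B.e S hS)

theorem quadEval_quad {N : MarklOperad k} (g : ∀ X d, E X d →ₗ[k] N.obj X d) {F X S : Per}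
    (φ : Elem F X S) (hF : F.k = 2) (hS : S.k = 2) {d : ℤ} (h : ε + ε = d) :
    quadEval g X d (B.quad φ hF hS h) =
      sgn k (ε * ε) • N.circ φ h (g S ε (B.e S hS)) (g F ε (B.e F hF)) :=
  quadEval_of g _ _ _

/-- If `F` and `S` both have two target points then `X` has three, and the contracted interval
starts at `0` or at `1`. As an elementary morphism is determined by its interval, at most two
one-dimensional summands survive. -/
theorem quad_span {X : Per} {d : ℤ} (θ : FreeQuad E X d) :
    (∀ {F F' S S' : Per} (φ : Elem F X S) (φ' : Elem F' X S') (hF : F.k = 2) (hS : S.k = 2)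
      (hF' : F'.k = 2) (hS' : S'.k = 2), φ.idx.val = 0 → φ'.idx.val = 1 → ∀ (h : ε + ε = d),
      ∃ a b : k, θ = a • B.quad φ hF hS h + b • B.quad φ' hF' hS' h) ∧
    (¬ (X.k = 3 ∧ ε + ε = d) → θ = 0) := by
  classical
  induction θ using DirectSum.induction_on with
  | zero => exact ⟨fun _ _ _ _ _ _ _ _ _ => ⟨0, 0, by simp⟩, fun _ => rfl⟩
  | add x y hx hy =>
    refine ⟨fun φ φ' hF hS hF' hS' h0 h1 h => ?_, fun h => ?_⟩
    · obtain ⟨a, b, e⟩ := hx.1 φ φ' hF hS hF' hS' h0 h1 h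
      obtain ⟨a', b', e'⟩ := hy.1 φ φ' hF hS hF' hS' h0 h1 h
      exact ⟨a + a', b + b', by rw [e, e', add_smul, add_smul]; abel⟩
    · rw [hx.2 h, hy.2 h, add_zero]
  | of t x =>
    change (∀ {F F' S S' : Per} (φ : Elem F X S) (φ' : Elem F' X S') (hF : F.k = 2)
      (hS : S.k = 2) (hF' : F'.k = 2) (hS' : S'.k = 2), φ.idx.val = 0 → φ'.idx.val = 1 →
      ∀ (h : ε + ε = d), ∃ a b : k, DirectSum.lof k (Tower₂ X d)
        (fun t => TensorProduct k (E t.F t.i) (E t.S t.j)) t x = _) ∧ (_ → DirectSum.lof k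
        (Tower₂ X d) (fun t => TensorProduct k (E t.F t.i) (E t.S t.j)) t x = 0)
    induction x using TensorProduct.induction_on with
    | zero =>
      rw [map_zero]
      exact ⟨fun _ _ _ _ _ _ _ _ _ => ⟨0, 0, by simp⟩, fun _ => rfl⟩
    | add x y hx hy =>
      rw [map_add]
      refine ⟨fun φ φ' hF hS hF' hS' h0 h1 h => ?_, fun h => ?_⟩
      · obtain ⟨a, b, e⟩ := hx.1 φ φ' hF hS hF' hS' h0 h1 h
        obtain ⟨a', b', e'⟩ := hy.1 φ φ' hF hS hF' hS' h0 h1 h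
        exact ⟨a + a', b + b', by rw [e, e', add_smul, add_smul]; abel⟩
      · rw [hx.2 h, hy.2 h, add_zero]
    | tmul x y =>
      by_cases hx : t.F.k = 2 ∧ t.i = ε
      · by_cases hy : t.S.k = 2 ∧ t.j = ε
        · obtain ⟨F, S, φ, hg, i, j, deg⟩ := t
          obtain ⟨hF, rfl⟩ := hx
          obtain ⟨hS, hj⟩ := hy
          simp only at hj hF hS
          subst hj
          have hk := φ.k_eq
          have hi := φ.idx.2
          have e : DirectSum.lof k (Tower₂ X d)
              (fun t => TensorProduct k (E t.F t.i) (E t.S t.j)) ⟨F, S, φ, hg, _, _, deg⟩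
              (x ⊗ₜ y) = (B.coord F hF x * B.coord S hS y) • B.quad φ hF hS deg := by
            conv_lhs => rw [B.eq_smul F hF x, B.eq_smul S hS y]
            rw [TensorProduct.smul_tmul_smul, map_smul]
            rfl
          rw [e]
          clear e
          generalize B.coord F hF x * B.coord S hS y = c
          refine ⟨fun {F₀ F₁ S₀ S₁} φ₀ φ₁ hF₀ hS₀ hF₁ hS₁ h0 h1 _ => ?_, fun h => ?_⟩
          · rcases (by omega : φ.idx.val = 0 ∨ φ.idx.val = 1) with h' | h'
            · obtain ⟨rfl, rfl, e⟩ := φ.unique φ₀ (by omega) (by omega)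
              obtain rfl := eq_of_heq e
              exact ⟨c, 0, by rw [zero_smul, add_zero]⟩
            · obtain ⟨rfl, rfl, e⟩ := φ.unique φ₁ (by omega) (by omega)
              obtain rfl := eq_of_heq e
              exact ⟨0, c, by rw [zero_smul, zero_add]⟩
          · exact absurd ⟨by omega, deg⟩ h
        · rw [B.eq_zero _ _ y hy, TensorProduct.tmul_zero, map_zero]
          exact ⟨fun _ _ _ _ _ _ _ _ _ => ⟨0, 0, by simp⟩, fun _ => rfl⟩
      · rw [B.eq_zero _ _ x hx, TensorProduct.zero_tmul, map_zero]
        exact ⟨fun _ _ _ _ _ _ _ _ _ => ⟨0, 0, by simp⟩, fun _ => rfl⟩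

end BinaryBasis

theorem Per.exists_elem_pair {X : Per} (hX : X.k = 3) :
    ∃ (F F' S S' : Per) (φ : Elem F X S) (φ' : Elem F' X S'), F.k = 2 ∧ S.k = 2 ∧ F'.k = 2 ∧
      S'.k = 2 ∧ φ.idx.val = 0 ∧ φ'.idx.val = 1 := by
  obtain ⟨F, S, φ, h0, hF⟩ := X.exists_elem (i := 0) (m := 2) le_rfl (by omega)
  obtain ⟨F', S', φ', h1, hF'⟩ := X.exists_elem (i := 1) (m := 2) le_rfl (by omega)
  have := φ.k_eq
  have := φ'.k_eq
  exact ⟨F, F', S, S', φ, φ', hF, by omega, hF', by omega, h0, h1⟩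

namespace QuadraticData

/-- The relations of `D` are generated by the relation `(a b) c = s a (b c)` between the elements
of the given basis. -/
structure RelSpec (D : QuadraticData k) {ε : ℤ} (B : BinaryBasis D.E ε) (s : k) : Prop where
  mem : ∀ {F F' X S S' : Per} (φ : Elem F X S) (φ' : Elem F' X S') (hF : F.k = 2) (hS : S.k = 2)
    (hF' : F'.k = 2) (hS' : S'.k = 2), φ.idx.val = 0 → φ'.idx.val = 1 → ∀ {d : ℤ}
    (h : ε + ε = d), B.quad φ hF hS h + (-s) • B.quad φ' hF' hS' h ∈ D.R X d
  coeff : ∀ {F F' X S S' : Per} (φ : Elem F X S) (φ' : Elem F' X S') (hF : F.k = 2) (hS : S.k = 2)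
    (hF' : F'.k = 2) (hS' : S'.k = 2), φ.idx.val = 0 → φ'.idx.val = 1 → ∀ {d : ℤ}
    (h : ε + ε = d) (a b : k), a • B.quad φ hF hS h + b • B.quad φ' hF' hS' h ∈ D.R X d →
      b = -(s * a)

variable {D : QuadraticData k} {ε : ℤ} {B : BinaryBasis D.E ε}

/-- Away from three target points and degree `ε + ε` there are no quadratic expressions at all;
there, `coeff` confines `R` to a line. -/
theorem RelSpec.eq_smul {s : k} (h : D.RelSpec B s) {X : Per} {d : ℤ} {x : FreeQuad D.E X d}
    (hx : x ∈ D.R X d) : x = 0 ∨ ∃ (F F' S S' : Per) (φ : Elem F X S) (φ' : Elem F' X S')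
      (hF : F.k = 2) (hS : S.k = 2) (hF' : F'.k = 2) (hS' : S'.k = 2) (hd : ε + ε = d) (a : k),
      φ.idx.val = 0 ∧ φ'.idx.val = 1 ∧
      x = a • (B.quad φ hF hS hd + (-s) • B.quad φ' hF' hS' hd) := by
  by_cases hX : X.k = 3 ∧ ε + ε = d
  · obtain ⟨F, F', S, S', φ, φ', hF, hS, hF', hS', h0, h1⟩ := exists_elem_pair hX.1
    obtain ⟨a, b, rfl⟩ := (B.quad_span x).1 φ φ' hF hS hF' hS' h0 h1 hX.2
    refine Or.inr ⟨F, F', S, S', φ, φ', hF, hS, hF', hS', hX.2, a, h0, h1, ?_⟩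
    rw [h.coeff φ φ' hF hS hF' hS' h0 h1 hX.2 a b hx, smul_add, smul_smul, mul_neg,
      mul_comm a s]
  · exact Or.inl ((B.quad_span x).2 hX)

/-- Both monomials are evaluated with the same sign `sgn k (ε * ε)`, which factors out and leaves
the quadratic relation in `N`. -/
theorem RelSpec.quadEval_eq_zero (h : D.RelSpec B (sgn k ε)) {N : MarklOperad k}
    (g : ∀ X d, D.E X d →ₗ[k] N.obj X d) (hm : QuadRel N ε fun T hT => g T ε (B.e T hT))
    (X : Per) (d : ℤ) (x : FreeQuad D.E X d) (hx : x ∈ D.R X d) : quadEval g X d x = 0 := by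
  obtain rfl | ⟨F, F', S, S', φ, φ', hF, hS, hF', hS', hd, a, h0, h1, rfl⟩ := h.eq_smul hx
  · exact map_zero _
  · rw [map_smul, map_add, map_smul, B.quadEval_quad, B.quadEval_quad,
      hm φ φ' hF hS hF' hS' h0 h1 hd, smul_comm, neg_smul, add_neg_cancel, smul_zero]

/-- A map out of `E` amounts to its values on the basis, and it annihilates `R` when these satisfy
the quadratic relation; the universal property of the presentation does the rest. -/
theorem RelSpec.isFreeOn (h : D.RelSpec B (sgn k ε)) :
    IsFreeOn D.operad ε fun T hT => D.gen T ε (B.e T hT) where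
  rel := by
    intro F F' X S S' φ φ' hF hS hF' hS' h0 h1 d hd
    have := gen_rel X d (h.mem φ φ' hF hS hF' hS' h0 h1 hd)
    rw [map_add, map_smul, B.quadEval_quad, B.quadEval_quad, smul_comm, ← smul_add, neg_smul,
      ← sub_eq_add_neg] at this
    have h2 := congrArg (fun v => sgn k (ε * ε) • v) this
    simp only [sgn_smul_sgn_smul, smul_zero] at h2
    exact sub_eq_zero.1 h2
  exists_hom N m hm := by
    refine ⟨lift (B.extend m) (h.quadEval_eq_zero _ ?_), fun T hT => ?_⟩
    · simp only [B.extend_e]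
      exact hm
    · rw [lift_gen, B.extend_e]
  hom_ext f g hfg := by
    apply QuadraticData.hom_ext
    intro X d x
    by_cases hX : X.k = 2 ∧ d = ε
    · obtain ⟨hX, rfl⟩ := hX
      rw [B.eq_smul X hX x, map_smul, map_smul, map_smul, hfg]
    · rw [B.eq_zero X d x hX, map_zero, map_zero, map_zero]

end QuadraticData

theorem BinaryBasis.dual_eq_smul {E : Per → GrVect k} {ε : ℤ} (B : BinaryBasis E ε) (T : Per)
    (hT : T.k = 2) (x : Module.Dual k (E T ε)) : x = x (B.e T hT) • B.coord T hT := by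
  apply LinearMap.ext
  intro y
  conv_lhs => rw [B.eq_smul T hT y]
  rw [map_smul, LinearMap.smul_apply, smul_eq_mul, smul_eq_mul, mul_comm]

theorem BinaryBasis.dual_eq_zero {E : Per → GrVect k} {ε : ℤ} (B : BinaryBasis E ε) (T : Per)
    (d : ℤ) (x : Module.Dual k (E T d)) (h : ¬ (T.k = 2 ∧ d = ε)) : x = 0 := by
  apply LinearMap.ext
  intro y
  rw [B.eq_zero T d y h, map_zero, map_zero]

/-- The dual basis of the suspended dual. -/
def BinaryBasis.susp {E : Per → GrVect k} {ε : ℤ} (B : BinaryBasis E (1 - ε)) :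
    BinaryBasis (suspDual E) ε where
  e T hT := B.coord T hT
  coord T hT := LinearMap.applyₗ (B.e T hT)
  coord_e T hT := B.coord_e T hT
  eq_smul T hT x := B.dual_eq_smul T hT x
  eq_zero T d x h := B.dual_eq_zero T (1 - d) x fun h' => h ⟨h'.1, by omega⟩

open Classical in
theorem quadPairing_lof {E : Per → GrVect k} {X : Per} {d : ℤ} (t : Tower₂ X d)
    (f : Module.Dual k (E t.F (1 - t.i))) (g : Module.Dual k (E t.S (1 - t.j)))
    (t' : Tower₂ X (2 - d))
    (a : E t'.F t'.i) (b : E t'.S t'.j) (ht : t.φ.idx.val ≠ t'.φ.idx.val) :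
    quadPairing E X d (DirectSum.lof k (Tower₂ X d)
      (fun t => TensorProduct k (suspDual E t.F t.i) (suspDual E t.S t.j)) t (f ⊗ₜ g))
      (DirectSum.lof k (Tower₂ X (2 - d))
        (fun t => TensorProduct k (E t.F t.i) (E t.S t.j)) t' (a ⊗ₜ b)) = 0 := by
  refine (congrArg (fun F : Module.Dual k (FreeQuad E X (2 - d)) => F (DirectSum.lof k _ _ _ _))
    (DirectSum.toModule_lof k _ _)).trans ?_
  change sgn k _ • TensorProduct.dualDistrib k _ _ (f ⊗ₜ g) (DirectSum.component k
    (Tower₂ X (2 - d)) (fun s => TensorProduct k (E s.F s.i) (E s.S s.j)) ⟨t.F, t.S, t.φ,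
      t.grade_pos, 1 - t.i, 1 - t.j, by have := t.deg; omega⟩ (DirectSum.lof k _ _ _ _)) = _
  rw [DirectSum.component.of, dif_neg, map_zero, smul_zero]
  rintro rfl
  exact ht rfl

open Classical in
theorem quadPairing_lof_self {E : Per → GrVect k} {X : Per} {d : ℤ} (t : Tower₂ X d)
    (f : Module.Dual k (E t.F (1 - t.i))) (g : Module.Dual k (E t.S (1 - t.j)))
    (a : E t.F (1 - t.i)) (b : E t.S (1 - t.j)) (h : 1 - t.i + (1 - t.j) = 2 - d) :
    quadPairing E X d (DirectSum.lof k (Tower₂ X d)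
      (fun t => TensorProduct k (suspDual E t.F t.i) (suspDual E t.S t.j)) t (f ⊗ₜ g))
      (DirectSum.lof k (Tower₂ X (2 - d))
        (fun t => TensorProduct k (E t.F t.i) (E t.S t.j))
        ⟨t.F, t.S, t.φ, t.grade_pos, 1 - t.i, 1 - t.j, h⟩ (a ⊗ₜ b)) =
      sgn k (t.j * (1 - t.i)) * (f a * g b) := by
  refine (congrArg (fun F : Module.Dual k (FreeQuad E X (2 - d)) => F (DirectSum.lof k _ _ _ _))
    (DirectSum.toModule_lof k _ _)).trans ?_
  change sgn k _ • TensorProduct.dualDistrib k _ _ (f ⊗ₜ g) (DirectSum.component k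
    (Tower₂ X (2 - d)) (fun s => TensorProduct k (E s.F s.i) (E s.S s.j)) ⟨t.F, t.S, t.φ,
      t.grade_pos, 1 - t.i, 1 - t.j, by have := t.deg; omega⟩ (DirectSum.lof k _ _ _ _)) = _
  rw [DirectSum.component.lof_self, TensorProduct.dualDistrib_apply]
  rfl

/-- In the dual bases the pairing of the two planes is the standard form up to the common sign `sgn
k (ε * (1 - ε))`. The annihilator of the line through `(1, -s)` is the line through `(1, s)`,
because `s * s = 1`. -/
theorem QuadraticData.RelSpec.dual {D : QuadraticData k} {ε : ℤ} {B : BinaryBasis D.E (1 - ε)}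
    {s : k} (hs : s * s = 1) (h : D.RelSpec B s) :
    D.dual.RelSpec (B := B.susp) (-s) := by
  have self : ∀ {F X S : Per} (φ : Elem F X S) (hF : F.k = 2) (hS : S.k = 2) {d : ℤ}
      (hd : ε + ε = d) (hd' : 1 - ε + (1 - ε) = 2 - d),
      quadPairing D.E X d (B.susp.quad φ hF hS hd) (B.quad φ hF hS hd') =
        sgn k (ε * (1 - ε)) := by
    intro F X S φ hF hS d hd hd'
    refine (quadPairing_lof_self (Tower₂.mk' φ hS hd) _ _ _ _ hd').trans ?_
    change sgn k (ε * (1 - ε)) * (B.coord F hF (B.e F hF) * B.coord S hS (B.e S hS)) = _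
    rw [B.coord_e, B.coord_e, mul_one, mul_one]
  have other : ∀ {F X S F' S' : Per} (φ : Elem F X S) (φ' : Elem F' X S') (hF : F.k = 2)
      (hS : S.k = 2) (hF' : F'.k = 2) (hS' : S'.k = 2) {d : ℤ}
      (hd : ε + ε = d) (hd' : 1 - ε + (1 - ε) = 2 - d), φ.idx.val ≠ φ'.idx.val →
      quadPairing D.E X d (B.susp.quad φ hF hS hd) (B.quad φ' hF' hS' hd') = 0 := by
    intro F X S F' S' φ φ' hF hS hF' hS' d hd hd' hne
    exact quadPairing_lof (Tower₂.mk' φ hS hd) _ _ (Tower₂.mk' φ' hS' hd') _ _ hne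
  have pair : ∀ {F X S F' S' : Per} (φ : Elem F X S) (φ' : Elem F' X S') (hF : F.k = 2)
      (hS : S.k = 2) (hF' : F'.k = 2) (hS' : S'.k = 2) {d : ℤ}
      (hd : ε + ε = d) (hd' : 1 - ε + (1 - ε) = 2 - d), φ.idx.val ≠ φ'.idx.val →
      ∀ a b a' b' : k, quadPairing D.E X d
        (a • B.susp.quad φ hF hS hd + b • B.susp.quad φ' hF' hS' hd)
        (a' • B.quad φ hF hS hd' + b' • B.quad φ' hF' hS' hd') =
        sgn k (ε * (1 - ε)) * (a * a' + b * b') := by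
    intro F X S F' S' φ φ' hF hS hF' hS' d hd hd' hne a b a' b'
    simp only [map_add, map_smul, LinearMap.add_apply, LinearMap.smul_apply]
    rw [self φ hF hS hd hd', self φ' hF' hS' hd hd', other φ φ' hF hS hF' hS' hd hd' hne,
      other φ' φ hF' hS' hF hS hd hd' (Ne.symm hne)]
    simp only [smul_eq_mul]
    ring
  constructor
  · intro F F' X S S' φ φ' hF hS hF' hS' h0 h1 d hd x hx
    obtain rfl | ⟨_, _, _, _, φ₀, φ₁, hF₀, hS₀, hF₁, hS₁, hd', a, h0', h1', rfl⟩ := h.eq_smul hx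
    · exact map_zero _
    · obtain ⟨rfl, rfl, e⟩ := φ.unique φ₀ (by omega) (by omega)
      obtain rfl := eq_of_heq e
      obtain ⟨rfl, rfl, e⟩ := φ'.unique φ₁ (by omega) (by omega)
      obtain rfl := eq_of_heq e
      have := pair φ φ' hF hS hF' hS' hd hd' (by omega) 1 (- -s) a (a * -s)
      rw [one_smul, ← smul_smul, ← smul_add] at this
      refine this.trans ?_
      have : 1 * a + - -s * (a * -s) = a * (1 - s * s) := by ring
      rw [this, hs, sub_self, mul_zero, mul_zero]
  · intro F F' X S S' φ φ' hF hS hF' hS' h0 h1 d hd a b hx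
    have hd' : 1 - ε + (1 - ε) = 2 - d := by omega
    have h2 := hx _ (h.mem φ φ' hF hS hF' hS' h0 h1 hd')
    have := pair φ φ' hF hS hF' hS' hd hd' (by omega) a b 1 (-s)
    rw [one_smul] at this
    have h3 := this.symm.trans h2
    have h4 : sgn k (ε * (1 - ε)) ≠ 0 := fun h0 => by
      have := sgn_mul_self k (ε * (1 - ε))
      rw [h0, zero_mul] at this
      exact zero_ne_one this
    have h5 := (mul_eq_zero.1 h3).resolve_left h4
    -- Orthogonality reads `a = s * b`; multiplication by `s` solves it for `b`.
    have h6 : s * (a * 1 + b * -s) = 0 := by rw [h5, mul_zero]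
    linear_combination -h6 - b * hs

end PerOperads

/-! ### A binary quadratic presentation of the terminal operad -/

namespace PerOperads

open Per

universe u

variable {k : Type u} [Field k]

theorem IsFreeOn.nonempty_iso {M N : MarklOperad k} {ε : ℤ} {m : ∀ T : Per, T.k = 2 → M.obj T ε}
    {n : ∀ T : Per, T.k = 2 → N.obj T ε} (hM : IsFreeOn M ε m) (hN : IsFreeOn N ε n) :
    Nonempty (M ≅ N) := by
  obtain ⟨f, hf⟩ := hM.exists_hom N n hN.rel
  obtain ⟨g, hg⟩ := hN.exists_hom M m hM.rel
  refine ⟨⟨f, g, hM.hom_ext _ _ fun T hT => ?_, hN.hom_ext _ _ fun T hT => ?_⟩⟩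
  · exact (congrArg (g.app T ε) (hf T hT)).trans (hg T hT)
  · exact (congrArg (f.app T ε) (hg T hT)).trans (hf T hT)

/-- Both quadratic monomials evaluate to the unit of the ground field, so the kernel consists of the
combinations whose coefficients sum to zero. -/
theorem QuadraticData.relSpec_of_terminal {D : QuadraticData k} (B : BinaryBasis D.E 0)
    (g : ∀ X d, D.E X d →ₗ[k] (terminalOperad k).obj X d)
    (hg : ∀ T hT, g T 0 (B.e T hT) = termOne k T)
    (hR : ∀ X d (x : FreeQuad D.E X d), x ∈ D.R X d ↔ quadEval g X d x = 0) :
    D.RelSpec B 1 := by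
  have key : ∀ {F X S : Per} (φ : Elem F X S) (hF : F.k = 2) (hS : S.k = 2)
      (h : (0 : ℤ) + 0 = 0), quadEval g X 0 (B.quad φ hF hS h) = termOne k X := by
    intro F X S φ hF hS h
    rw [B.quadEval_quad, hg, hg, termOne_circ, mul_zero, sgn_zero, one_smul]
  constructor
  · intro F F' X S S' φ φ' hF hS hF' hS' h0 h1 d h
    obtain rfl : d = 0 := by omega
    rw [hR, map_add, map_smul, key, key, neg_smul, one_smul, add_neg_cancel]
  · intro F F' X S S' φ φ' hF hS hF' hS' h0 h1 d h a b hx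
    obtain rfl : d = 0 := by omega
    rw [hR, map_add, map_smul, map_smul, key, key, ← add_smul] at hx
    have h2 : (a + b) * 1 = 0 := congrArg Subtype.val hx
    linear_combination h2

section Standard

variable (k) in
/-- The ground field placed in degree `0` on the surjections onto two-element sets. -/
def binaryField (T : Per) (d : ℤ) : Submodule k k where
  carrier := {x | ¬ (T.k = 2 ∧ d = 0) → x = 0}
  zero_mem' _ := rfl
  add_mem' ha hb h := by rw [ha h, hb h, add_zero]
  smul_mem' c x hx h := by rw [hx h, smul_zero]

theorem binaryField_eq_zero {T : Per} {d : ℤ} (h : ¬ (T.k = 2 ∧ d = 0)) (x : binaryField k T d) :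
    x = 0 := Subtype.ext (x.2 h)

variable (k) in
/-- The collection of generators of the terminal operad. -/
def binaryColl (T : Per) : GrVect k := fun d => ModuleCat.of k (binaryField k T d)

variable (k) in
/-- The basis of the collection of generators of the terminal operad. -/
def binaryCollBasis : BinaryBasis (binaryColl k) 0 where
  e T hT := (⟨1, fun h => absurd ⟨hT, rfl⟩ h⟩ : binaryField k T 0)
  coord T _ := (binaryField k T 0).subtype
  coord_e _ _ := rfl
  eq_smul T _ x := Subtype.ext (mul_one (Subtype.val (p := fun c => c ∈ binaryField k T 0) x)).symm
  eq_zero _ _ x h := binaryField_eq_zero h x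

variable (k) in
/-- A binary quadratic presentation of the terminal operad. -/
noncomputable def terminalData : QuadraticData k where
  E := binaryColl k
  oneConnected T d hT := by
    refine ⟨fun a b => ?_⟩
    have h : ¬ (T.k = 2 ∧ d = 0) := fun h => by
      unfold Per.grade at hT
      omega
    exact (binaryField_eq_zero h a).trans (binaryField_eq_zero h b).symm
  R X d := LinearMap.ker (quadEval ((binaryCollBasis k).extend
    (N := terminalOperad k) fun T _ => termOne k T) X d)

theorem terminalData_isBinary : (terminalData k).IsBinary := by
  intro T d h
  by_contra hT
  obtain ⟨a, b, hab⟩ := h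
  have h : ¬ (T.k = 2 ∧ d = 0) := fun h => by
    unfold Per.grade at hT
    omega
  exact hab ((binaryField_eq_zero h a).trans (binaryField_eq_zero h b).symm)

theorem terminalOperad_oneConnected : (terminalOperad k).OneConnected := by
  refine fun n => ⟨⟨fun a b h => ?_, fun x => ?_⟩, fun d hd => ⟨fun a b => ?_⟩⟩
  · have h' : a * 1 = b * 1 := congrArg Subtype.val h
    simpa using h'
  · obtain ⟨c, rfl⟩ := eq_smul_termOne x
    exact ⟨c, rfl⟩
  · rw [terminal_eq_zero hd a, terminal_eq_zero hd b]

/-- With `R` the whole kernel of the evaluation, the presented operad and the terminal operad are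
free on the same generators with the same relation. -/
theorem terminalOperad_isBinaryQuadratic : (terminalOperad k).IsBinaryQuadratic := by
  refine ⟨terminalOperad_oneConnected, terminalData k, terminalData_isBinary, ?_⟩
  have h : (terminalData k).RelSpec (binaryCollBasis k) 1 :=
    QuadraticData.relSpec_of_terminal (D := terminalData k) (binaryCollBasis k)
      ((binaryCollBasis k).extend (N := terminalOperad k) fun T _ => termOne k T)
      (fun T hT => BinaryBasis.extend_e (binaryCollBasis k) (fun T _ => termOne k T) T hT)
      fun _ _ _ => Iff.rfl
  rw [← sgn_zero] at h
  exact h.isFreeOn.nonempty_iso isFreeOn_terminal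

end Standard

/-! ### Truncation to weight two and recovery of the quadratic data -/

namespace QuadraticData

section Truncation

variable (D : QuadraticData k)

/-- The pieces of weight at most two of the operad presented by `D`. -/
abbrev TruncObj (X : Per) (d : ℤ) : Type u := k × D.E X d × (FreeQuad D.E X d ⧸ D.R X d)

/-- Transport along equalities of the indices. -/
def truncCast {F T : Per} {j d : ℤ} (hF : F = T) (hj : j = d) :
    D.TruncObj F j →ₗ[k] D.TruncObj T d := by
  subst hF hj
  exact LinearMap.id

theorem truncCast_rfl {T : Per} {d : ℤ} (y : D.TruncObj T d) :
    D.truncCast (rfl : T = T) (rfl : d = d) y = y := rfl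

theorem _root_.PerOperads.Per.Elem.eq_of_k_eq_one {F T S : Per} (φ : Elem F T S) (hS : S.k = 1) :
    F = T := by
  obtain ⟨n, rfl⟩ := exists_eq_term hS
  exact φ.eq_of_term

open Classical in
/-- The class of the product of two generators. -/
noncomputable def truncMul {F T S : Per} (φ : Elem F T S) {i j d : ℤ} (h : i + j = d)
    (hS : 1 ≤ S.grade) : D.E S i →ₗ[k] D.E F j →ₗ[k] D.TruncObj T d :=
  (TensorProduct.mk k (D.E F j) (D.E S i)).flip.compr₂
    (sgn k (j * i) • LinearMap.inr k _ _ ∘ₗ LinearMap.inr k _ _ ∘ₗ (D.R T d).mkQ ∘ₗ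
      DirectSum.lof k (Tower₂ T d) (fun t => TensorProduct k (D.E t.F t.i) (D.E t.S t.j))
        ⟨F, S, φ, hS, j, i, (add_comm _ _).trans h⟩)

theorem truncMul_fst {F T S : Per} (φ : Elem F T S) {i j d : ℤ} (h : i + j = d)
    (hS : 1 ≤ S.grade) (x : D.E S i) (y : D.E F j) : (D.truncMul φ h hS x y).2.1 = 0 := by
  simp [truncMul]

open Classical in
/-- The circle products of the truncation. -/
noncomputable def truncCirc {F T S : Per} (φ : Elem F T S) {i j d : ℤ} (h : i + j = d) :
    D.TruncObj S i →ₗ[k] D.TruncObj F j →ₗ[k] D.TruncObj T d :=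
  -- The factor `k` is present over every object and in every degree, but acts only over one-point
  -- objects and in degree `0`, by scalars. All other products see weight one only and land in
  -- weight two.
  if hS : S.k = 1 then
    if hi : i = 0 then
      (LinearMap.lsmul k (D.TruncObj T d)).compl₁₂ (LinearMap.fst k _ _)
        (D.truncCast (φ.eq_of_k_eq_one hS) (by omega))
    else 0
  else (D.truncMul φ h (by have := S.one_le_k; unfold Per.grade; omega)).compl₁₂
    (LinearMap.fst k _ _ ∘ₗ LinearMap.snd k _ _) (LinearMap.fst k _ _ ∘ₗ LinearMap.snd k _ _)

theorem truncCirc_unit {F T S : Per} (φ : Elem F T S) {j d : ℤ} (h : 0 + j = d) (hS : S.k = 1)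
    (x : D.TruncObj S 0) (y : D.TruncObj F j) : D.truncCirc φ h x y =
      x.1 • D.truncCast (φ.eq_of_k_eq_one hS) ((zero_add j).symm.trans h) y := by
  rw [truncCirc, dif_pos hS, dif_pos rfl]
  rfl

theorem truncCirc_of_ne {F T S : Per} (φ : Elem F T S) {i j d : ℤ} (h : i + j = d) (hS : S.k = 1)
    (hi : i ≠ 0) (x : D.TruncObj S i) (y : D.TruncObj F j) : D.truncCirc φ h x y = 0 := by
  rw [truncCirc, dif_pos hS, dif_neg hi]
  rfl

theorem truncCirc_mul {F T S : Per} (φ : Elem F T S) {i j d : ℤ} (h : i + j = d)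
    (hS : 1 ≤ S.grade) (x : D.TruncObj S i) (y : D.TruncObj F j) :
    D.truncCirc φ h x y = D.truncMul φ h hS x.2.1 y.2.1 := by
  rw [truncCirc, dif_neg (by unfold Per.grade at hS; omega)]
  rfl

theorem truncCirc_left {F T S : Per} (φ : Elem F T S) {i j d : ℤ} (h : i + j = d)
    (hS : 1 ≤ S.grade) (x : D.TruncObj S i) (y : D.TruncObj F j) (hx : x.2.1 = 0) :
    D.truncCirc φ h x y = 0 := by
  rw [truncCirc_mul D φ h hS, hx, map_zero, LinearMap.zero_apply]

theorem truncCirc_right {F T S : Per} (φ : Elem F T S) {i j d : ℤ} (h : i + j = d)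
    (hS : 1 ≤ S.grade) (x : D.TruncObj S i) (y : D.TruncObj F j) (hy : y.2.1 = 0) :
    D.truncCirc φ h x y = 0 := by
  rw [truncCirc_mul D φ h hS, hy, map_zero]

theorem truncCirc_fst {F T S : Per} (φ : Elem F T S) {i j d : ℤ} (h : i + j = d)
    (hS : 1 ≤ S.grade) (x : D.TruncObj S i) (y : D.TruncObj F j) :
    (D.truncCirc φ h x y).2.1 = 0 := by
  rw [truncCirc_mul D φ h hS, truncMul_fst]

/-- Over a one-point `P` both sides are the action of one scalar. Otherwise the inner products have
no component of weight one while the outer ones see nothing else, so both sides vanish. -/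
theorem truncCirc_joint {F G H T S P : Per} (φ : Elem F T S) (ψ : Elem G S P) (ξ : Elem H T P)
    (χ : Elem F H G) (hi : ψ.hom.base φ.idx = ψ.idx) {p q r pq qr d : ℤ} (h₁ : q + r = qr)
    (h₂ : p + qr = d) (h₃ : p + q = pq) (h₄ : pq + r = d)
    (x : D.TruncObj P p) (y : D.TruncObj G q) (z : D.TruncObj F r) :
    D.truncCirc ξ h₂ x (D.truncCirc χ h₁ y z) = D.truncCirc φ h₄ (D.truncCirc ψ h₃ x y) z := by
  have hk := ψ.k_eq
  have hG := ψ.two_le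
  have hP := P.one_le_k
  by_cases hP1 : P.k = 1
  · by_cases hp : p = 0
    · subst hp
      obtain rfl := ψ.eq_of_k_eq_one hP1
      obtain rfl := ξ.eq_of_k_eq_one hP1
      obtain rfl : q = pq := by omega
      obtain rfl : qr = d := by omega
      have e := φ.joint_idx_val ψ ξ χ hi
      have h0 := ψ.idx.2
      obtain ⟨-, -, e⟩ := φ.unique χ (by omega) rfl
      obtain rfl := eq_of_heq e
      rw [truncCirc_unit D ξ _ hP1, truncCirc_unit D ψ _ hP1, truncCast_rfl, truncCast_rfl,
        map_smul, LinearMap.smul_apply]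
    · rw [truncCirc_of_ne D ξ _ hP1 hp, truncCirc_of_ne D ψ _ hP1 hp, map_zero,
        LinearMap.zero_apply]
  · rw [truncCirc_right D ξ _ (by unfold Per.grade; omega) _ _
        (truncCirc_fst D χ _ ψ.grade_pos _ _),
      truncCirc_left D φ _ (by unfold Per.grade; omega) _ _
        (truncCirc_fst D ψ _ (by unfold Per.grade; omega) _ _)]

/-- The truncation of the operad presented by `D` to weight at most two. -/
noncomputable def truncation : MarklOperad k where
  obj X d := ModuleCat.of k (D.TruncObj X d)
  circ {_ _ _} φ {_ _ _} h := D.truncCirc φ h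
  one n := ((1, 0, 0) : D.TruncObj (term n) 0)
  joint φ ψ ξ χ hi _ _ _ _ _ _ h₁ h₂ h₃ h₄ x y z := D.truncCirc_joint φ ψ ξ χ hi h₁ h₂ h₃ h₄ x y z
  disjoint {F G T P' P'' S} φ' ψ' φ'' ψ'' hi hj hij p q r pq pr d h₁ h₂ h₃ h₄ x g f := by
    have h0 : 2 ≤ S.k := by
      by_contra h
      exact hij (Fin.ext (by have := ψ'.idx.2; have := ψ''.idx.2; omega))
    have h1 := ψ'.k_eq
    have h2 := ψ''.k_eq
    have h3 := ψ'.two_le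
    have h4 := ψ''.two_le
    have e1 := truncCirc_left D φ' h₂ (by unfold Per.grade; omega) (D.truncCirc ψ' h₁ x g) f
      (truncCirc_fst D ψ' h₁ (by unfold Per.grade; omega) x g)
    have e2 := truncCirc_left D φ'' h₄ (by unfold Per.grade; omega) (D.truncCirc ψ'' h₃ x f) g
      (truncCirc_fst D ψ'' h₃ (by unfold Per.grade; omega) x f)
    refine e1.trans ((smul_zero _).symm.trans (congrArg _ e2.symm))
  one_circ {_ _} φ {d} h x := by
    refine (truncCirc_unit D φ h rfl _ x).trans ?_
    rw [truncCast_rfl]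
    exact one_smul k _

/-- The inclusion of the generators into the truncation. -/
noncomputable def truncGen (X : Per) (d : ℤ) : D.E X d →ₗ[k] D.truncation.obj X d :=
  LinearMap.inr k k (D.E X d × (FreeQuad D.E X d ⧸ D.R X d)) ∘ₗ LinearMap.inl k _ _

theorem quadEval_truncGen (X : Per) (d : ℤ) (x : FreeQuad D.E X d) :
    quadEval D.truncGen X d x = ((0, 0, (D.R X d).mkQ x) : D.TruncObj X d) := by
  classical
  have : quadEval D.truncGen X d = (LinearMap.inr k k (D.E X d × (FreeQuad D.E X d ⧸ D.R X d)) ∘ₗ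
      LinearMap.inr k _ _ ∘ₗ (D.R X d).mkQ) := by
    apply DirectSum.linearMap_ext
    intro t
    apply TensorProduct.ext'
    intro a b
    rw [LinearMap.comp_apply, quadEval_of]
    refine (congrArg (fun v : D.TruncObj X d => sgn k (t.i * t.j) • v)
      (truncCirc_mul D t.φ _ t.grade_pos _ _)).trans ?_
    -- The sign in `truncMul` was chosen to cancel the one in the embedding of `𝔽²(E)`.
    exact sgn_smul_sgn_smul _ _
  exact congrArg (fun f => f x) this

theorem quadEval_truncGen_eq_zero (X : Per) (d : ℤ) (x : FreeQuad D.E X d) (hx : x ∈ D.R X d) :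
    quadEval D.truncGen X d x = 0 := by
  rw [quadEval_truncGen]
  exact congrArg (fun v => ((0, 0, v) : D.TruncObj X d)) ((Submodule.Quotient.mk_eq_zero _).2 hx)

/-- The projection to the truncation. -/
noncomputable def toTruncation : D.operad ⟶ D.truncation :=
  lift D.truncGen D.quadEval_truncGen_eq_zero

/-- A generator is read off from the weight one component of its image in the truncation. -/
theorem gen_injective (X : Per) (d : ℤ) : Function.Injective (D.gen X d) := by
  intro e e' h
  have h2 := congrArg (D.toTruncation.app X d) h
  rw [toTruncation, lift_gen, lift_gen] at h2
  exact congrArg (fun v : D.TruncObj X d => v.2.1) h2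

/-- The truncation sends a quadratic expression to its class modulo `R`. Hence the ideal generated
by `R` contains no further expressions of weight two. -/
theorem mem_R_of_quadEval_gen {X : Per} {d : ℤ} {x : FreeQuad D.E X d}
    (h : quadEval (N := D.operad) D.gen X d x = 0) : x ∈ D.R X d := by
  have h2 := congrArg (D.toTruncation.app X d) h
  rw [map_quadEval, map_zero] at h2
  have e : (fun X d => D.toTruncation.app X d ∘ₗ D.gen X d) = D.truncGen := by
    funext X d
    apply LinearMap.ext
    intro y
    exact lift_gen D.truncGen D.quadEval_truncGen_eq_zero X d y
  rw [e, quadEval_truncGen] at h2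
  exact (Submodule.Quotient.mk_eq_zero _).1 (congrArg (fun v : D.TruncObj X d => v.2.2) h2)

end Truncation

/-! ### Presentations of the terminal operad and their Koszul duals -/

section Presentation

variable {D : QuadraticData k} (θ : D.operad ≅ terminalOperad k)

theorem iso_injective {M N : MarklOperad k} (θ : M ≅ N) (X : Per) (d : ℤ) :
    Function.Injective (θ.hom.app X d) := by
  refine Function.LeftInverse.injective (g := θ.inv.app X d) fun x => ?_
  exact congrArg (fun f : M ⟶ M => f.app X d x) θ.hom_inv_id

theorem iso_hom_inv {M N : MarklOperad k} (θ : M ≅ N) (X : Per) (d : ℤ) (y : N.obj X d) :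
    θ.hom.app X d (θ.inv.app X d y) = y :=
  congrArg (fun f : N ⟶ N => f.app X d y) θ.inv_hom_id

/-- A circle product landing over two points contracts both of them, so its outer factor lives over
one point. There the isomorphism with the terminal operad leaves only multiples of the unit, and no
new elements arise. -/
theorem gen_surjective (θ : D.operad ≅ terminalOperad k) {T : Per} (hT : T.k = 2) (d : ℤ) :
    Function.Surjective (D.gen T d) := by
  classical
  intro x
  -- The family tested is the span of the generators over two points and everything elsewhere.
  have := generation (D := D) (fun X d => if X.k = 2 then LinearMap.range (D.gen X d) else ⊤)
    (fun n => by rw [if_neg (by change ¬ 1 = 2; omega)]; trivial)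
    (fun X d e => by
      split_ifs
      · exact ⟨e, rfl⟩
      · trivial)
    (fun {F T S} φ {i j d} h x y _ hy => by
      split_ifs with hT
      · have h1 := φ.k_eq
        have h2 := φ.two_le
        have h3 := φ.idx.2
        obtain ⟨n, rfl⟩ := exists_eq_term (T := S) (by omega)
        obtain rfl := φ.eq_of_term
        rw [if_pos hT] at hy
        by_cases hi : i = 0
        · subst hi
          obtain rfl : j = d := by omega
          have hx : ∃ c : k, x = c • D.operad.one n := by
            obtain ⟨c, hc⟩ := eq_smul_termOne (θ.hom.app _ _ x)
            refine ⟨c, iso_injective θ _ _ ?_⟩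
            rw [map_smul, θ.hom.map_one, hc]
            rfl
          obtain ⟨c, rfl⟩ := hx
          rw [map_smul, LinearMap.smul_apply, D.operad.one_circ]
          exact Submodule.smul_mem _ c hy
        · obtain rfl : x = 0 := by
            apply iso_injective θ
            rw [terminal_eq_zero hi (θ.hom.app _ _ x), map_zero]
          rw [map_zero, LinearMap.zero_apply]
          exact zero_mem _
      · trivial) T d x
  rw [if_pos hT] at this
  exact this

/-- Generators embed into the ground field and, over two points, reach its unit, which gives the
basis. Since `R` is all that evaluates to zero in the presented operad, and `θ` is injective, `R` is
the kernel of the evaluation in the terminal operad. -/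
theorem exists_relSpec (hD : D.IsBinary) (θ : D.operad ≅ terminalOperad k) :
    ∃ B : BinaryBasis D.E 0, D.RelSpec B 1 := by
  let g : ∀ X d, D.E X d →ₗ[k] (terminalOperad k).obj X d := fun X d =>
    θ.hom.app X d ∘ₗ D.gen X d
  have hg : ∀ X d, Function.Injective (g X d) := fun X d =>
    (iso_injective θ X d).comp (D.gen_injective X d)
  choose e he using fun (T : Per) (hT : T.k = 2) =>
    gen_surjective θ hT 0 (θ.inv.app T 0 (termOne k T))
  have hge : ∀ T hT, g T 0 (e T hT) = termOne k T := fun T hT => by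
    change θ.hom.app T 0 (D.gen T 0 (e T hT)) = _
    rw [he, iso_hom_inv]
  have hval : ∀ T (y : (terminalOperad k).obj T 0),
      y = (groundField k 0).subtype y • termOne k T := fun T y =>
    Subtype.ext (mul_one (Subtype.val (p := fun c => c ∈ groundField k 0) y)).symm
  let B : BinaryBasis D.E 0 :=
    { e := e
      coord := fun T _ => (groundField k 0).subtype ∘ₗ g T 0
      coord_e := fun T hT => congrArg (groundField k 0).subtype (hge T hT)
      eq_smul := fun T hT x => hg T 0 (by
        rw [map_smul, hge]
        exact hval T (g T 0 x))
      eq_zero := fun T d x h => by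
        by_cases hd : d = 0
        · by_contra hx
          have := hD T d ⟨x, 0, hx⟩
          unfold Per.grade at this
          exact h ⟨by omega, hd⟩
        · exact hg T d (by rw [terminal_eq_zero hd (g T d x), map_zero]) }
  refine ⟨B, relSpec_of_terminal B g hge fun X d x => ?_⟩
  have := map_quadEval θ.hom D.gen X d x
  constructor
  · intro hx
    rw [← this, gen_rel X d hx, map_zero]
  · intro hx
    apply mem_R_of_quadEval_gen
    apply iso_injective θ
    rw [this, map_zero]
    exact hx

theorem koszulDual_isFreeOn (hD : D.IsBinary) (θ : D.operad ≅ terminalOperad k) :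
    ∃ m, IsFreeOn D.koszulDual 1 m := by
  -- The degree `0` is written as `1 - 1`, the form in which `RelSpec.dual` takes it for `ε = 1`.
  have h : ∃ B : BinaryBasis D.E (1 - 1), D.RelSpec B 1 := exists_relSpec hD θ
  obtain ⟨B, hB⟩ := h
  have := hB.dual (mul_one 1)
  rw [← sgn_one] at this
  exact ⟨_, this.isFreeOn⟩

end Presentation

end QuadraticData

end PerOperads

/-! ### Binary operations on a collection -/

namespace PerOperads

open Per

universe u

namespace Per

theorem surjective_of_fibCard {n : ℕ} {n₁ n₂ : ℕ+} {r : Fin n → Fin 2} (h₁ : fibCard r 0 = n₁)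
    (h₂ : fibCard r 1 = n₂) : Function.Surjective r := by
  have key : ∀ (t : Fin 2) (m : ℕ+), fibCard r t = m → ∃ x, r x = t := fun t m h => by
    obtain ⟨x, hx⟩ := Finset.card_pos.1 (h.symm ▸ m.pos : 0 < fibCard r t)
    exact ⟨x, (Finset.mem_filter.1 hx).2⟩
  intro t
  match t with
  | 0 => exact key 0 _ h₁
  | 1 => exact key 1 _ h₂

theorem surjective_restr {n m : ℕ} {β : Type} {r : Fin n → β} {s : Finset (Fin n)}
    (h : s.card = m) (hr : ∀ y, ∃ x ∈ s, r x = y) : Function.Surjective (restr r s h) := by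
  intro y
  obtain ⟨x, hx, rfl⟩ := hr y
  have : x ∈ Set.range (s.orderEmbOfFin h) := by
    rw [Finset.range_orderEmbOfFin]
    exact hx
  obtain ⟨z, rfl⟩ := this
  exact ⟨z, rfl⟩

theorem isRestr_restr {n m : ℕ+} {l : ℕ} {r : Fin n → Fin l} {s : Finset (Fin n)}
    (h : s.card = m) (hr : Function.Surjective (restr r s h)) :
    IsRestr ⟨m, l, restr r s h, hr⟩ (s : Set (Fin n)) fun x => (r x).val :=
  ⟨s.orderEmbOfFin h, Finset.range_orderEmbOfFin _ _, fun _ => rfl⟩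

section Three

variable {n n₁₂ n₂₃ : ℕ+} {α : Fin n → Fin 3} (hα : Function.Surjective α)

/-- With `exists_elem_right` this reads the associativity data of a permutad in `Per`: `s` and `t`
are the fiber and the target of the contraction of the first two of three points, `v` and `u` those
of the last two. -/
theorem exists_elem_left (h : (Finset.univ.filter fun x => α x ≠ 2).card = n₁₂)
    {s : Fin n₁₂ → Fin 2} (hs : s = restr (fun x => if α x = 0 then 0 else 1) _ h)
    {t : Fin n → Fin 2} (ht : t = fun x => if α x = 2 then 1 else 0) :
    ∃ (hs : Function.Surjective s) (ht : Function.Surjective t)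
      (φ : Elem ⟨n₁₂, 2, s, hs⟩ ⟨n, 3, α, hα⟩ ⟨n, 2, t, ht⟩), φ.idx.val = 0 := by
  subst hs ht
  have hs : Function.Surjective (restr (fun x => if α x = 0 then (0 : Fin 2) else 1) _ h) := by
    apply surjective_restr
    intro y
    match y with
    | 0 =>
      obtain ⟨x, hx⟩ := hα 0
      exact ⟨x, by simp [hx], by simp [hx]⟩
    | 1 =>
      obtain ⟨x, hx⟩ := hα 1
      exact ⟨x, by simp [hx], by simp [hx]⟩
  have ht : Function.Surjective fun x => if α x = 2 then (1 : Fin 2) else 0 := by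
    intro y
    match y with
    | 0 =>
      obtain ⟨x, hx⟩ := hα 0
      exact ⟨x, by simp [hx]⟩
    | 1 =>
      obtain ⟨x, hx⟩ := hα 2
      exact ⟨x, by simp [hx]⟩
  refine ⟨hs, ht, exists_elem_of_isRestr (le_refl 2) (i := 0) (by simp) rfl
    (isRestr_self ⟨n, 3, α, hα⟩) (isRestr_restr h hs) (isRestr_self ⟨n, 2, _, ht⟩) ?_ rfl ?_ ?_⟩
  · ext x
    have : ∀ y : Fin 3, y ≠ 2 ↔ 0 ≤ y.val ∧ y.val < 0 + 2 := by decide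
    simpa using this (α x)
  · intro x hx
    have : ∀ y : Fin 3, y ≠ 2 → (if y = 0 then (0 : Fin 2) else 1).val = y.val - 0 := by decide
    exact this _ (by simpa using hx)
  · intro x _
    have : ∀ y : Fin 3, (if y = 2 then (1 : Fin 2) else 0).val =
        min y.val 0 + (y.val + 1 - (0 + 2)) := by decide
    exact this (α x)

theorem exists_elem_right (h : (Finset.univ.filter fun x => α x ≠ 0).card = n₂₃)
    {v : Fin n₂₃ → Fin 2} (hv : v = restr (fun x => if α x = 2 then 1 else 0) _ h)
    {u : Fin n → Fin 2} (hu : u = fun x => if α x = 0 then 0 else 1) :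
    ∃ (hv : Function.Surjective v) (hu : Function.Surjective u)
      (φ : Elem ⟨n₂₃, 2, v, hv⟩ ⟨n, 3, α, hα⟩ ⟨n, 2, u, hu⟩), φ.idx.val = 1 := by
  subst hv hu
  have hv : Function.Surjective (restr (fun x => if α x = 2 then (1 : Fin 2) else 0) _ h) := by
    apply surjective_restr
    intro y
    match y with
    | 0 =>
      obtain ⟨x, hx⟩ := hα 1
      exact ⟨x, by simp [hx], by simp [hx]⟩
    | 1 =>
      obtain ⟨x, hx⟩ := hα 2
      exact ⟨x, by simp [hx], by simp [hx]⟩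
  have hu : Function.Surjective fun x => if α x = 0 then (0 : Fin 2) else 1 := by
    intro y
    match y with
    | 0 =>
      obtain ⟨x, hx⟩ := hα 0
      exact ⟨x, by simp [hx]⟩
    | 1 =>
      obtain ⟨x, hx⟩ := hα 1
      exact ⟨x, by simp [hx]⟩
  refine ⟨hv, hu, exists_elem_of_isRestr (le_refl 2) (i := 1) (by simp) rfl
    (isRestr_self ⟨n, 3, α, hα⟩) (isRestr_restr h hv) (isRestr_self ⟨n, 2, _, hu⟩) ?_ rfl ?_ ?_⟩
  · ext x
    have : ∀ y : Fin 3, y ≠ 0 ↔ 1 ≤ y.val ∧ y.val < 1 + 2 := by decide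
    simpa using this (α x)
  · intro x hx
    have : ∀ y : Fin 3, y ≠ 0 → (if y = 2 then (1 : Fin 2) else 0).val = y.val - 1 := by decide
    exact this _ (by simpa using hx)
  · intro x _
    have : ∀ y : Fin 3, (if y = 0 then (0 : Fin 2) else 1).val =
        min y.val 1 + (y.val + 1 - (1 + 2)) := by decide
    exact this (α x)

end Three

end Per

variable {k : Type u} [Field k] {A : Coll k}

section Binary

variable {c : Fin 2 → ℕ+} {d : Fin 2 → ℤ}

/-- A family of two elements. -/
def Coll.pair (A : Coll k) (a : A (c 0) (d 0)) (b : A (c 1) (d 1)) : ∀ t : Fin 2, A (c t) (d t)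
  | 0 => a
  | 1 => b

theorem Coll.elt_pair (a : A (c 0) (d 0)) (b : A (c 1) (d 1)) :
    (fun t => A.elt (A.pair a b t)) = ![A.elt a, A.elt b] := by
  funext t
  match t with
  | 0 => rfl
  | 1 => rfl

theorem Coll.update_pair_zero (a a' : A (c 0) (d 0)) (b : A (c 1) (d 1)) :
    Function.update (A.pair a b) 0 a' = A.pair a' b := by
  funext t
  match t with
  | 0 => rfl
  | 1 => rfl

theorem Coll.update_pair_one (a : A (c 0) (d 0)) (b b' : A (c 1) (d 1)) :
    Function.update (A.pair a b) 1 b' = A.pair a b' := by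
  funext t
  match t with
  | 0 => rfl
  | 1 => rfl

/-- A multilinear map in two variables as a bilinear map. -/
def bilin {W : Type*} [AddCommGroup W] [Module k W]
    (x : MultilinearMap k (fun t : Fin 2 => A (c t) (d t)) W) :
    A (c 0) (d 0) →ₗ[k] A (c 1) (d 1) →ₗ[k] W :=
  LinearMap.mk₂ k (fun a b => x (A.pair a b))
    (fun a a' b => by
      rw [← Coll.update_pair_zero a (a + a') b, x.map_update_add, Coll.update_pair_zero,
        Coll.update_pair_zero])
    (fun s a b => by
      rw [← Coll.update_pair_zero a (s • a) b, x.map_update_smul, Coll.update_pair_zero])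
    (fun a b b' => by
      rw [← Coll.update_pair_one a b (b + b'), x.map_update_add, Coll.update_pair_one,
        Coll.update_pair_one])
    (fun s a b => by
      rw [← Coll.update_pair_one a b (s • b), x.map_update_smul, Coll.update_pair_one])

/-- A bilinear map as a multilinear map in two variables. -/
def multilin {W : Type*} [AddCommGroup W] [Module k W]
    (x : A (c 0) (d 0) →ₗ[k] A (c 1) (d 1) →ₗ[k] W) :
    MultilinearMap k (fun t : Fin 2 => A (c t) (d t)) W :=
  MultilinearMap.mk' (fun a => x (a 0) (a 1))
    (fun a t v w => by
      match t with
      | 0 => simp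
      | 1 => simp)
    (fun a t s v => by
      match t with
      | 0 => simp
      | 1 => simp)

end Binary

namespace EndObj

section Three

variable {n n' m : ℕ+} {α : Fin n → Fin 3} {hα : Function.Surjective α} {r : Fin m → Fin 2}
  {hr : Function.Surjective r} {t : Fin n' → Fin 2} {ht : Function.Surjective t}

/-- No argument precedes the contracted pair, hence there is no Koszul sign. -/
theorem ev_circ_left (φ : Elem ⟨m, 2, r, hr⟩ ⟨n, 3, α, hα⟩ ⟨n', 2, t, ht⟩) (h0 : φ.idx.val = 0)
    {p q d : ℤ} (h : p + q = d) (x : EndObj A ⟨n', 2, t, ht⟩ p) (y : EndObj A ⟨m, 2, r, hr⟩ q)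
    (e₀ e₁ e₂ : A.Elt) (hb : ∀ j, Per.src ⟨n, 3, α, hα⟩ j = (![e₀, e₁, e₂] j).1)
    (hy : ∀ j, Per.src ⟨m, 2, r, hr⟩ j = (![e₀, e₁] j).1)
    (hx : ∀ j, Per.src ⟨n', 2, t, ht⟩ j = (![y.ev ![e₀, e₁] hy, e₂] j).1) :
    ev (circ φ h x y) ![e₀, e₁, e₂] hb = x.ev ![y.ev ![e₀, e₁] hy, e₂] hx := by
  rw [ev_circ, h0, psum_zero, mul_zero, sgn_zero, Coll.Elt.one_smul]
  apply ev_congr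
  funext j
  match j with
  | 0 =>
    refine graft_idx φ y _ hb h0.symm (b' := ![e₀, e₁]) (fun l j hj => ?_) hy
    match l with
    | 0 =>
      obtain rfl : j = (0 : Fin 3) := Fin.ext (hj.trans (by rw [h0]; rfl))
      rfl
    | 1 =>
      obtain rfl : j = (1 : Fin 3) := Fin.ext (hj.trans (by rw [h0]; rfl))
      rfl
  | 1 =>
    exact graft_gt φ y _ hb (t := (1 : Fin 2)) (j := (2 : Fin 3)) (by rw [h0]; exact Nat.one_pos)
      rfl

/-- The sign comes from `y` passing the single argument `e₀`. -/
theorem ev_circ_right (φ : Elem ⟨m, 2, r, hr⟩ ⟨n, 3, α, hα⟩ ⟨n', 2, t, ht⟩) (h0 : φ.idx.val = 1)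
    {p q d : ℤ} (h : p + q = d) (x : EndObj A ⟨n', 2, t, ht⟩ p) (y : EndObj A ⟨m, 2, r, hr⟩ q)
    (e₀ e₁ e₂ : A.Elt) (hb : ∀ j, Per.src ⟨n, 3, α, hα⟩ j = (![e₀, e₁, e₂] j).1)
    (hy : ∀ j, Per.src ⟨m, 2, r, hr⟩ j = (![e₁, e₂] j).1)
    (hx : ∀ j, Per.src ⟨n', 2, t, ht⟩ j = (![e₀, y.ev ![e₁, e₂] hy] j).1) :
    ev (circ φ h x y) ![e₀, e₁, e₂] hb =
      (x.ev ![e₀, y.ev ![e₁, e₂] hy] hx).smul (sgn k (q * e₀.2.1)) := by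
  rw [ev_circ, h0, psum_succ _ (i := 0) (Nat.succ_pos 2), psum_zero, zero_add]
  refine congrArg (Coll.Elt.smul (sgn k (q * e₀.2.1))) ?_
  apply ev_congr
  funext j
  match j with
  | 0 =>
    exact graft_lt φ y _ hb (t := (0 : Fin 2)) (j := (0 : Fin 3)) (by rw [h0]; exact Nat.one_pos)
      rfl
  | 1 =>
    refine graft_idx φ y _ hb h0.symm (b' := ![e₁, e₂]) (fun l j hj => ?_) hy
    match l with
    | 0 =>
      obtain rfl : j = (1 : Fin 3) := Fin.ext (hj.trans (by rw [h0]; rfl))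
      rfl
    | 1 =>
      obtain rfl : j = (2 : Fin 3) := Fin.ext (hj.trans (by rw [h0]; rfl))
      rfl

end Three

end EndObj

/-- The collection obtained from `A` by renumbering the degrees. -/
def Coll.regrade (A : Coll k) (sh : ℤ → ℤ) : Coll k := fun n d => A n (sh d)

section BinaryOp

variable {sh : ℤ → ℤ} {ε : ℤ}

theorem src_eq_of_fibCard {n n₁ n₂ : ℕ+} {r : Fin n → Fin 2} (h₁ : fibCard r 0 = n₁)
    (h₂ : fibCard r 1 = n₂) (hr : Function.Surjective r) (t : Fin 2) :
    Per.src ⟨n, 2, r, hr⟩ t = ![n₁, n₂] t := by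
  match t with
  | 0 => exact PNat.eq h₁
  | 1 => exact PNat.eq h₂

/-- The components and degrees of the arguments of a binary operation. -/
def binIdx (hsh : ∀ d, sh d = d - ε) {n n₁ n₂ : ℕ+} {r : Fin n → Fin 2} (h₁ : fibCard r 0 = n₁)
    (h₂ : fibCard r 1 = n₂) (hr : Function.Surjective r) {i j d : ℤ} (h : i + j = d) :
    EndIdx ⟨n, 2, r, hr⟩ ε :=
  ⟨n, rfl, ![n₁, n₂], src_eq_of_fibCard h₁ h₂ hr, ![sh i, sh j], sh d, by
    have := Fin.sum_univ_two ![sh i, sh j]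
    refine (congrArg (fun s => ε + s) this).trans ?_
    change ε + (sh i + sh j) = sh d
    rw [hsh, hsh, hsh]
    omega⟩

/-- The binary operations of the permutad corresponding to a family of operations of degree `ε`. -/
def binOp (hsh : ∀ d, sh d = d - ε) (m : ∀ T : Per, T.k = 2 → EndObj A T ε)
    {n n₁ n₂ : ℕ+} (r : Fin n → Fin 2) (h₁ : fibCard r 0 = n₁) (h₂ : fibCard r 1 = n₂)
    {i j d : ℤ} (h : i + j = d) :
    A.regrade sh n₁ i →ₗ[k] A.regrade sh n₂ j →ₗ[k] A.regrade sh n d :=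
  sgn k (ε * sh i) • bilin (c := ![n₁, n₂]) (d := ![sh i, sh j])
    (m ⟨n, 2, r, surjective_of_fibCard h₁ h₂⟩ rfl (binIdx hsh h₁ h₂ _ h))

theorem elt_binOp (hsh : ∀ d, sh d = d - ε) (m : ∀ T : Per, T.k = 2 → EndObj A T ε)
    {n n₁ n₂ : ℕ+} (r : Fin n → Fin 2) (h₁ : fibCard r 0 = n₁) (h₂ : fibCard r 1 = n₂)
    {i j d : ℤ} (h : i + j = d) (a : A n₁ (sh i)) (b : A n₂ (sh j))
    (hb : ∀ t, Per.src ⟨n, 2, r, surjective_of_fibCard h₁ h₂⟩ t = (![A.elt a, A.elt b] t).1) :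
    A.elt (d := sh d) (binOp hsh m r h₁ h₂ h a b) =
      ((m ⟨n, 2, r, surjective_of_fibCard h₁ h₂⟩ rfl).ev ![A.elt a, A.elt b] hb).smul
        (sgn k (ε * sh i)) := by
  let i₀ : EndIdx ⟨n, 2, r, surjective_of_fibCard h₁ h₂⟩ ε := binIdx hsh h₁ h₂ _ h
  change (A.elt (m ⟨n, 2, r, surjective_of_fibCard h₁ h₂⟩ rfl i₀
    (A.pair (c := ![n₁, n₂]) (d := ![sh i, sh j]) a b))).smul (sgn k (ε * sh i)) = _
  refine congrArg (Coll.Elt.smul (sgn k (ε * sh i))) ?_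
  refine (EndObj.elt_apply (m ⟨n, 2, r, surjective_of_fibCard h₁ h₂⟩ rfl) i₀.hn i₀.hc i₀.hD
    (A.pair (c := ![n₁, n₂]) (d := ![sh i, sh j]) a b)).trans ?_
  exact EndObj.ev_congr _ (Coll.elt_pair (c := ![n₁, n₂]) (d := ![sh i, sh j]) a b) _

theorem src_eq_fst {n n₁ n₂ : ℕ+} {r : Fin n → Fin 2} (h₁ : fibCard r 0 = n₁)
    (h₂ : fibCard r 1 = n₂) (hr : Function.Surjective r) {e e' : A.Elt} (he : n₁ = e.1)
    (he' : n₂ = e'.1) (t : Fin 2) : Per.src ⟨n, 2, r, hr⟩ t = (![e, e'] t).1 := by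
  match t with
  | 0 => exact (src_eq_of_fibCard h₁ h₂ hr 0).trans he
  | 1 => exact (src_eq_of_fibCard h₁ h₂ hr 1).trans he'

end BinaryOp

end PerOperads

/-! ### Associativity and the quadratic relation -/

namespace PerOperads

open Per

universe u

variable {k : Type u} [Field k] {A : Coll k} {sh : ℤ → ℤ} {ε : ℤ}

/-- Holds because `ε * (ε - 1)` is even. On the left are the twists of `(ab)c`, on the right `sgn k
ε` times the twist that remains in `a(bc)`; this is why `binOp` carries the sign of its first
argument. -/
theorem sgn_assoc (i j : ℤ) :
    sgn k (ε * (ε + (i + j))) * sgn k (ε * i) = sgn k ε * sgn k (ε * j) := by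
  rw [← sgn_add, ← sgn_add]
  obtain ⟨c, hc⟩ := Int.even_mul_pred_self ε
  apply sgn_eq k (c + ε * i)
  linear_combination hc

theorem sgn_mul_cancel {A : Coll k} {i : ℤ} {e e' : A.Elt}
    (h : e.smul (sgn k i) = e'.smul (sgn k i)) : e = e' := by
  have := congrArg (Coll.Elt.smul (sgn k i)) h
  rwa [Coll.Elt.smul_smul, Coll.Elt.smul_smul, sgn_mul_self, Coll.Elt.one_smul,
    Coll.Elt.one_smul] at this

section Core

variable (hsh : ∀ d, sh d = d - ε) (m : ∀ T : Per, T.k = 2 → EndObj A T ε)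
  {n n₁ n₂ n₃ n₁₂ n₂₃ : ℕ+} {α : Fin n → Fin 3} (hα : Function.Surjective α)
  {s : Fin n₁₂ → Fin 2} {t u : Fin n → Fin 2} {v : Fin n₂₃ → Fin 2}
  (s₀ : fibCard s 0 = n₁) (s₁ : fibCard s 1 = n₂) (t₀ : fibCard t 0 = n₁₂)
  (t₁ : fibCard t 1 = n₃) (u₀ : fibCard u 0 = n₁) (u₁ : fibCard u 1 = n₂₃)
  (v₀ : fibCard v 0 = n₂) (v₁ : fibCard v 1 = n₃)
  {i j l ij jl d : ℤ} (hij : i + j = ij) (hijl : ij + l = d) (hjl : j + l = jl)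
  (hijl' : i + jl = d) (a : A n₁ (sh i)) (b : A n₂ (sh j)) (c : A n₃ (sh l))
  {r : ℤ} (hr : ε + ε = r)
  (hb : ∀ x, Per.src ⟨n, 3, α, hα⟩ x = (![A.elt a, A.elt b, A.elt c] x).1)

include s₀ s₁ t₀ t₁ hij in
theorem elt_binOp_left {hs : Function.Surjective s} {ht : Function.Surjective t}
    (φ : Elem ⟨n₁₂, 2, s, hs⟩ ⟨n, 3, α, hα⟩ ⟨n, 2, t, ht⟩) (h0 : φ.idx.val = 0) :
    A.elt (d := sh d) (binOp hsh m t t₀ t₁ hijl (binOp hsh m s s₀ s₁ hij a b) c) =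
      (EndObj.ev (EndObj.circ φ hr (m ⟨n, 2, t, ht⟩ rfl) (m ⟨n₁₂, 2, s, hs⟩ rfl))
        ![A.elt a, A.elt b, A.elt c] hb).smul (sgn k (ε * sh ij) * sgn k (ε * sh i)) := by
  have hy : ∀ x, Per.src ⟨n₁₂, 2, s, hs⟩ x = (![A.elt a, A.elt b] x).1 := fun x =>
    src_eq_fst s₀ s₁ hs rfl rfl x
  have hx : ∀ x, Per.src ⟨n, 2, t, ht⟩ x =
      (![(m ⟨n₁₂, 2, s, hs⟩ rfl).ev ![A.elt a, A.elt b] hy, A.elt c] x).1 := fun x =>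
    src_eq_fst t₀ t₁ ht rfl rfl x
  have hx' : ∀ x, Per.src ⟨n, 2, t, ht⟩ x =
      (![A.elt (d := sh ij) (binOp hsh m s s₀ s₁ hij a b), A.elt c] x).1 := fun x =>
    src_eq_fst t₀ t₁ ht rfl rfl x
  rw [elt_binOp hsh m t t₀ t₁ hijl _ c hx',
    EndObj.ev_circ_left φ h0 hr _ _ _ _ _ hb hy hx,
    EndObj.ev_smul_slot _ (sgn k (ε * sh i)) _ _ hx hx' (0 : Fin 2)
      (elt_binOp hsh m s s₀ s₁ hij a b hy), Coll.Elt.smul_smul]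
  intro x hx
  match x with
  | 0 => exact absurd rfl hx
  | 1 => rfl

-- The twist of the outer operation is the Koszul sign for moving the inner operation past `a`, so
-- the circle product absorbs it and only the inner twist remains.
include u₀ u₁ v₀ v₁ hjl in
theorem elt_binOp_right {hv : Function.Surjective v} {hu : Function.Surjective u}
    (φ : Elem ⟨n₂₃, 2, v, hv⟩ ⟨n, 3, α, hα⟩ ⟨n, 2, u, hu⟩) (h0 : φ.idx.val = 1) :
    A.elt (d := sh d) (binOp hsh m u u₀ u₁ hijl' a (binOp hsh m v v₀ v₁ hjl b c)) =
      (EndObj.ev (EndObj.circ φ hr (m ⟨n, 2, u, hu⟩ rfl) (m ⟨n₂₃, 2, v, hv⟩ rfl))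
        ![A.elt a, A.elt b, A.elt c] hb).smul (sgn k (ε * sh j)) := by
  have hy : ∀ x, Per.src ⟨n₂₃, 2, v, hv⟩ x = (![A.elt b, A.elt c] x).1 := fun x =>
    src_eq_fst v₀ v₁ hv rfl rfl x
  have hx : ∀ x, Per.src ⟨n, 2, u, hu⟩ x =
      (![A.elt a, (m ⟨n₂₃, 2, v, hv⟩ rfl).ev ![A.elt b, A.elt c] hy] x).1 := fun x =>
    src_eq_fst u₀ u₁ hu rfl rfl x
  have hx' : ∀ x, Per.src ⟨n, 2, u, hu⟩ x =
      (![A.elt a, A.elt (d := sh jl) (binOp hsh m v v₀ v₁ hjl b c)] x).1 := fun x =>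
    src_eq_fst u₀ u₁ hu rfl rfl x
  rw [elt_binOp hsh m u u₀ u₁ hijl' a _ hx',
    EndObj.ev_circ_right φ h0 hr _ _ _ _ _ hb hy hx,
    EndObj.ev_smul_slot _ (sgn k (ε * sh j)) _ _ hx hx' (1 : Fin 2)
      (elt_binOp hsh m v v₀ v₁ hjl b c hy), Coll.Elt.smul_smul, Coll.Elt.smul_smul, mul_comm]
  intro x hx
  match x with
  | 0 => rfl
  | 1 => exact absurd rfl hx

include s₀ s₁ t₀ t₁ u₀ u₁ v₀ v₁ hij hijl hjl hijl' hr in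
/-- One instance of associativity amounts to one value of the quadratic relation. -/
theorem binOp_assoc_iff {hs : Function.Surjective s} {ht : Function.Surjective t}
    (φ : Elem ⟨n₁₂, 2, s, hs⟩ ⟨n, 3, α, hα⟩ ⟨n, 2, t, ht⟩) (h0 : φ.idx.val = 0)
    {hv : Function.Surjective v} {hu : Function.Surjective u}
    (φ' : Elem ⟨n₂₃, 2, v, hv⟩ ⟨n, 3, α, hα⟩ ⟨n, 2, u, hu⟩) (h1 : φ'.idx.val = 1) :
    binOp hsh m t t₀ t₁ hijl (binOp hsh m s s₀ s₁ hij a b) c =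
        binOp hsh m u u₀ u₁ hijl' a (binOp hsh m v v₀ v₁ hjl b c) ↔
      EndObj.ev (EndObj.circ φ hr (m ⟨n, 2, t, ht⟩ rfl) (m ⟨n₁₂, 2, s, hs⟩ rfl))
        ![A.elt a, A.elt b, A.elt c] hb =
      EndObj.ev (sgn k ε • EndObj.circ φ' hr (m ⟨n, 2, u, hu⟩ rfl) (m ⟨n₂₃, 2, v, hv⟩ rfl))
        ![A.elt a, A.elt b, A.elt c] hb := by
  have e1 := elt_binOp_left hsh m hα s₀ s₁ t₀ t₁ hij hijl a b c hr hb φ h0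
  have e2 := elt_binOp_right hsh m hα u₀ u₁ v₀ v₁ hjl hijl' a b c hr hb φ' h1
  rw [show sh ij = ε + (sh i + sh j) by rw [hsh, hsh, hsh]; omega, sgn_assoc, mul_comm] at e1
  rw [EndObj.ev_smul]
  have key : ∀ e e' : A.Elt, e = e'.smul (sgn k ε) ↔ e.smul (sgn k (ε * sh j) * sgn k ε) =
      e'.smul (sgn k (ε * sh j)) := fun e e' => by
    constructor
    · rintro rfl
      rw [Coll.Elt.smul_smul, mul_assoc, sgn_mul_self, mul_one]
    · intro h
      rw [← Coll.Elt.smul_smul] at h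
      rw [← sgn_mul_cancel h, Coll.Elt.smul_smul, sgn_mul_self, Coll.Elt.one_smul]
  rw [key, ← e1, ← e2]
  exact ⟨fun h => congrArg (A.elt (d := sh d)) h, fun h => A.elt_injective h⟩

end Core

section Structure

variable (hsh : ∀ d, sh d = d - ε) (m : ∀ T : Per, T.k = 2 → EndObj A T ε)

/-- The permutad structure corresponding to a family of operations satisfying the quadratic
relation. -/
def binStr (hm : QuadRel (endOperad A) ε m) : PermutadStr (A.regrade sh) where
  op r h₁ h₂ _ _ _ h := binOp hsh m r h₁ h₂ h
  assoc {n n₁ n₂ n₃ n₁₂ n₂₃} α h₁₂ h₂₃ s hs t ht u hu v hv s₀ s₁ t₀ t₁ u₀ u₁ v₀ v₁ i j l ij jl d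
      hij hijl hjl hijl' a b c := by
    -- Surjectivity of `α` is extracted from the cardinalities: `0` and `2` are attained because
    -- fibers of `u` and `t` are nonempty, and `1` because a fiber of `s` is.
    have c0 : (Finset.univ.filter fun x => α x = 0).card = n₁ := by
      rw [← u₀, fibCard]
      congr 1
      ext x
      have : ∀ y : Fin 3, y = 0 ↔ (if y = 0 then (0 : Fin 2) else 1) = 0 := by decide
      simp only [hu, Finset.mem_filter, Finset.mem_univ, true_and]
      exact this _
    have c2 : (Finset.univ.filter fun x => α x = 2).card = n₃ := by
      rw [← t₁, fibCard]
      congr 1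
      ext x
      have : ∀ y : Fin 3, y = 2 ↔ (if y = 2 then (1 : Fin 2) else 0) = 1 := by decide
      simp only [ht, Finset.mem_filter, Finset.mem_univ, true_and]
      exact this _
    have hα : Function.Surjective α := by
      intro y
      match y with
      | 0 =>
        obtain ⟨x, hx⟩ := Finset.card_pos.1 (c0.symm ▸ n₁.pos)
        exact ⟨x, (Finset.mem_filter.1 hx).2⟩
      | 2 =>
        obtain ⟨x, hx⟩ := Finset.card_pos.1 (c2.symm ▸ n₃.pos)
        exact ⟨x, (Finset.mem_filter.1 hx).2⟩
      | 1 =>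
        obtain ⟨z, hz⟩ := surjective_of_fibCard s₀ s₁ 1
        rw [hs] at hz
        have h1 := Finset.orderEmbOfFin_mem _ h₁₂ z
        have : ∀ y : Fin 3, y ≠ 2 → (if y = 0 then (0 : Fin 2) else 1) = 1 → y = 1 := by decide
        exact ⟨_, this _ (Finset.mem_filter.1 h1).2 hz⟩
    obtain ⟨hs', ht', φ, hφ⟩ := exists_elem_left hα h₁₂ hs ht
    obtain ⟨hv', hu', φ', hφ'⟩ := exists_elem_right hα h₂₃ hv hu
    have hb : ∀ x, Per.src ⟨n, 3, α, hα⟩ x =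
        (![A.elt (d := sh i) a, A.elt (d := sh j) b, A.elt (d := sh l) c] x).1 := by
      intro x
      match x with
      | 0 => exact PNat.eq c0
      | 2 => exact PNat.eq c2
      | 1 =>
        have e1 : φ.incl (1 : Fin 2) = (1 : Fin 3) := Fin.ext (by rw [φ.incl_val, hφ]; rfl)
        have e2 := φ.src_incl (1 : Fin 2)
        rw [e1] at e2
        exact e2.symm.trans (src_eq_of_fibCard s₀ s₁ hs' 1)
    refine (binOp_assoc_iff hsh m hα s₀ s₁ t₀ t₁ u₀ u₁ v₀ v₁ hij hijl hjl hijl' a b c rfl hb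
      φ hφ φ' hφ').2 ?_
    have := hm φ φ' rfl rfl rfl rfl hφ hφ' rfl
    exact congrArg (fun x : EndObj A ⟨n, 3, α, hα⟩ (ε + ε) => x.ev _ hb) this

theorem exists_eq_regrade (hsh : ∀ d, sh d = d - ε) (e : A.Elt) :
    ∃ (n : ℕ+) (i : ℤ) (a : A n (sh i)), e = A.elt a := by
  obtain ⟨n, i, a⟩ := e
  obtain ⟨i, rfl⟩ : ∃ j, sh j = i := ⟨i + ε, by rw [hsh]; omega⟩
  exact ⟨n, i, a, rfl⟩

theorem fun_eq_vec₂ {β : Type*} (f : Fin 2 → β) : f = ![f 0, f 1] := by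
  funext x
  match x with
  | 0 => rfl
  | 1 => rfl

theorem fun_eq_vec₃ {β : Type*} (f : Fin 3 → β) : f = ![f 0, f 1, f 2] := by
  funext x
  match x with
  | 0 => rfl
  | 1 => rfl
  | 2 => rfl

/-- An instance of the quadratic relation lives over a surjection onto three points, and on
homogeneous triples it is one instance of associativity. The work lies in reading off the required
cardinalities from the sources of the objects involved. -/
theorem quadRel_of_assoc (σ : PermutadStr (A.regrade sh))
    (hσ : ∀ {n n₁ n₂ : ℕ+} (r : Fin n → Fin 2) (h₁ : fibCard r 0 = n₁) (h₂ : fibCard r 1 = n₂)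
      {i j d : ℤ} (h : i + j = d), σ.op r h₁ h₂ h = binOp hsh m r h₁ h₂ h) :
    QuadRel (endOperad A) ε m := by
  intro F F' X S S' φ φ' hF hS hF' hS' h0 h1 r hr
  have hX : X.k = 3 := by
    have := φ.k_eq
    omega
  obtain ⟨n, κ, α, hα⟩ := X
  obtain rfl : κ = 3 := hX
  have p₁₂ : 0 < (Finset.univ.filter fun x => α x ≠ 2).card := by
    obtain ⟨x, hx⟩ := hα 0
    exact Finset.card_pos.2 ⟨x, by simp [hx]⟩
  have p₂₃ : 0 < (Finset.univ.filter fun x => α x ≠ 0).card := by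
    obtain ⟨x, hx⟩ := hα 2
    exact Finset.card_pos.2 ⟨x, by simp [hx]⟩
  obtain ⟨n₁₂, h₁₂⟩ : ∃ n₁₂ : ℕ+, (Finset.univ.filter fun x => α x ≠ 2).card = n₁₂ :=
    ⟨⟨_, p₁₂⟩, rfl⟩
  obtain ⟨n₂₃, h₂₃⟩ : ∃ n₂₃ : ℕ+, (Finset.univ.filter fun x => α x ≠ 0).card = n₂₃ :=
    ⟨⟨_, p₂₃⟩, rfl⟩
  obtain ⟨s, hs⟩ : ∃ s, s = restr (fun x => if α x = 0 then (0 : Fin 2) else 1) _ h₁₂ := ⟨_, rfl⟩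
  obtain ⟨t, ht⟩ : ∃ t, t = fun x => if α x = 2 then (1 : Fin 2) else 0 := ⟨_, rfl⟩
  obtain ⟨u, hu⟩ : ∃ u, u = fun x => if α x = 0 then (0 : Fin 2) else 1 := ⟨_, rfl⟩
  obtain ⟨v, hv⟩ : ∃ v, v = restr (fun x => if α x = 2 then (1 : Fin 2) else 0) _ h₂₃ := ⟨_, rfl⟩
  obtain ⟨hs', ht', φ₀, hφ₀⟩ := exists_elem_left hα h₁₂ hs ht
  obtain ⟨hv', hu', φ₁, hφ₁⟩ := exists_elem_right hα h₂₃ hv hu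
  -- Contractions with equal intervals coincide, so `φ` and `φ'` may be taken to be the standard
  -- pair attached to `α`.
  obtain ⟨rfl, rfl, e⟩ := φ.unique φ₀ (h0.trans hφ₀.symm) hF
  obtain rfl := eq_of_heq e
  obtain ⟨rfl, rfl, e⟩ := φ'.unique φ₁ (h1.trans hφ₁.symm) hF'
  obtain rfl := eq_of_heq e
  apply EndObj.ext_ev
  intro b hb
  obtain ⟨n₁, i, a₁, e₁⟩ := exists_eq_regrade hsh (b (0 : Fin 3))
  obtain ⟨n₂, j, a₂, e₂⟩ := exists_eq_regrade hsh (b (1 : Fin 3))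
  obtain ⟨n₃, l, a₃, e₃⟩ := exists_eq_regrade hsh (b (2 : Fin 3))
  obtain rfl : b = ![A.elt a₁, A.elt a₂, A.elt a₃] := by
    rw [← e₁, ← e₂, ← e₃]
    exact fun_eq_vec₃ b
  have i0 : φ.idx = (0 : Fin 2) := Fin.ext h0
  have i1 : φ'.idx = (1 : Fin 2) := Fin.ext h1
  have x0 : φ.incl (0 : Fin 2) = (0 : Fin 3) := Fin.ext (by rw [φ.incl_val, h0]; rfl)
  have x1 : φ.incl (1 : Fin 2) = (1 : Fin 3) := Fin.ext (by rw [φ.incl_val, h0]; rfl)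
  have x2 : φ'.incl (0 : Fin 2) = (1 : Fin 3) := Fin.ext (by rw [φ'.incl_val, h1]; rfl)
  have x3 : φ'.incl (1 : Fin 2) = (2 : Fin 3) := Fin.ext (by rw [φ'.incl_val, h1]; rfl)
  have y0 : φ.hom.base (2 : Fin 3) = (1 : Fin 2) := Fin.ext (by rw [φ.base_val, h0]; rfl)
  have y1 : φ'.hom.base (0 : Fin 3) = (0 : Fin 2) := Fin.ext (by rw [φ'.base_val, h1]; rfl)
  have s₀ : fibCard s 0 = n₁ := congrArg PNat.val
    ((φ.src_incl (0 : Fin 2)).trans ((congrArg (Per.src _) x0).trans (hb (0 : Fin 3))))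
  have s₁ : fibCard s 1 = n₂ := congrArg PNat.val
    ((φ.src_incl (1 : Fin 2)).trans ((congrArg (Per.src _) x1).trans (hb (1 : Fin 3))))
  have v₀ : fibCard v 0 = n₂ := congrArg PNat.val
    ((φ'.src_incl (0 : Fin 2)).trans ((congrArg (Per.src _) x2).trans (hb (1 : Fin 3))))
  have v₁ : fibCard v 1 = n₃ := congrArg PNat.val
    ((φ'.src_incl (1 : Fin 2)).trans ((congrArg (Per.src _) x3).trans (hb (2 : Fin 3))))
  have t₀ : fibCard t 0 = n₁₂ := congrArg PNat.val
    ((congrArg (Per.src _) i0.symm).trans φ.src_idx)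
  have u₁ : fibCard u 1 = n₂₃ := congrArg PNat.val
    ((congrArg (Per.src _) i1.symm).trans φ'.src_idx)
  have t₁ : fibCard t 1 = n₃ := congrArg PNat.val
    ((congrArg (Per.src _) y0.symm).trans
      ((φ.src_base (by rw [y0, i0]; exact Fin.ne_of_val_ne Nat.one_ne_zero)).trans
        (hb (2 : Fin 3))))
  have u₀ : fibCard u 0 = n₁ := congrArg PNat.val
    ((congrArg (Per.src _) y1.symm).trans
      ((φ'.src_base (by rw [y1, i1]; exact Fin.ne_of_val_ne Nat.zero_ne_one)).trans
        (hb (0 : Fin 3))))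
  refine (binOp_assoc_iff hsh m hα s₀ s₁ t₀ t₁ u₀ u₁ v₀ v₁ rfl rfl rfl (add_assoc i j l).symm
    a₁ a₂ a₃ hr hb φ h0 φ' h1).1 ?_
  have := σ.assoc α h₁₂ h₂₃ s hs t ht u hu v hv s₀ s₁ t₀ t₁ u₀ u₁ v₀ v₁ rfl rfl rfl
    (add_assoc i j l).symm a₁ a₂ a₃
  rwa [hσ, hσ, hσ, hσ] at this

/-- The binary operations determine the family of operations. -/
theorem eq_of_binOp_eq {m m' : ∀ T : Per, T.k = 2 → EndObj A T ε}
    (h : ∀ {n n₁ n₂ : ℕ+} (r : Fin n → Fin 2) (h₁ : fibCard r 0 = n₁) (h₂ : fibCard r 1 = n₂)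
      {i j d : ℤ} (h : i + j = d), binOp hsh m r h₁ h₂ h = binOp hsh m' r h₁ h₂ h) : m = m' := by
  funext T hT
  obtain ⟨n, κ, r, hr⟩ := T
  obtain rfl : κ = 2 := hT
  apply EndObj.ext_ev
  intro b hb
  obtain ⟨n₁, i, a, e₁⟩ := exists_eq_regrade hsh (b (0 : Fin 2))
  obtain ⟨n₂, j, a', e₂⟩ := exists_eq_regrade hsh (b (1 : Fin 2))
  obtain rfl : b = ![A.elt a, A.elt a'] := by
    rw [← e₁, ← e₂]
    exact fun_eq_vec₂ b
  have h₁ : fibCard r 0 = n₁ := congrArg PNat.val (hb (0 : Fin 2))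
  have h₂ : fibCard r 1 = n₂ := congrArg PNat.val (hb (1 : Fin 2))
  apply sgn_mul_cancel (i := ε * sh i)
  rw [← elt_binOp hsh m r h₁ h₂ rfl a a' hb, ← elt_binOp hsh m' r h₁ h₂ rfl a a' hb, h]

/-- The family of operations corresponding to the operations of a permutad. -/
def ofBinOp (hsh : ∀ d, sh d = d - ε) (σ : PermutadStr (A.regrade sh)) :
    ∀ T : Per, T.k = 2 → EndObj A T ε
  | ⟨n, 2, r, hr⟩, rfl => fun i => sgn k (ε * i.d (0 : Fin 2)) •
    multilin (A := A) (c := i.c) (d := i.d)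
      (((σ.op (n := n) (n₁ := i.c (0 : Fin 2)) (n₂ := i.c (1 : Fin 2)) r
          (congrArg PNat.val (i.hc (0 : Fin 2))) (congrArg PNat.val (i.hc (1 : Fin 2)))
          (i := i.d (0 : Fin 2) + ε) (j := i.d (1 : Fin 2) + ε) (d := i.D + ε) (by
            have h1 := i.hD
            have h2 := Fin.sum_univ_two i.d
            have h3 := h1.symm.trans (congrArg (fun s => ε + s) h2)
            rw [h3]
            ring)).compl₁₂
        (A.tr rfl (by rw [hsh]; omega)).toLinearMap
        (A.tr rfl (by rw [hsh]; omega)).toLinearMap).compr₂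
        (A.tr i.hn (by rw [hsh]; omega)).toLinearMap)

theorem binOp_ofBinOp (σ : PermutadStr (A.regrade sh)) {n n₁ n₂ : ℕ+} (r : Fin n → Fin 2)
    (h₁ : fibCard r 0 = n₁) (h₂ : fibCard r 1 = n₂) {i j d : ℤ} (h : i + j = d) :
    binOp hsh (ofBinOp hsh σ) r h₁ h₂ h = σ.op r h₁ h₂ h := by
  apply LinearMap.ext₂
  intro a b
  apply A.elt_injective
  have key : ∀ {i' j' d' : ℤ} (hi : i' = i) (hj : j' = j) (hd : d' = d) (h' : i' + j' = d')
      (hi' : sh i = sh i') (hj' : sh j = sh j') (hd' : sh d' = sh d),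
      A.elt (A.tr rfl hd' (σ.op r h₁ h₂ h' (A.tr rfl hi' a) (A.tr rfl hj' b))) =
        A.elt (d := sh d) (σ.op r h₁ h₂ h a b) := by
    intro i' j' d' hi hj hd
    subst hi hj hd
    intros
    rfl
  -- The twist is applied once in `ofBinOp` and once in `binOp`; the rest is transport along `sh d +
  -- ε = d`.
  refine Eq.trans (congrArg (A.elt (d := sh d)) (sgn_smul_sgn_smul (ε * sh i) _)) ?_
  have hshε : ∀ d, sh d + ε = d := fun d => by rw [hsh]; omega
  exact key (hshε i) (hshε j) (hshε d) _ _ _ _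

end Structure

end PerOperads

/-! ### Comparison of algebras with permutads -/

namespace PerOperads

open Per

universe u

variable {k : Type u} [Field k]

section Generation

variable {M : MarklOperad k}

/-- A family of subspaces of an operad is a suboperad if it contains the units and is closed under
the circle products. -/
structure IsSuboperad (M : MarklOperad k) (W : ∀ X d, Submodule k (M.obj X d)) : Prop where
  one : ∀ n, M.one n ∈ W (term n) 0
  circ : ∀ {F T S : Per} (φ : Elem F T S) {i j d : ℤ} (h : i + j = d) (x : M.obj S i)
    (y : M.obj F j), x ∈ W S i → y ∈ W F j → M.circ φ h x y ∈ W T d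

/-- A suboperad as an operad. -/
def IsSuboperad.operad {W : ∀ X d, Submodule k (M.obj X d)} (hW : IsSuboperad M W) :
    MarklOperad k where
  obj X d := ModuleCat.of k (W X d)
  circ {F T S} φ {i j d} h := LinearMap.mk₂ k
    (fun (x : W S i) (y : W F j) => (⟨M.circ φ h x.1 y.1, hW.circ φ h _ _ x.2 y.2⟩ : W T d))
    (fun x x' y => Subtype.ext (by simp)) (fun c x y => Subtype.ext (by simp))
    (fun x y y' => Subtype.ext (by simp)) (fun c x y => Subtype.ext (by simp))
  one n := (⟨M.one n, hW.one n⟩ : W (term n) 0)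
  joint φ ψ ξ χ hi _ _ _ _ _ _ h₁ h₂ h₃ h₄ x y z :=
    Subtype.ext (M.joint φ ψ ξ χ hi h₁ h₂ h₃ h₄ x.1 y.1 z.1)
  disjoint φ' ψ' φ'' ψ'' hi hj hij _ _ _ _ _ _ h₁ h₂ h₃ h₄ x g f :=
    Subtype.ext (M.disjoint φ' ψ' φ'' ψ'' hi hj hij h₁ h₂ h₃ h₄ x.1 g.1 f.1)
  one_circ φ _ h x := Subtype.ext (M.one_circ φ h x.1)

/-- The inclusion of a suboperad. -/
def IsSuboperad.incl {W : ∀ X d, Submodule k (M.obj X d)} (hW : IsSuboperad M W) :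
    hW.operad ⟶ M :=
  MarklOperad.Hom.mk (fun X d => (W X d).subtype) (fun _ _ _ _ _ _ _ => rfl) (fun _ => rfl)

/-- The universal property gives a morphism from `M` to the suboperad; followed by the inclusion it
fixes the generators, so it is the identity of `M`. -/
theorem IsFreeOn.generation {ε : ℤ} {m₀ : ∀ T : Per, T.k = 2 → M.obj T ε} (hM : IsFreeOn M ε m₀)
    {W : ∀ X d, Submodule k (M.obj X d)} (hW : IsSuboperad M W)
    (hm : ∀ T hT, m₀ T hT ∈ W T ε) (X : Per) (d : ℤ) (x : M.obj X d) : x ∈ W X d := by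
  obtain ⟨f, hf⟩ := hM.exists_hom hW.operad (fun T hT => (⟨m₀ T hT, hm T hT⟩ : W T ε))
    fun φ φ' hF hS hF' hS' h0 h1 _ h => Subtype.ext (hM.rel φ φ' hF hS hF' hS' h0 h1 h)
  have e : f ≫ hW.incl = 𝟙 M := hM.hom_ext _ _ fun T hT =>
    congrArg (hW.incl.app T ε) (hf T hT)
  have : hW.incl.app X d (f.app X d x) = x := congrArg (fun g : M ⟶ M => g.app X d x) e
  rw [← this]
  exact Subtype.property (p := fun y => y ∈ W X d) (f.app X d x)

end Generation

theorem vec₂_eq {β : Type*} {a b : β} {f : Fin 2 → β} (h0 : a = f 0) (h1 : b = f 1) :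
    ![a, b] = f := by
  rw [h0, h1]
  exact (fun_eq_vec₂ f).symm

section Morphisms

variable {M : MarklOperad k} {A B : Coll k}

/-- A morphism of collections on homogeneous elements. -/
def Coll.mapElt (f : A ⟶ B) (e : A.Elt) : B.Elt := B.elt (f e.1 e.2.1 e.2.2)

theorem Coll.mapElt_smul (f : A ⟶ B) (s : k) (e : A.Elt) :
    Coll.mapElt f (e.smul s) = (Coll.mapElt f e).smul s :=
  congrArg B.elt (map_smul (f e.1 e.2.1).hom s e.2.2)

/-- A morphism of collections intertwines two operations. -/
def Intertwines (f : A ⟶ B) {T : Per} {p : ℤ} (x : EndObj A T p) (y : EndObj B T p) : Prop :=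
  ∀ i : EndIdx T p, ∀ a : ∀ j, A (i.c j) (i.d j),
    f i.n i.D (x i a) = y i fun j => f (i.c j) (i.d j) (a j)

theorem intertwines_iff {f : A ⟶ B} {T : Per} {p : ℤ} {x : EndObj A T p} {y : EndObj B T p} :
    Intertwines f x y ↔
      ∀ b hb, Coll.mapElt f (x.ev b hb) = y.ev (fun j => Coll.mapElt f (b j)) hb := by
  constructor
  · intro h b hb
    exact congrArg B.elt (h ⟨T.n, rfl, _, hb, _, _, rfl⟩ fun j => (b j).2.2)
  · rintro h ⟨n, hn, c, hc, d, D, hD⟩ a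
    subst hn hD
    exact B.elt_injective (h (fun j => A.elt (a j)) hc)

theorem Intertwines.graft {f : A ⟶ B} {F T S : Per} (φ : Elem F T S) {j : ℤ}
    {y : EndObj A F j} {y' : EndObj B F j} (hy : Intertwines f y y') (b : Fin T.k → A.Elt)
    (hb : ∀ t, T.src t = (b t).1) (hb' : ∀ t, T.src t = (Coll.mapElt f (b t)).1) (t : Fin S.k) :
    Coll.mapElt f (EndObj.graft φ y b hb t) =
      EndObj.graft φ y' (fun t => Coll.mapElt f (b t)) hb' t := by
  unfold EndObj.graft
  by_cases ht : t = φ.idx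
  · rw [if_pos ht, if_pos ht]
    exact intertwines_iff.1 hy _ _
  · rw [if_neg ht, if_neg ht]

theorem Intertwines.circ {f : A ⟶ B} {F T S : Per} (φ : Elem F T S) {i j d : ℤ} (h : i + j = d)
    {x : EndObj A S i} {x' : EndObj B S i} {y : EndObj A F j} {y' : EndObj B F j}
    (hx : Intertwines f x x') (hy : Intertwines f y y') :
    Intertwines f (EndObj.circ φ h x y) (EndObj.circ φ h x' y') := by
  refine intertwines_iff.2 fun b hb => ?_
  have hb' : ∀ t, T.src t = (Coll.mapElt f (b t)).1 := hb
  have e : ∀ t, S.src t = (Coll.mapElt f (EndObj.graft φ y b hb t)).1 :=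
    EndObj.graft_src φ y b hb
  have e1 := EndObj.ev_circ φ h x y b hb
  have e2 := EndObj.ev_circ φ h x' y' (fun t => Coll.mapElt f (b t)) hb'
  have e3 := intertwines_iff.1 hx (EndObj.graft φ y b hb) (EndObj.graft_src φ y b hb)
  have e4 := EndObj.ev_congr x' (funext (hy.graft φ b hb hb')) e
  rw [e1, Coll.mapElt_smul, e3, e4]
  exact e2.symm

variable {ε : ℤ} {m₀ : ∀ T : Per, T.k = 2 → M.obj T ε}

/-- A morphism of collections which commutes with the generating operations commutes with all
operations. -/
theorem IsFreeOn.intertwines (hM : IsFreeOn M ε m₀) (g : M ⟶ endOperad A) (h : M ⟶ endOperad B)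
    (f : A ⟶ B) (hf : ∀ T hT, Intertwines f (g.app T ε (m₀ T hT)) (h.app T ε (m₀ T hT)))
    (X : Per) (d : ℤ) (x : M.obj X d) : Intertwines f (g.app X d x) (h.app X d x) := by
  let W : ∀ X d, Submodule k (M.obj X d) := fun X d =>
    { carrier := {x | Intertwines f (g.app X d x) (h.app X d x)}
      zero_mem' := fun i a => by
        rw [map_zero, map_zero]
        exact map_zero (f i.n i.D).hom
      add_mem' := fun {x y} hx hy i a => by
        rw [map_add, map_add]
        exact (map_add (f i.n i.D).hom _ _).trans (congrArg₂ (· + ·) (hx i a) (hy i a))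
      smul_mem' := fun c x hx i a => by
        rw [map_smul, map_smul]
        exact (map_smul (f i.n i.D).hom _ _).trans (congrArg (c • ·) (hx i a)) }
  have hW : IsSuboperad M W :=
    { one := fun n => by
        change Intertwines f (g.app _ _ (M.one n)) (h.app _ _ (M.one n))
        rw [g.map_one, h.map_one]
        refine intertwines_iff.2 fun b hb => ?_
        exact (congrArg (Coll.mapElt f) (EndObj.ev_one n b hb)).trans
          (EndObj.ev_one (A := B) n (fun j => Coll.mapElt f (b j)) hb).symm
      circ := fun φ _ _ _ e x y hx hy => by
        change Intertwines f (g.app _ _ (M.circ φ e x y)) (h.app _ _ (M.circ φ e x y))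
        rw [g.map_circ, h.map_circ]
        exact Intertwines.circ φ e hx hy }
  exact hM.generation hW hf X d x

variable {sh : ℤ → ℤ}

theorem intertwines_binary (hsh : ∀ d, sh d = d - ε) {f : A ⟶ B}
    {m : ∀ T : Per, T.k = 2 → EndObj A T ε} {m' : ∀ T : Per, T.k = 2 → EndObj B T ε}
    (h : ∀ {n n₁ n₂ : ℕ+} (r : Fin n → Fin 2) (h₁ : fibCard r 0 = n₁) (h₂ : fibCard r 1 = n₂)
      {i j d : ℤ} (h : i + j = d) (a : A n₁ (sh i)) (b : A n₂ (sh j)),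
      f n (sh d) (binOp hsh m r h₁ h₂ h a b) =
        binOp hsh m' r h₁ h₂ h (f n₁ (sh i) a) (f n₂ (sh j) b)) (T : Per) (hT : T.k = 2) :
    Intertwines f (m T hT) (m' T hT) := by
  obtain ⟨n, κ, r, hr⟩ := T
  obtain rfl : κ = 2 := hT
  rw [intertwines_iff]
  intro b hb
  obtain ⟨n₁, i, a, e₁⟩ := exists_eq_regrade hsh (b (0 : Fin 2))
  obtain ⟨n₂, j, a', e₂⟩ := exists_eq_regrade hsh (b (1 : Fin 2))
  obtain rfl : b = ![A.elt a, A.elt a'] := by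
    rw [← e₁, ← e₂]
    exact fun_eq_vec₂ b
  have h₁ : fibCard r 0 = n₁ := congrArg PNat.val (hb (0 : Fin 2))
  have h₂ : fibCard r 1 = n₂ := congrArg PNat.val (hb (1 : Fin 2))
  apply sgn_mul_cancel (i := ε * sh i)
  rw [← Coll.mapElt_smul, ← elt_binOp hsh m r h₁ h₂ rfl a a' hb]
  refine (congrArg (B.elt (d := sh (i + j))) (h r h₁ h₂ rfl a a')).trans ?_
  rw [elt_binOp hsh m' r h₁ h₂ rfl _ _ (src_eq_fst h₁ h₂ _ rfl rfl)]
  refine congrArg (Coll.Elt.smul _) (EndObj.ev_congr _ ?_ _)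
  exact vec₂_eq rfl rfl

theorem Intertwines.binOp (hsh : ∀ d, sh d = d - ε) {f : A ⟶ B}
    {m : ∀ T : Per, T.k = 2 → EndObj A T ε} {m' : ∀ T : Per, T.k = 2 → EndObj B T ε}
    (h : ∀ T hT, Intertwines f (m T hT) (m' T hT)) {n n₁ n₂ : ℕ+} (r : Fin n → Fin 2)
    (h₁ : fibCard r 0 = n₁) (h₂ : fibCard r 1 = n₂) {i j d : ℤ} (hd : i + j = d)
    (a : A n₁ (sh i)) (b : A n₂ (sh j)) :
    f n (sh d) (binOp hsh m r h₁ h₂ hd a b) =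
      binOp hsh m' r h₁ h₂ hd (f n₁ (sh i) a) (f n₂ (sh j) b) := by
  have hr := surjective_of_fibCard h₁ h₂
  have hb : ∀ t, Per.src ⟨n, 2, r, hr⟩ t = (![A.elt a, A.elt b] t).1 := fun t =>
    src_eq_fst h₁ h₂ hr rfl rfl t
  have hb' : ∀ t, Per.src ⟨n, 2, r, hr⟩ t =
      (![B.elt (f n₁ (sh i) a), B.elt (f n₂ (sh j) b)] t).1 := fun t =>
    src_eq_fst h₁ h₂ hr rfl rfl t
  apply B.elt_injective
  rw [elt_binOp hsh m' r h₁ h₂ hd _ _ hb']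
  refine (congrArg (Coll.mapElt f) (elt_binOp hsh m r h₁ h₂ hd a b hb)).trans ?_
  rw [Coll.mapElt_smul, intertwines_iff.1 (h _ _)]
  exact congrArg (Coll.Elt.smul _) (EndObj.ev_congr _ (vec₂_eq rfl rfl).symm _)

end Morphisms

section Comparison

variable {M : MarklOperad k} {ε : ℤ} {m₀ : ∀ T : Per, T.k = 2 → M.obj T ε} {sh : ℤ → ℤ}

/-- The generating operations of an algebra. -/
def Algebra.binary (m₀ : ∀ T : Per, T.k = 2 → M.obj T ε) (A : Algebra M) :
    ∀ T : Per, T.k = 2 → EndObj A.coll T ε := fun T hT => A.str.toHom.app T ε (m₀ T hT)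

theorem Algebra.Hom.intertwines {A B : Algebra M} (f : A ⟶ B) {T : Per} {p : ℤ} (x : M.obj T p) :
    Intertwines f.map (A.str.toHom.app T p x) (B.str.toHom.app T p x) :=
  fun i a => f.map_act T i.hn i.hc i.hD x a

/-- The functor from algebras over an operad generated by elements of degree `ε`, subject to the
quadratic relation, to permutads. -/
def toPermutad (hM : IsFreeOn M ε m₀) (hsh : ∀ d, sh d = d - ε) : Algebra M ⥤ Permutad k where
  obj A := ⟨A.coll.regrade sh, binStr hsh (A.binary m₀) (QuadRel.map hM.rel A.str.toHom)⟩
  map f := Permutad.Hom.mk (fun n d => f.map n (sh d)) fun r h₁ h₂ _ _ _ h a b =>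
    Intertwines.binOp hsh (fun T hT => f.intertwines (m₀ T hT)) r h₁ h₂ h a b

variable (hM : IsFreeOn M ε m₀) (hsh : ∀ d, sh d = d - ε)

/-- The renumbering `sh` is a shift, hence bijective, and families along it extend to all degrees.
This is applied to maps and, with constant `P`, to the graded pieces themselves. -/
theorem exists_extension (hsh : ∀ d, sh d = d - ε) {P : ℤ → Type*} (g : ∀ d, P (sh d)) :
    ∃ f : ∀ d, P d, ∀ d, f (sh d) = g d := by
  have h : ∀ d, sh (d + ε) = d := fun d => by rw [hsh]; omega
  refine ⟨fun d => h d ▸ g (d + ε), fun d => ?_⟩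
  have key : ∀ d' (e : sh d' = sh d), e ▸ g d' = g d := by
    intro d' e
    obtain rfl : d' = d := by rw [hsh, hsh] at e; omega
    rfl
  exact key _ _

theorem toPermutad_map_injective {A B : Algebra M} :
    Function.Injective ((toPermutad hM hsh).map : (A ⟶ B) → _) := by
  intro f g h
  apply Algebra.Hom.ext
  funext n d
  obtain ⟨d, rfl⟩ : ∃ j, sh j = d := ⟨d + ε, by rw [hsh]; omega⟩
  exact congrArg (fun f : (toPermutad hM hsh).obj A ⟶ (toPermutad hM hsh).obj B => f.map n d) h

theorem toPermutad_map_surjective {A B : Algebra M} :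
    Function.Surjective ((toPermutad hM hsh).map : (A ⟶ B) → _) := by
  intro g
  have key := fun n => exists_extension hsh (P := fun d => A.coll n d ⟶ B.coll n d)
    fun d => g.map n d
  choose f hf using key
  obtain ⟨f, rfl⟩ : ∃ f' : A.coll ⟶ B.coll, f' = f := ⟨f, rfl⟩
  have h := intertwines_binary (m := A.binary m₀) (m' := B.binary m₀) hsh (f := f)
    (fun r h₁ h₂ i j d h a b => by
      rw [hf, hf, hf]
      exact g.map_op r h₁ h₂ h a b)
  have h' := hM.intertwines A.str.toHom B.str.toHom f h
  refine ⟨Algebra.Hom.mk f fun T n hn c hc p d D hD x a => h' T p x ⟨n, hn, c, hc, d, D, hD⟩ a, ?_⟩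
  apply Permutad.Hom.ext
  funext n d
  exact hf n d

/-- The shifted collection determines the collection, the permutad operations determine the
generating operations, and these determine the morphism to the endomorphism operad, which is the
algebra structure. -/
theorem toPermutad_obj_injective : Function.Injective (toPermutad hM hsh).obj := by
  rintro ⟨A, σ⟩ ⟨B, τ⟩ h
  obtain rfl : A = B := by
    have h' := congrArg Permutad.coll h
    funext n d
    obtain ⟨d, rfl⟩ : ∃ j, sh j = d := ⟨d + ε, by rw [hsh]; omega⟩
    exact congrFun (congrFun h' n) d
  have h1 : binStr hsh (Algebra.binary m₀ ⟨A, σ⟩) (QuadRel.map hM.rel σ.toHom) =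
      binStr hsh (Algebra.binary m₀ ⟨A, τ⟩) (QuadRel.map hM.rel τ.toHom) :=
    eq_of_heq (Permutad.mk.inj h).2
  have h2 : Algebra.binary m₀ ⟨A, σ⟩ = Algebra.binary m₀ ⟨A, τ⟩ :=
    eq_of_binOp_eq hsh fun r h₁ h₂ _ _ _ h =>
      congrArg (fun s : PermutadStr (A.regrade sh) => s.op r h₁ h₂ h) h1
  have h3 : σ.toHom = τ.toHom := hM.hom_ext _ _ fun T hT => congrFun (congrFun h2 T) hT
  rw [← σ.ofHom_toHom, ← τ.ofHom_toHom, h3]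

/-- Undoing the shift and the twist gives operations of degree `ε`; associativity makes them satisfy
the quadratic relation, and freeness extends them to an algebra structure. -/
theorem toPermutad_obj_surjective : Function.Surjective (toPermutad hM hsh).obj := by
  rintro ⟨P, σ⟩
  obtain ⟨A, rfl⟩ : ∃ A : Coll k, A.regrade sh = P := by
    choose A hA using fun n => exists_extension hsh (P := fun _ => ModuleCat.{u} k) (P n)
    exact ⟨A, funext fun n => funext fun d => hA n d⟩
  have hσ : ∀ {n n₁ n₂ : ℕ+} (r : Fin n → Fin 2) (h₁ : fibCard r 0 = n₁) (h₂ : fibCard r 1 = n₂)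
      {i j d : ℤ} (h : i + j = d),
      σ.op r h₁ h₂ h = binOp hsh (ofBinOp hsh σ) r h₁ h₂ h := fun r h₁ h₂ _ _ _ h =>
    (binOp_ofBinOp hsh σ r h₁ h₂ h).symm
  obtain ⟨f, hf⟩ := hM.exists_hom (endOperad A) _ (quadRel_of_assoc hsh _ σ hσ)
  refine ⟨⟨A, AlgebraStr.ofHom f⟩, ?_⟩
  have e : Algebra.binary m₀ ⟨A, AlgebraStr.ofHom f⟩ = ofBinOp hsh σ :=
    funext fun T => funext fun hT => hf T hT
  refine congrArg (Permutad.mk (A.regrade sh)) ?_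
  obtain ⟨op, assoc⟩ := σ
  simp only [binStr, PermutadStr.mk.injEq]
  funext n n₁ n₂ r h₁ h₂ i j d h
  rw [e]
  exact (hσ r h₁ h₂ h).symm

end Comparison

/-- The inverse takes the unique preimage of each object and, after conjugation with `eqToHom`, the
unique preimage of each morphism. -/
theorem isIsoOfCategories_of_bijective {C D : Type*} [Category C] [Category D] (Φ : C ⥤ D)
    (h : ∀ X Y, Function.Bijective (Φ.map : (X ⟶ Y) → _)) (hobj : Function.Bijective Φ.obj) :
    IsIsoOfCategories Φ := by
  have : Φ.Faithful := ⟨fun {X Y} _ _ e => (h X Y).1 e⟩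
  have : Φ.Full := ⟨fun {X Y} g => (h X Y).2 g⟩
  choose G hG using hobj.2
  have hG' : ∀ X, G (Φ.obj X) = X := fun X => hobj.1 (hG _)
  let Ψ : D ⥤ C :=
    { obj := G
      map := fun {X Y} g => Φ.preimage (eqToHom (hG X) ≫ g ≫ eqToHom (hG Y).symm)
      map_id := fun X => Φ.map_injective (by simp)
      map_comp := fun f g => Φ.map_injective (by simp) }
  refine ⟨Ψ, CategoryTheory.Functor.ext hG' fun X Y f => Φ.map_injective ?_,
    CategoryTheory.Functor.ext hG fun X Y f => ?_⟩
  · simp [Ψ, eqToHom_map]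
  · simp [Ψ]

theorem toPermutad_isIso {M : MarklOperad k} {ε : ℤ} {m₀ : ∀ T : Per, T.k = 2 → M.obj T ε}
    {sh : ℤ → ℤ} (hM : IsFreeOn M ε m₀) (hsh : ∀ d, sh d = d - ε) :
    IsIsoOfCategories (toPermutad hM hsh) :=
  isIsoOfCategories_of_bijective _
    (fun _ _ => ⟨toPermutad_map_injective hM hsh, toPermutad_map_surjective hM hsh⟩)
    ⟨toPermutad_obj_injective hM hsh, toPermutad_obj_surjective hM hsh⟩

end PerOperads

/-! ### The theorem -/

theorem theorem13p4 {k : Type*} [Field k] [CharZero k] :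
    (∃ Φ : PerOperads.Algebra (PerOperads.terminalOperad k) ⥤ PerOperads.Permutad k,
      PerOperads.IsIsoOfCategories Φ ∧
      Φ ⋙ PerOperads.Permutad.forget k = PerOperads.Algebra.forget _ ∧
      ∀ A, ∃ s : PerOperads.PermutadStr A.coll, Φ.obj A = ⟨A.coll, s⟩ ∧
        ∀ {n : ℕ+} (r : Fin n → Fin 2) (hr : Function.Surjective r) (c : Fin 2 → ℕ+)
          (h₁ : PerOperads.fibCard r 0 = c 0) (h₂ : PerOperads.fibCard r 1 = c 1)
          (hc : ∀ j, PerOperads.Per.src ⟨n, 2, r, hr⟩ j = c j) (d : Fin 2 → ℤ) {D : ℤ}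
          (hd : d 0 + d 1 = D) (hD : 0 + ∑ j, d j = D) (a : ∀ j, A.coll (c j) (d j)),
          s.op r h₁ h₂ hd (a 0) (a 1) =
            A.str.act ⟨n, 2, r, hr⟩ rfl hc hD
              (⟨1, fun h => absurd rfl h⟩ : PerOperads.groundField k 0) a) ∧
    (PerOperads.terminalOperad k).IsBinaryQuadratic ∧
    (∀ D : PerOperads.QuadraticData k, D.IsBinary →
      Nonempty (D.operad ≅ PerOperads.terminalOperad k) →
      ∃ Φ : PerOperads.Algebra D.koszulDual ⥤ PerOperads.Permutad k,
        PerOperads.IsIsoOfCategories Φ ∧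
        Φ ⋙ PerOperads.Permutad.forget k =
          PerOperads.Algebra.forget _ ⋙ PerOperads.suspension k) := by
  -- The renumbering is the identity function rather than `d ↦ d - 0`, so that the two forgetful
  -- functors agree by definition.
  refine ⟨⟨PerOperads.toPermutad (sh := fun d => d) PerOperads.isFreeOn_terminal
      fun d => (sub_zero d).symm, PerOperads.toPermutad_isIso _ _, rfl, fun A => ⟨_, rfl, ?_⟩⟩,
    PerOperads.terminalOperad_isBinaryQuadratic, fun D hD ⟨θ⟩ => ?_⟩
  · intro n r hr c h₁ h₂ hc d D hd hD a
    apply A.coll.elt_injective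
    have hb : ∀ t, PerOperads.Per.src ⟨n, 2, r, hr⟩ t =
        (![A.coll.elt (a 0), A.coll.elt (a 1)] t).1 := fun t =>
      PerOperads.src_eq_fst h₁ h₂ hr rfl rfl t
    refine (PerOperads.elt_binOp (sh := fun d => d) (fun d => (sub_zero d).symm)
      (A.binary fun T _ => PerOperads.termOne k T) r h₁ h₂ hd (a 0) (a 1) hb).trans ?_
    -- For `ε = 0` the twist is trivial, and the operation is the action of the unit itself.
    rw [zero_mul, PerOperads.sgn_zero, PerOperads.Coll.Elt.one_smul]
    refine Eq.trans ?_ (PerOperads.EndObj.elt_apply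
      (A.binary (fun T _ => PerOperads.termOne k T) ⟨n, 2, r, hr⟩ rfl) rfl hc hD a).symm
    exact PerOperads.EndObj.ev_congr _
      (PerOperads.vec₂_eq (f := fun j : Fin 2 => A.coll.elt (a j)) rfl rfl) _
  · obtain ⟨m, hm⟩ := D.koszulDual_isFreeOn hD θ
    exact ⟨PerOperads.toPermutad (sh := fun d => d - 1) hm fun _ => rfl,
      PerOperads.toPermutad_isIso _ _, rfl⟩
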